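/- **Definitions.** Let $X$ be a nonempty countable set. A resistance form on $X$ is a pair $(\mathcal E,\mathcal F)$ such that - (RF1) $\mathcal F$ is a linear space of functions $X\to\mathbb R$ containing the constants, $\mathcal E$ is a nonnegative symmetric bilinear form on $\mathcal F$, and $\mathcal E(u,u)=0$ if and only if $u$ is constant; - (RF2) $\mathcal F$ modulo constants is complete with respect to $\mathcal E(u,u)^{1/2}$; - (RF3) every real function on a finite subset $V\subset X$ is the restriction to $V$ of some $u\in\mathcal F$; - (RF4) for all $x,y\in X$, $\sup\{(u(x)-u(y))^2/\mathcal E(u,u): u\in\mathcal F,\ \mathcal E(u,u)>0\}<\infty$; - (RF5) if $u\in\mathcal F$ then $\bar u=\max(0,\min(1,u))\in\mathcal F$ and $\mathcal E(\bar u,\bar u)\le\mathcal E(u,u)$. Let $\mathcal B\subset\mathcal F$ be the space of bounded functions in $\mathcal F$, $A(\mathcal B)$ the $C^*$-algebra of bounded functions $X\to\mathbb C$ generated by $\mathcal B$ (with the supremum norm), $\Delta$ the Gelfand spectrum of $A(\mathcal B)$, $f\mapsto\hat f$ the Gelfand transform, and $\iota:X\to\Delta$, $\iota(x)(a)=a(x)$.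 A Dirichlet form is a densely defined, symmetric, nonnegative, closed bilinear form on a real $L^2$-space on which the unit contraction $u\mapsto\max(0,\min(1,u))$ operates; write $\mathcal E_1(u)=\mathcal E(u,u)+\|u\|_{L^2}^2$. A Dirichlet form with domain $\mathcal D$ on $L^2(Y,m)$ is regular if $Y$ is a locally compact Hausdorff space, $m$ is a Radon measure of full support, and $\mathcal D\cap C_c(Y)$ is $\mathcal E_1$-dense in $\mathcal D$ and uniformly dense in $C_c(Y)$. **Theorem.** Let $(\mathcal E,\mathcal F)$ be a resistance form on a nonempty countable set $X$. There exists a finite measure $\mu$ on $X$ (with all subsets measurable) such that: 1. $\mu(\{x\})>0$ for every $x\in X$, and $\mathcal F\subset L^2(X,\mu)$. 2. $(\mathcal E,\mathcal F)$ is a Dirichlet form on $L^2(X,\mu)$. 3. $A(\mathcal B)$ is the uniform closure of $\mathcal B+i\mathcal B$; $\iota$ is injective with dense range; the image measure $\hat\mu=\mu\circ\iota^{-1}$ satisfies $\int_X f\,d\mu=\int_\Delta\hat f\,d\hat\mu$ for all $f\in\mathcal B$; and the form $\hat{\mathcal E}(\hat f,\hat g)=\mathcal E(f,g)$, $f,g\in\mathcal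 B$, is closable on $L^2(\Delta,\hat\mu)$ and its closure is a regular Dirichlet form. If $\mathcal B$ is separable in the supremum norm, then $\Delta$ is second countable. 4. There is a Markov process associated with the form: there are a strongly continuous contraction semigroup $(T_t)_{t\ge0}$ on $L^2(X,\mu)$ whose generator $A$ is given by "$u\in\operatorname{dom}A$ and $Au=g$ if and only if $u\in\mathcal F$ and $\mathcal E(u,v)=-\langle g,v\rangle_{L^2(X,\mu)}$ for all $v\in\mathcal F$", and probability measures $(P_x)_{x\in X}$ on $X^{[0,\infty)}$ (with the product $\sigma$-algebra) such that the coordinate process $(Z_t)_{t\ge0}$ satisfies $Z_0=x$ $P_x$-almost surely, $P_x(Z_{s+t}\in B\mid\sigma(Z_r:r\le s))=P_{Z_s}(Z_t\in B)$ $P_x$-almost surely for all $x\in X$, $s,t\ge0$, $B\subset X$, and $T_tu(x)=\int u(Z_t)\,dP_x$ for all $u\in L^2(X,\mu)$, $t\ge0$, $x\in X$ (the integrand being $P_x$-integrable). -/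

import Mathlib

open Filter Topology MeasureTheory ProbabilityTheory
open scoped ENNReal NNReal

noncomputable section

/-- A real bilinear form `form` defined on a linear subspace `domain` of a real vector space. -/
structure FormOn (V : Type*) [AddCommGroup V] [Module ℝ V] where
  domain : Submodule ℝ V
  form : LinearMap.BilinForm ℝ domain

/-! ### Resistance forms -/

/-- Resistance forms `(E, F)` on a set `X`. -/
structure IsResistanceForm {X : Type*} (R : FormOn (X → ℝ)) : Prop where
  /-- (RF1) constants, symmetry, nonnegativity, kernel -/
  const_mem : ∀ c : ℝ, (fun _ => c) ∈ R.domain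
  symm : ∀ u v : R.domain, R.form u v = R.form v u
  nonneg : ∀ u : R.domain, 0 ≤ R.form u u
  eq_zero_iff : ∀ u : R.domain, R.form u u = 0 ↔ ∃ c : ℝ, ∀ x, u.1 x = c
  /-- (RF2) `F` modulo constants is complete for the norm `E(u, u)^{1/2}` -/
  complete : ∀ u : ℕ → R.domain,
    Tendsto (fun p : ℕ × ℕ => R.form (u p.1 - u p.2) (u p.1 - u p.2)) atTop (𝓝 0) →
      ∃ w : R.domain, Tendsto (fun n => R.form (u n - w) (u n - w)) atTop (𝓝 0)
  /-- (RF3) functions on finite sets extend to elements of `F` -/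
  extend : ∀ (V : Finset X) (v : V → ℝ), ∃ u : R.domain, ∀ x : V, u.1 x = v x
  /-- (RF4) the effective resistance between any two points is finite -/
  resistance_finite : ∀ x y : X,
    BddAbove {r : ℝ | ∃ u : R.domain, 0 < R.form u u ∧
      r = (u.1 x - u.1 y) ^ 2 / R.form u u}
  /-- (RF5) Markov property -/
  markov : ∀ u : R.domain, ∃ w : R.domain,
    (∀ x, w.1 x = max 0 (min 1 (u.1 x))) ∧ R.form w w ≤ R.form u u

/-! ### Dirichlet forms on `L²` -/

section Dirichlet

variable {Y : Type*} [MeasurableSpace Y] {m : Measure Y}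

/-- `E₁(u) = E(u, u) + ‖u‖²` on the domain of a form on `L²(Y, m)`. -/
def energyOne (D : FormOn (Lp ℝ 2 m)) (u : D.domain) : ℝ :=
  D.form u u + ‖(u : Lp ℝ 2 m)‖ ^ 2

/-- Symmetric Dirichlet forms on `L²(Y, m)`: densely defined, symmetric, nonnegative, closed,
Markovian. -/
structure IsDirichletForm (D : FormOn (Lp ℝ 2 m)) : Prop where
  dense : Dense (D.domain : Set (Lp ℝ 2 m))
  symm : ∀ u v : D.domain, D.form u v = D.form v u
  nonneg : ∀ u : D.domain, 0 ≤ D.form u u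
  closed : ∀ u : ℕ → D.domain,
    Tendsto (fun p : ℕ × ℕ => energyOne D (u p.1 - u p.2)) atTop (𝓝 0) →
      ∃ w : D.domain, Tendsto (fun n => energyOne D (u n - w)) atTop (𝓝 0)
  markov : ∀ u : D.domain, ∃ w : D.domain,
    ((w : Lp ℝ 2 m) : Y → ℝ) =ᵐ[m] (fun y => max 0 (min 1 ((u : Lp ℝ 2 m) y))) ∧
      D.form w w ≤ D.form u u

/-- Regular Dirichlet forms: `Y` is a locally compact Hausdorff space, `m` is a Radon measure of
full support, and `F ∩ C_c(Y)` is dense in `F` for the `E₁`-norm and in `C_c(Y)` for the uniform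
norm. -/
structure IsRegularDirichletForm [TopologicalSpace Y] (D : FormOn (Lp ℝ 2 m)) : Prop where
  isDirichletForm : IsDirichletForm D
  locallyCompact : LocallyCompactSpace Y
  hausdorff : T2Space Y
  radon : m.Regular
  fullSupport : m.IsOpenPosMeasure
  dense_domain : ∀ u : D.domain, ∀ ε > 0, ∃ v : D.domain,
    (∃ φ : Y → ℝ, Continuous φ ∧ HasCompactSupport φ ∧ ((v : Lp ℝ 2 m) : Y → ℝ) =ᵐ[m] φ) ∧
      energyOne D (u - v) < ε
  dense_continuous : ∀ φ : Y → ℝ, Continuous φ → HasCompactSupport φ → ∀ ε > 0,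
    ∃ ψ : Y → ℝ, Continuous ψ ∧ HasCompactSupport ψ ∧
      (∃ v : D.domain, ((v : Lp ℝ 2 m) : Y → ℝ) =ᵐ[m] ψ) ∧ ∀ y, |φ y - ψ y| < ε

/-- `T` is the strongly continuous contraction semigroup associated with the form `D`: its
infinitesimal generator `A` (the strong derivative of `T` at `0`) is the operator given by
`u ∈ dom A`, `A u = g` if and only if `u ∈ F` and `E(u, v) = -⟨g, v⟩` for all `v ∈ F`. -/
structure IsSemigroupOf (D : FormOn (Lp ℝ 2 m)) (T : ℝ≥0 → (Lp ℝ 2 m →L[ℝ] Lp ℝ 2 m)) :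
    Prop where
  zero : T 0 = ContinuousLinearMap.id ℝ (Lp ℝ 2 m)
  add : ∀ s t, T (s + t) = (T s).comp (T t)
  contraction : ∀ t, ‖T t‖ ≤ 1
  continuous : ∀ u, Continuous fun t => T t u
  generator : ∀ u g : Lp ℝ 2 m,
    Tendsto (fun t : ℝ≥0 => (t : ℝ)⁻¹ • (T t u - u)) (𝓝[>] 0) (𝓝 g) ↔
      ∃ hu : u ∈ D.domain, ∀ v : D.domain,
        D.form ⟨u, hu⟩ v = -(inner ℝ g (v : Lp ℝ 2 m))

end Dirichlet

/-- The form `D` on `L²(X, m)` is the form `R` of functions on `X`, each function being identified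
with its `m`-equivalence class. -/
structure IsL2Version {X : Type*} [MeasurableSpace X] {m : Measure X} (R : FormOn (X → ℝ))
    (D : FormOn (Lp ℝ 2 m)) : Prop where
  mem_domain_iff : ∀ u : Lp ℝ 2 m, u ∈ D.domain ↔ ∃ f : R.domain, (u : X → ℝ) =ᵐ[m] f.1
  form_eq : ∀ (u v : D.domain) (f g : R.domain),
    ((u : Lp ℝ 2 m) : X → ℝ) =ᵐ[m] f.1 → ((v : Lp ℝ 2 m) : X → ℝ) =ᵐ[m] g.1 →
      D.form u v = R.form f g

/-! ### The Gelfand spectrum -/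

section Gelfand

variable {X : Type*}

/-- The space `B` of bounded functions of finite energy. -/
def boundedDomain (R : FormOn (X → ℝ)) : Submodule ℝ (X → ℝ) where
  carrier := {f | f ∈ R.domain ∧ ∃ C : ℝ, ∀ x, |f x| ≤ C}
  zero_mem' := ⟨R.domain.zero_mem, 0, fun x => by simp⟩
  add_mem' := by
    rintro f g ⟨hf, C, hC⟩ ⟨hg, C', hC'⟩
    exact ⟨R.domain.add_mem hf hg, C + C', fun x =>
      (abs_add_le _ _).trans (add_le_add (hC x) (hC' x))⟩
  smul_mem' := by
    rintro c f ⟨hf, C, hC⟩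
    refine ⟨R.domain.smul_mem c hf, |c| * C, fun x => ?_⟩
    rw [Pi.smul_apply, smul_eq_mul, abs_mul]
    exact mul_le_mul_of_nonneg_left (hC x) (abs_nonneg c)

/-- The inclusion of `B` into the domain of the form. -/
def boundedIncl {R : FormOn (X → ℝ)} (f : boundedDomain R) : R.domain := ⟨f.1, f.2.1⟩

/-- The C*-algebra of all bounded functions `X → ℂ`, with the supremum norm. -/
abbrev BoundedFun (X : Type*) : Type _ := lp (fun _ : X => ℂ) ∞

/-- The element of `BoundedFun X` given by a bounded real function. -/
def toBoundedFun {R : FormOn (X → ℝ)} (f : boundedDomain R) : BoundedFun X :=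
  ⟨fun x => (f.1 x : ℂ), by
    obtain ⟨C, hC⟩ := f.2.2
    refine memℓp_infty ⟨C, ?_⟩
    rintro _ ⟨x, rfl⟩
    simpa using hC x⟩

/-- The C*-algebra `A(B)` of bounded functions generated by `B`. -/
def gelfandAlgebra (R : FormOn (X → ℝ)) : StarSubalgebra ℂ (BoundedFun X) :=
  (StarAlgebra.adjoin ℂ
    (Set.range (toBoundedFun : boundedDomain R → BoundedFun X))).topologicalClosure

instance (R : FormOn (X → ℝ)) : IsClosed (gelfandAlgebra R : Set (BoundedFun X)) :=
  StarSubalgebra.isClosed_topologicalClosure _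

/-- `A(B)` as a type, with the C*-algebra structure inherited from `BoundedFun X`. -/
def GelfandAlgebra (R : FormOn (X → ℝ)) : Type _ := gelfandAlgebra R

instance (R : FormOn (X → ℝ)) : CommCStarAlgebra (GelfandAlgebra R) :=
  inferInstanceAs (CommCStarAlgebra (gelfandAlgebra R))

/-- The spectrum `Δ` of `A(B)`: nonzero multiplicative continuous linear functionals with the
topology of pointwise convergence. -/
def GelfandSpectrum (R : FormOn (X → ℝ)) : Type _ :=
  WeakDual.characterSpace ℂ (GelfandAlgebra R)

instance (R : FormOn (X → ℝ)) : TopologicalSpace (GelfandSpectrum R) :=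
  inferInstanceAs (TopologicalSpace (WeakDual.characterSpace ℂ (GelfandAlgebra R)))

instance (R : FormOn (X → ℝ)) : MeasurableSpace (GelfandSpectrum R) := borel _

instance (R : FormOn (X → ℝ)) : BorelSpace (GelfandSpectrum R) := ⟨rfl⟩

/-- A function `f ∈ B` as an element of `A(B)`. -/
def toGelfandAlgebra {R : FormOn (X → ℝ)} (f : boundedDomain R) : GelfandAlgebra R :=
  (⟨toBoundedFun f, StarSubalgebra.le_topologicalClosure _
    (StarAlgebra.subset_adjoin ℂ _ ⟨f, rfl⟩)⟩ : gelfandAlgebra R)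

/-- The Gelfand transform of `f ∈ B`, as a real function on `Δ`. -/
def gelfand {R : FormOn (X → ℝ)} (f : boundedDomain R) (φ : GelfandSpectrum R) : ℝ :=
  (WeakDual.gelfandTransform ℂ (GelfandAlgebra R) (toGelfandAlgebra f) φ).re

/-- Evaluation at `x` as an algebra homomorphism on `A(B)`. -/
def evalHom (R : FormOn (X → ℝ)) (x : X) : GelfandAlgebra R →ₐ[ℂ] ℂ :=
  ({ toFun := fun a => (a : BoundedFun X) x
     map_one' := rfl
     map_mul' := fun _ _ => rfl
     map_zero' := rfl
     map_add' := fun _ _ => rfl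
     commutes' := fun c => by
       simp [Algebra.algebraMap_eq_smul_one] } : gelfandAlgebra R →ₐ[ℂ] ℂ)

/-- The map `ι : X → Δ`, `ι(x)(a) = a(x)`. -/
def gelfandEmbedding (R : FormOn (X → ℝ)) (x : X) : GelfandSpectrum R :=
  (WeakDual.CharacterSpace.equivAlgHom.symm (evalHom R x) :
    WeakDual.characterSpace ℂ (GelfandAlgebra R))

/-- `D` is the closure in `L²(Δ, m)` of the form `Ê(f̂, ĝ) = E(f, g)`, `f, g ∈ B`, when `D` is
closed: it extends this form, and the functions `f̂` are `E₁`-dense in its domain. -/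
structure IsTransferredForm {R : FormOn (X → ℝ)} {m : Measure (GelfandSpectrum R)}
    (D : FormOn (Lp ℝ 2 m)) : Prop where
  mem_domain : ∀ f : boundedDomain R, ∃ u : D.domain,
    ((u : Lp ℝ 2 m) : GelfandSpectrum R → ℝ) =ᵐ[m] gelfand f
  form_eq : ∀ (f g : boundedDomain R) (u v : D.domain),
    ((u : Lp ℝ 2 m) : GelfandSpectrum R → ℝ) =ᵐ[m] gelfand f →
    ((v : Lp ℝ 2 m) : GelfandSpectrum R → ℝ) =ᵐ[m] gelfand g →
      D.form u v = R.form (boundedIncl f) (boundedIncl g)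
  core : ∀ u : D.domain, ∀ ε > 0, ∃ (f : boundedDomain R) (v : D.domain),
    ((v : Lp ℝ 2 m) : GelfandSpectrum R → ℝ) =ᵐ[m] gelfand f ∧ energyOne D (u - v) < ε

end Gelfand

/-! ### Markov processes -/

/-- `(Z t)_{t ≥ 0}` under the probability measures `P x`, `x ∈ X`, is a (time-homogeneous, with
respect to its own history) Markov process with countable state space `X`, starting at `x`
under `P x`. -/
structure IsMarkovProcess {X Ω : Type*} [MeasurableSpace X] [MeasurableSpace Ω]
    (P : X → Measure Ω) (Z : ℝ≥0 → Ω → X) : Prop where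
  isProbabilityMeasure : ∀ x, IsProbabilityMeasure (P x)
  measurable : ∀ t, Measurable (Z t)
  start : ∀ x, ∀ᵐ ω ∂(P x), Z 0 ω = x
  markov : ∀ (x : X) (s t : ℝ≥0) (A : Set X), MeasurableSet A →
    (P x)[Set.indicator (Z (s + t) ⁻¹' A) (fun _ => (1 : ℝ)) |
        ⨆ r : Set.Iic s, MeasurableSpace.comap (Z r) inferInstance]
      =ᵐ[P x] fun ω => (P (Z s ω)).real (Z t ⁻¹' A)

end

/-! The effective resistance bound (RF4) reads `(f x - f x₀)² ≤ C x · E(f, f)` for a fixed base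
point `x₀`. Since `X` is countable, summable weights can be chosen small enough against `C` that the
atomic measure `μ` with these weights satisfies the Poincaré inequality `∫ (f - f x₀)² dμ ≤ E(f, f)`
(`IsResistanceForm.exists_isAdaptedMeasure`). This gives `F ⊂ L²(μ)`, and it turns completeness
modulo constants into closedness: an `E₁`-Cauchy sequence has an energy limit, and convergence at
the atom `x₀` fixes the free constant (`IsAtomicMap.closed_pullForm`). Functions equal to an
indicator on large finite sets give density. All this is done for the image of `μ` under an
injective map `i : X → Y`, so that `i = id` and `i = ι` are covered at once; since null sets are
exactly the sets missing the atoms, both `L²`-spaces consist of functions on `X`.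

The algebra is governed by the lattice structure of `B`. By (RF5), `B` is stable under maxima; a
square is a uniform limit of maxima of tangent lines, and products follow by polarization. Hence the
closure of `B + iB` is already a star algebra (`IsResistanceForm.closure_complexSpan`). With Gelfand
duality this yields uniform density of the transforms of `B` in the continuous functions on the
compact space `Δ`. Density of bounded functions in energy (`IsResistanceForm.exists_bounded_approx`)
then gives regularity and the core property.

For the process, the semigroup is the limit of the exponentials of the Yosida approximations of the
generator (`IsClosedForm.exists_semigroup`). The resolvent preserves the functions with values in
`[0, 1]`, because it minimizes a functional that truncation does not increase
(`IsResolvent.apply_mem_Icc`); so the semigroup is positive. It fixes the constant `1`, which has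
zero energy. Thus `p t x y = T t (1_y) x` is a conservative transition function, and Kolmogorov
extension over the discrete countable space produces the path measures (`exists_isProjectiveLimit`,
`IsTransitionFunction.isMarkovProcess`). -/

noncomputable section

/-! ### Closed forms on Hilbert spaces and their resolvents -/

section ClosedForm

variable {H : Type*} [NormedAddCommGroup H] [InnerProductSpace ℝ H]

/-- Densely defined, symmetric, nonnegative, closed forms on a real inner product space. -/
structure IsClosedForm (D : FormOn H) : Prop where
  dense : Dense (D.domain : Set H)
  symm : ∀ u v : D.domain, D.form u v = D.form v u
  nonneg : ∀ u : D.domain, 0 ≤ D.form u u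
  closed : ∀ u : ℕ → D.domain,
    Tendsto (fun p : ℕ × ℕ => D.form (u p.1 - u p.2) (u p.1 - u p.2) +
      ‖((u p.1 - u p.2 : D.domain) : H)‖ ^ 2) atTop (𝓝 0) →
      ∃ w : D.domain,
        Tendsto (fun n => D.form (u n - w) (u n - w) + ‖((u n - w : D.domain) : H)‖ ^ 2)
          atTop (𝓝 0)

/-- `J` is the operator `(1 + α L)⁻¹`, where `L` is the nonnegative operator of the form `D`. -/
structure IsResolvent (D : FormOn H) (α : ℝ) (J : H →L[ℝ] H) : Prop where
  norm_le : ‖J‖ ≤ 1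
  mem : ∀ h, J h ∈ D.domain
  eq : ∀ h (v : D.domain), α * D.form ⟨J h, mem h⟩ v + inner ℝ (J h) (v : H) = inner ℝ h (v : H)

/-- The graph of the (nonpositive) generator associated with the form `D`. -/
def IsGeneratorPair (D : FormOn H) (u g : H) : Prop :=
  ∃ hu : u ∈ D.domain, ∀ v : D.domain, D.form ⟨u, hu⟩ v = -(inner ℝ g (v : H))

/-- The inner product `α E(u, v) + ⟨u, v⟩` on the domain of a form. -/
@[reducible]
def energyCore {D : FormOn H} (hD : IsClosedForm D) {α : ℝ} (hα : 0 < α) :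
    InnerProductSpace.Core ℝ D.domain where
  inner u v := α * D.form u v + inner ℝ (u : H) (v : H)
  conj_inner_symm u v := by
    simp only [conj_trivial]
    rw [hD.symm, real_inner_comm]
  re_inner_nonneg u := by
    simpa using add_nonneg (mul_nonneg hα.le (hD.nonneg u)) real_inner_self_nonneg
  add_left u v w := by
    simp only [map_add, LinearMap.add_apply, Submodule.coe_add, inner_add_left]; ring
  smul_left u v r := by
    simp only [map_smul, LinearMap.smul_apply, Submodule.coe_smul, inner_smul_left, smul_eq_mul,
      conj_trivial]; ring
  definite u h := by
    have h1 := mul_nonneg hα.le (hD.nonneg u)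
    have h2 : 0 ≤ inner ℝ (u : H) (u : H) := real_inner_self_nonneg
    have h3 : inner ℝ (u : H) (u : H) = 0 := by
      have : α * D.form u u + inner ℝ (u : H) (u : H) = 0 := h
      linarith
    exact Subtype.ext (inner_self_eq_zero.1 h3)

/-- The Riesz representation theorem for a complete inner product given by its axioms. -/
theorem exists_core_inner_eq {V : Type*} [AddCommGroup V] [Module ℝ V]
    (c : InnerProductSpace.Core ℝ V)
    (hc : ∀ u : ℕ → V, Tendsto (fun p : ℕ × ℕ => c.inner (u p.1 - u p.2) (u p.1 - u p.2)) atTop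
      (𝓝 0) → ∃ w, Tendsto (fun n => c.inner (u n - w) (u n - w)) atTop (𝓝 0))
    (l : V →ₗ[ℝ] ℝ) (C : ℝ) (hl : ∀ v, |l v| ≤ C * √(c.inner v v)) :
    ∃ u, ∀ v, c.inner u v = l v := by
  let _ : NormedAddCommGroup V := c.toNormedAddCommGroup
  let _ : InnerProductSpace ℝ V := InnerProductSpace.ofCore c.toCore
  have hn : ∀ v : V, c.inner v v = ‖v‖ ^ 2 := fun v => real_inner_self_eq_norm_sq v
  have : CompleteSpace V := by
    refine Metric.complete_of_cauchySeq_tendsto fun u hu => ?_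
    obtain ⟨w, hw⟩ := hc u (by
      simp_rw [hn]
      have h1 := (cauchySeq_iff_tendsto_dist_atTop_0.1 hu).pow 2
      simpa [dist_eq_norm] using h1)
    refine ⟨w, ?_⟩
    rw [tendsto_iff_norm_sub_tendsto_zero]
    simp_rw [hn] at hw
    simpa using hw.sqrt
  let L : StrongDual ℝ V := l.mkContinuous C fun v => by
    have := hl v
    rwa [hn, Real.sqrt_sq (norm_nonneg v)] at this
  exact ⟨(InnerProductSpace.toDual ℝ V).symm L, fun v =>
    InnerProductSpace.toDual_symm_apply (x := v) (y := L)⟩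

/-- Test both equations with `u - w` and subtract: `α E(u - w, u - w) + ‖u - w‖² = 0`. -/
theorem IsResolvent.unique {D : FormOn H} (hD : IsClosedForm D) {α : ℝ} (hα : 0 < α)
    {u w h : H} (hu : u ∈ D.domain) (hw : w ∈ D.domain)
    (h1 : ∀ v : D.domain, α * D.form ⟨u, hu⟩ v + inner ℝ u (v : H) = inner ℝ h (v : H))
    (h2 : ∀ v : D.domain, α * D.form ⟨w, hw⟩ v + inner ℝ w (v : H) = inner ℝ h (v : H)) :
    u = w := by
  have h3 := h1 (⟨u, hu⟩ - ⟨w, hw⟩)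
  have h4 := h2 (⟨u, hu⟩ - ⟨w, hw⟩)
  have h5 := mul_nonneg hα.le (hD.nonneg (⟨u, hu⟩ - ⟨w, hw⟩))
  have h6 : 0 ≤ inner ℝ (u - w) (u - w) := real_inner_self_nonneg
  have h7 : inner ℝ (u - w) (u - w) = 0 := by
    simp only [Submodule.coe_sub, map_sub, LinearMap.sub_apply, inner_sub_left,
      inner_sub_right] at *
    linarith
  exact sub_eq_zero.1 (inner_self_eq_zero.1 h7)

/-- Riesz representation of `v ↦ ⟨h, v⟩` in the Hilbert space given by the domain with inner product
`α E + ⟨·,·⟩`; uniqueness makes the solution linear in `h`. -/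
theorem IsClosedForm.exists_isResolvent {D : FormOn H} (hD : IsClosedForm D) {α : ℝ}
    (hα : 0 < α) : ∃ J : H →L[ℝ] H, IsResolvent D α J := by
  have hcomplete : ∀ u : ℕ → D.domain, Tendsto (fun p : ℕ × ℕ =>
      (energyCore hD hα).inner (u p.1 - u p.2) (u p.1 - u p.2)) atTop (𝓝 0) →
      ∃ w, Tendsto (fun n => (energyCore hD hα).inner (u n - w) (u n - w)) atTop (𝓝 0) := by
    intro u hu
    have key : ∀ v : D.domain, (energyCore hD hα).inner v v = α * D.form v v + ‖(v : H)‖ ^ 2 := by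
      intro v
      change α * D.form v v + inner ℝ (v : H) (v : H) = _
      rw [real_inner_self_eq_norm_sq]
    simp_rw [key] at hu ⊢
    have hnn : ∀ v : D.domain, 0 ≤ D.form v v + ‖(v : H)‖ ^ 2 := fun v =>
      add_nonneg (hD.nonneg v) (sq_nonneg _)
    have hnn' : ∀ v : D.domain, 0 ≤ α * D.form v v + ‖(v : H)‖ ^ 2 := fun v =>
      add_nonneg (mul_nonneg hα.le (hD.nonneg v)) (sq_nonneg _)
    -- Closedness concerns `E + ‖·‖²`. The two squared norms bound each other with factors `α⁻¹ + 1`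
    -- and `α + 1`.
    obtain ⟨w, hw⟩ := hD.closed u (by
      have h1 := hu.const_mul (α⁻¹ + 1)
      rw [mul_zero] at h1
      refine squeeze_zero (fun p => hnn _) (fun p => ?_) h1
      have h2 := hD.nonneg (u p.1 - u p.2)
      have h3 : 0 ≤ α * D.form (u p.1 - u p.2) (u p.1 - u p.2) := mul_nonneg hα.le h2
      have h4 : α⁻¹ * (α * D.form (u p.1 - u p.2) (u p.1 - u p.2)) =
        D.form (u p.1 - u p.2) (u p.1 - u p.2) := by field_simp
      have h5 : 0 ≤ α⁻¹ * ‖((u p.1 - u p.2 : D.domain) : H)‖ ^ 2 := by positivity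
      rw [add_mul, mul_add, h4, one_mul]
      linarith)
    refine ⟨w, ?_⟩
    have h1 := hw.const_mul (α + 1)
    rw [mul_zero] at h1
    refine squeeze_zero (fun p => hnn' _) (fun n => ?_) h1
    have h2 := hD.nonneg (u n - w)
    have h5 : 0 ≤ α * ‖((u n - w : D.domain) : H)‖ ^ 2 := by positivity
    rw [add_mul, mul_add, one_mul]
    linarith
  have hex : ∀ h : H, ∃ u : D.domain, ∀ v : D.domain,
      α * D.form u v + inner ℝ (u : H) (v : H) = inner ℝ h (v : H) := by
    intro h
    refine exists_core_inner_eq (energyCore hD hα) hcomplete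
      ((innerₗ H h).comp D.domain.subtype) ‖h‖ fun v => ?_
    refine (abs_real_inner_le_norm _ _).trans ?_
    refine mul_le_mul_of_nonneg_left (Real.le_sqrt_of_sq_le ?_) (norm_nonneg _)
    change _ ≤ α * D.form v v + inner ℝ (v : H) (v : H)
    rw [real_inner_self_eq_norm_sq]
    have := mul_nonneg hα.le (hD.nonneg v)
    simp only [Submodule.subtype_apply]
    linarith
  choose J hJ using hex
  let Jl : H →ₗ[ℝ] H :=
    { toFun := fun h => J h
      map_add' := fun x y => by
        refine IsResolvent.unique (h := x + y) hD hα (J (x + y)).2 (J x + J y).2 (hJ _) fun v => ?_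
        have := hJ x v
        have := hJ y v
        change α * D.form (J x + J y) v + inner ℝ ((J x : H) + J y) (v : H) = _
        rw [map_add, LinearMap.add_apply, inner_add_left, inner_add_left]
        linarith
      map_smul' := fun c x => by
        refine IsResolvent.unique (h := c • x) hD hα (J (c • x)).2 (c • J x).2 (hJ _) fun v => ?_
        have := hJ x v
        change α * D.form (c • J x) v + inner ℝ (c • (J x : H)) (v : H) = _
        rw [map_smul, LinearMap.smul_apply, inner_smul_left, inner_smul_left, ← this]
        simp
        ring }
  refine ⟨Jl.mkContinuous 1 fun h => ?_, ?_, fun h => (J h).2, fun h v => hJ h v⟩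
  · rw [one_mul]
    -- Testing with `J h` itself gives `‖J h‖² ≤ ⟨h, J h⟩`.
    have h1 := hJ h (J h)
    have h2 := mul_nonneg hα.le (hD.nonneg (J h))
    have h3 := real_inner_le_norm h (J h : H)
    rw [real_inner_self_eq_norm_sq] at h1
    change ‖(J h : H)‖ ≤ ‖h‖
    by_contra! hlt
    nlinarith [norm_nonneg h]
  · exact LinearMap.mkContinuous_norm_le _ zero_le_one _

namespace IsResolvent

variable {D : FormOn H} {α β : ℝ} {J K : H →L[ℝ] H}

theorem norm_apply_le (hJ : IsResolvent D α J) (h : H) : ‖J h‖ ≤ ‖h‖ := by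
  simpa using J.le_of_opNorm_le hJ.norm_le h

theorem generatorPair (hα : 0 < α) (hJ : IsResolvent D α J) (h : H) :
    IsGeneratorPair D (J h) (α⁻¹ • (J h - h)) := by
  refine ⟨hJ.mem h, fun v => ?_⟩
  have h1 := hJ.eq h v
  rw [inner_smul_left, inner_sub_left, ← h1]
  simp
  field_simp

/-- Together with `generatorPair`, this identifies `J` with `(1 - α A)⁻¹` for the generator `A`. -/
theorem apply_of_generatorPair (hD : IsClosedForm D) (hα : 0 < α) (hJ : IsResolvent D α J)
    {u g : H} (hu : IsGeneratorPair D u g) : J (u - α • g) = u := by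
  obtain ⟨hu, h⟩ := hu
  refine unique (h := u - α • g) hD hα (hJ.mem _) hu (hJ.eq _) fun v => ?_
  rw [h v, inner_sub_left, inner_smul_left]
  simp
  ring

theorem generatorPair_map (hD : IsClosedForm D) (hβ : 0 < β) (hK : IsResolvent D β K) {u g : H}
    (hu : IsGeneratorPair D u g) : IsGeneratorPair D (K u) (K g) := by
  have h1 := hK.generatorPair hβ u
  convert h1 using 1
  have h2 := hK.apply_of_generatorPair hD hβ hu
  rw [map_sub, map_smul] at h2
  rw [sub_eq_iff_eq_add] at h2
  rw [eq_inv_smul_iff₀ hβ.ne', eq_sub_iff_add_eq]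
  exact (add_comm _ _).trans h2.symm

theorem commute (hD : IsClosedForm D) (hα : 0 < α) (hβ : 0 < β) (hJ : IsResolvent D α J)
    (hK : IsResolvent D β K) : Commute J K := by
  ext h
  change J (K h) = K (J h)
  have h1 := hK.generatorPair_map hD hβ (hJ.generatorPair hα h)
  have h2 := hJ.apply_of_generatorPair hD hα h1
  rw [map_smul, smul_smul, mul_inv_cancel₀ hα.ne', one_smul, ← map_sub K,
    sub_sub_cancel] at h2
  exact h2

/-- The Yosida approximation of the generator. -/
theorem yosida_apply (hD : IsClosedForm D) (hα : 0 < α) (hJ : IsResolvent D α J) {u g : H}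
    (hu : IsGeneratorPair D u g) : α⁻¹ • (J u - u) = J g := by
  have h2 := hJ.apply_of_generatorPair hD hα hu
  rw [map_sub, map_smul] at h2
  rw [inv_smul_eq_iff₀ hα.ne']
  nth_rw 2 [← h2]
  abel

theorem norm_sub_le (hD : IsClosedForm D) (hα : 0 < α) (hJ : IsResolvent D α J) {u g : H}
    (hu : IsGeneratorPair D u g) : ‖J u - u‖ ≤ α * ‖g‖ := by
  have h1 := hJ.yosida_apply hD hα hu
  rw [inv_smul_eq_iff₀ hα.ne'] at h1
  rw [h1, norm_smul, Real.norm_of_nonneg hα.le]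
  exact mul_le_mul_of_nonneg_left (hJ.norm_apply_le g) hα.le

/-- If `x` is orthogonal to the range, then `⟨x, J x⟩ = 0` forces `J x = 0`. The resolvent equation
then makes `x` orthogonal to the whole domain, which is dense. -/
theorem dense_range [CompleteSpace H] (hD : IsClosedForm D) (hα : 0 < α) (hJ : IsResolvent D α J) :
    DenseRange J := by
  have h1 : (LinearMap.range (J : H →ₗ[ℝ] H)).topologicalClosure = ⊤ := by
    rw [Submodule.topologicalClosure_eq_top_iff, Submodule.eq_bot_iff]
    intro x hx
    rw [Submodule.mem_orthogonal'] at hx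
    have h2 : inner ℝ x (J x) = 0 := hx _ ⟨x, rfl⟩
    have h3 := hJ.eq x ⟨J x, hJ.mem x⟩
    have h4 := mul_nonneg hα.le (hD.nonneg ⟨J x, hJ.mem x⟩)
    have h5 : 0 ≤ inner ℝ (J x) (J x) := real_inner_self_nonneg
    simp only at h3
    have h6 : J x = 0 := inner_self_eq_zero.1 (by linarith : inner ℝ (J x) (J x) = 0)
    refine hD.dense.eq_zero_of_inner_left ℝ fun v hv => ?_
    have h7 := hJ.eq x ⟨v, hv⟩
    have h8 : (⟨J x, hJ.mem x⟩ : D.domain) = 0 := Subtype.ext h6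
    rw [h8, h6] at h7
    simpa using h7.symm
  have h2 := (Submodule.dense_iff_topologicalClosure_eq_top).2 h1
  exact h2

theorem dense_generator [CompleteSpace H] (hD : IsClosedForm D) (hα : 0 < α)
    (hJ : IsResolvent D α J) :
    Dense {u | ∃ g, IsGeneratorPair D u g} := by
  refine (hJ.dense_range hD hα).mono ?_
  rintro _ ⟨h, rfl⟩
  exact ⟨_, hJ.generatorPair hα h⟩

end IsResolvent

end ClosedForm

/-! ### Exponentials of bounded operators and contraction estimates -/

section ContractionExp

variable {H : Type*} [NormedAddCommGroup H] [NormedSpace ℝ H]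

theorem norm_pow_le_one_of_contraction {J : H →L[ℝ] H} (hJ : ‖J‖ ≤ 1) (n : ℕ) : ‖J ^ n‖ ≤ 1 := by
  induction n with
  | zero => exact ContinuousLinearMap.norm_id_le
  | succ n ih =>
    rw [pow_succ]
    exact (norm_mul_le _ _).trans (mul_le_one₀ ih (norm_nonneg _) hJ)

variable [CompleteSpace H]

/-- For `c ≥ 0` this is a Poisson average of the powers of `J`. Contractivity, and later positivity,
pass from `J` to the exponential through this series. -/
theorem hasSum_exp_smul_sub_one (J : H →L[ℝ] H) (c : ℝ) :
    HasSum (fun n : ℕ => (Real.exp (-c) * (c ^ n / n.factorial)) • J ^ n)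
      (NormedSpace.exp (c • (J - 1))) := by
  let _ : NormedAlgebra ℚ (H →L[ℝ] H) := NormedAlgebra.restrictScalars ℚ ℝ _
  have h1 : NormedSpace.exp (c • (J - 1)) = Real.exp (-c) • NormedSpace.exp (c • J) := by
    have h2 : c • (J - 1) = algebraMap ℝ (H →L[ℝ] H) (-c) + c • J := by
      rw [Algebra.algebraMap_eq_smul_one, smul_sub, neg_smul]; abel
    rw [h2, NormedSpace.exp_add_of_commute (Algebra.commutes _ _),
      ← NormedSpace.algebraMap_exp_comm, ← Algebra.smul_def, Real.exp_eq_exp_ℝ]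
  rw [h1]
  have h3 := (NormedSpace.exp_series_hasSum_exp' (𝕂 := ℝ) (c • J)).const_smul (Real.exp (-c))
  have h4 : ∀ n : ℕ, Real.exp (-c) • ((n.factorial : ℝ)⁻¹ • (c • J) ^ n) =
      (Real.exp (-c) * (c ^ n / n.factorial)) • J ^ n := fun n => by
    rw [smul_pow, smul_smul, smul_smul]
    congr 1
    ring
  simpa only [h4] using h3

theorem norm_exp_smul_sub_one_le {J : H →L[ℝ] H} (hJ : ‖J‖ ≤ 1) {c : ℝ} (hc : 0 ≤ c) :
    ‖NormedSpace.exp (c • (J - 1))‖ ≤ 1 := by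
  rw [← (hasSum_exp_smul_sub_one J c).tsum_eq]
  have h1 : HasSum (fun n : ℕ => Real.exp (-c) * (c ^ n / n.factorial)) 1 := by
    have := (NormedSpace.expSeries_div_hasSum_exp c).mul_left (Real.exp (-c))
    rwa [← Real.exp_eq_exp_ℝ, ← Real.exp_add, neg_add_cancel, Real.exp_zero] at this
  refine tsum_of_norm_bounded h1 fun n => ?_
  rw [norm_smul, Real.norm_of_nonneg (by positivity)]
  exact mul_le_of_le_one_right (by positivity) (norm_pow_le_one_of_contraction hJ n)

/-- Interpolate by `s ↦ exp(tB) exp(s(A - B)) u`. By commutativity its derivative is `exp(sA) exp((t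
- s)B) (A - B) u`, in which both exponentials are contractions on `[0, t]`. -/
theorem norm_exp_sub_exp_apply_le {A B : H →L[ℝ] H} (hAB : Commute A B)
    (hA : ∀ s : ℝ, 0 ≤ s → ‖NormedSpace.exp (s • A)‖ ≤ 1)
    (hB : ∀ s : ℝ, 0 ≤ s → ‖NormedSpace.exp (s • B)‖ ≤ 1) {t : ℝ} (ht : 0 ≤ t) (u : H) :
    ‖NormedSpace.exp (t • A) u - NormedSpace.exp (t • B) u‖ ≤ t * ‖A u - B u‖ := by
  let _ : NormedAlgebra ℚ (H →L[ℝ] H) := NormedAlgebra.restrictScalars ℚ ℝ _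
  have hBAB : Commute B (A - B) := hAB.symm.sub_right (Commute.refl B)
  let f : ℝ → H := fun s => (NormedSpace.exp (t • B) * NormedSpace.exp (s • (A - B))) u
  have h0 : f 0 = NormedSpace.exp (t • B) u := by
    simp only [f, zero_smul, NormedSpace.exp_zero, mul_one]
  have h1 : f t = NormedSpace.exp (t • A) u := by
    simp only [f]
    rw [← NormedSpace.exp_add_of_commute ((hBAB.smul_left t).smul_right t), ← smul_add,
      add_sub_cancel]
  have hd : ∀ s ∈ Set.Icc (0 : ℝ) t, HasDerivWithinAt f
      ((NormedSpace.exp (t • B) * (NormedSpace.exp (s • (A - B)) * (A - B))) u)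
      (Set.Icc 0 t) s := by
    intro s _
    have h2 := (hasDerivAt_exp_smul_const (𝕂 := ℝ) (A - B) s).const_mul (NormedSpace.exp (t • B))
    exact (((ContinuousLinearMap.apply ℝ H u).hasFDerivAt).comp_hasDerivAt s h2).hasDerivWithinAt
  have hb : ∀ s ∈ Set.Icc (0 : ℝ) t,
      ‖(NormedSpace.exp (t • B) * (NormedSpace.exp (s • (A - B)) * (A - B))) u‖ ≤
        ‖A u - B u‖ := by
    intro s hs
    have h3 : NormedSpace.exp (t • B) * NormedSpace.exp (s • (A - B)) =
        NormedSpace.exp (s • A) * NormedSpace.exp ((t - s) • B) := by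
      rw [← NormedSpace.exp_add_of_commute ((hBAB.smul_left t).smul_right s),
        ← NormedSpace.exp_add_of_commute ((hAB.smul_left s).smul_right (t - s))]
      congr 1
      rw [smul_sub, sub_smul]; abel
    rw [← mul_assoc, h3, mul_assoc, mul_apply_eq_comp, mul_apply_eq_comp]
    refine (ContinuousLinearMap.le_of_opNorm_le _ (hA s hs.1) _).trans ?_
    rw [one_mul]
    refine (ContinuousLinearMap.le_of_opNorm_le _ (hB (t - s) (sub_nonneg.2 hs.2)) _).trans ?_
    rw [one_mul, sub_apply]
  have := (convex_Icc (0 : ℝ) t).norm_image_sub_le_of_norm_hasDerivWithin_le hd hb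
    (Set.left_mem_Icc.2 ht) (Set.right_mem_Icc.2 ht)
  rwa [h0, h1, sub_zero, Real.norm_of_nonneg ht, mul_comm] at this

theorem norm_exp_apply_sub_le {A : H →L[ℝ] H}
    (hA : ∀ s : ℝ, 0 ≤ s → ‖NormedSpace.exp (s • A)‖ ≤ 1) {t : ℝ} (ht : 0 ≤ t) (u : H) :
    ‖NormedSpace.exp (t • A) u - u‖ ≤ t * ‖A u‖ := by
  have := norm_exp_sub_exp_apply_le (Commute.zero_right A) hA
    (fun s _ => by
      rw [smul_zero, NormedSpace.exp_zero]; exact ContinuousLinearMap.norm_id_le) ht u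
  simpa using this

theorem norm_exp_apply_sub_sub_le {A : H →L[ℝ] H} {t C : ℝ} (ht : 0 ≤ t) (u : H)
    (hC : ∀ s ∈ Set.Icc 0 t, ‖NormedSpace.exp (s • A) (A u) - A u‖ ≤ C) :
    ‖NormedSpace.exp (t • A) u - u - t • A u‖ ≤ t * C := by
  let f : ℝ → H := fun s => NormedSpace.exp (s • A) u - s • A u
  have hd : ∀ s ∈ Set.Icc (0 : ℝ) t, HasDerivWithinAt f
      (NormedSpace.exp (s • A) (A u) - A u) (Set.Icc 0 t) s := by
    intro s _
    have h2 := ((ContinuousLinearMap.apply ℝ H u).hasFDerivAt).comp_hasDerivAt s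
      (hasDerivAt_exp_smul_const (𝕂 := ℝ) A s)
    have h3 := (hasDerivAt_id s).smul_const (A u)
    rw [one_smul] at h3
    exact (h2.sub h3).hasDerivWithinAt
  have := (convex_Icc (0 : ℝ) t).norm_image_sub_le_of_norm_hasDerivWithin_le hd hC
    (Set.left_mem_Icc.2 ht) (Set.right_mem_Icc.2 ht)
  rw [sub_zero, Real.norm_of_nonneg ht, mul_comm] at this
  convert this using 2
  simp only [f, zero_smul, NormedSpace.exp_zero, one_apply_eq_self, sub_zero]
  abel

end ContractionExp

/-! ### The Hille–Yosida construction for the generator of a closed form -/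

section HilleYosida

theorem tendsto_zero_of_dense {H ι : Type*} [NormedAddCommGroup H] [NormedSpace ℝ H]
    {l : Filter ι} (R : ι → H →L[ℝ] H) (C : ℝ) (hR : ∀ i, ‖R i‖ ≤ C) {s : Set H} (hs : Dense s)
    (h : ∀ u ∈ s, Tendsto (fun i => R i u) l (𝓝 0)) (u : H) :
    Tendsto (fun i => R i u) l (𝓝 0) := by
  rw [Metric.tendsto_nhds]
  intro ε hε
  obtain ⟨v, hv, huv⟩ := Metric.dense_iff.1 hs u (ε / (2 * (|C| + 1))) (by positivity)
  rw [Metric.mem_ball, dist_comm, dist_eq_norm, lt_div_iff₀ (by positivity)] at hv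
  filter_upwards [Metric.tendsto_nhds.1 (h v huv) (ε / 2) (half_pos hε)] with i hi
  rw [dist_zero_right] at hi ⊢
  have h1 : R i u = R i (u - v) + R i v := by rw [map_sub]; abel
  have h2 : ‖R i (u - v)‖ ≤ (|C| + 1) * ‖u - v‖ :=
    (R i).le_of_opNorm_le ((hR i).trans ((le_abs_self C).trans (by linarith))) _
  calc ‖R i u‖ ≤ ‖R i (u - v)‖ + ‖R i v‖ := h1 ▸ norm_add_le _ _
    _ < ε := by linarith

variable {H : Type*} [NormedAddCommGroup H] [InnerProductSpace ℝ H]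

/-- The Yosida approximation `α⁻¹ (J - 1)` of the generator, where `J` is the resolvent. -/
def yosida (α : ℝ) (J : H →L[ℝ] H) : H →L[ℝ] H := α⁻¹ • (J - 1)

variable {D : FormOn H} {α : ℕ → ℝ} {J : ℕ → H →L[ℝ] H}

theorem IsResolvent.yosida_eq (hD : IsClosedForm D) {a : ℝ} {K : H →L[ℝ] H} (ha : 0 < a)
    (hK : IsResolvent D a K) {u g : H} (hu : IsGeneratorPair D u g) : yosida a K u = K g :=
  hK.yosida_apply hD ha hu

/-- On the domain of the generator, `‖J u - u‖ ≤ α ‖A u‖`; uniform boundedness extends the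
convergence from this dense set. -/
theorem tendsto_resolvent [CompleteSpace H] (hD : IsClosedForm D) (hα : ∀ n, 0 < α n)
    (hα0 : Tendsto α atTop (𝓝 0))
    (hJ : ∀ n, IsResolvent D (α n) (J n)) (h : H) : Tendsto (fun n => J n h) atTop (𝓝 h) := by
  have := tendsto_zero_of_dense (l := atTop) (fun n => J n - 1) 2 (fun n => by
    have h1 := norm_sub_le (J n) 1
    have h2 := (hJ n).norm_le
    have h3 : ‖(1 : H →L[ℝ] H)‖ ≤ 1 := ContinuousLinearMap.norm_id_le
    linarith) ((hJ 0).dense_generator hD (hα 0)) (by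
      rintro u ⟨g, hu⟩
      rw [tendsto_zero_iff_norm_tendsto_zero]
      refine squeeze_zero (fun _ => norm_nonneg _)
        (fun n => (hJ n).norm_sub_le hD (hα n) hu) ?_
      simpa using hα0.mul_const ‖g‖) h
  rw [← tendsto_sub_nhds_zero_iff]
  exact this

variable [CompleteSpace H]

theorem norm_exp_yosida_le {a : ℝ} {K : H →L[ℝ] H} (ha : 0 < a) (hK : IsResolvent D a K)
    (s : ℝ) (hs : 0 ≤ s) : ‖NormedSpace.exp (s • yosida a K)‖ ≤ 1 := by
  rw [yosida, smul_smul]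
  exact norm_exp_smul_sub_one_le hK.norm_le (by positivity)

/-- For `u` in the domain of the generator the Yosida approximations give `J n (A u)`, which
converges. Since resolvents commute, the exponentials differ on `u` by at most `t` times the
difference of these vectors. -/
theorem cauchySeq_exp_yosida (hD : IsClosedForm D) (hα : ∀ n, 0 < α n)
    (hα0 : Tendsto α atTop (𝓝 0))
    (hJ : ∀ n, IsResolvent D (α n) (J n)) (t : ℝ≥0) (h : H) :
    CauchySeq fun n => NormedSpace.exp ((t : ℝ) • yosida (α n) (J n)) h := by
  rw [cauchySeq_iff_tendsto_dist_atTop_0]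
  have key := tendsto_zero_of_dense (l := atTop) (fun p : ℕ × ℕ =>
    NormedSpace.exp ((t : ℝ) • yosida (α p.1) (J p.1)) -
      NormedSpace.exp ((t : ℝ) • yosida (α p.2) (J p.2))) 2 (fun p => by
    have h1 := norm_exp_yosida_le (hα p.1) (hJ p.1) t t.2
    have h2 := norm_exp_yosida_le (hα p.2) (hJ p.2) t t.2
    exact (norm_sub_le _ _).trans (by linarith)) ((hJ 0).dense_generator hD (hα 0)) (by
      rintro u ⟨g, hu⟩
      rw [tendsto_zero_iff_norm_tendsto_zero]
      have h3 := (cauchySeq_iff_tendsto_dist_atTop_0.1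
        (tendsto_resolvent hD hα hα0 hJ g).cauchySeq).const_mul (t : ℝ)
      rw [mul_zero] at h3
      refine squeeze_zero (fun _ => norm_nonneg _) (fun p => ?_) h3
      have hc : Commute (yosida (α p.1) (J p.1)) (yosida (α p.2) (J p.2)) :=
        ((((hJ p.1).commute hD (hα p.1) (hα p.2) (hJ p.2)).sub_left
          (Commute.one_left _)).sub_right (Commute.one_right _)).smul_left _ |>.smul_right _
      have h4 := norm_exp_sub_exp_apply_le hc (norm_exp_yosida_le (hα p.1) (hJ p.1))
        (norm_exp_yosida_le (hα p.2) (hJ p.2)) t.2 u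
      rw [(hJ p.1).yosida_eq hD (hα p.1) hu, (hJ p.2).yosida_eq hD (hα p.2) hu] at h4
      rw [dist_eq_norm]
      exact h4) h
  simpa [dist_eq_norm] using key.norm

/-- Strongly continuous contraction semigroups with generator given by a form. -/
structure IsFormSemigroup (D : FormOn H) (T : ℝ≥0 → (H →L[ℝ] H)) : Prop where
  zero : T 0 = ContinuousLinearMap.id ℝ H
  add : ∀ s t, T (s + t) = (T s).comp (T t)
  contraction : ∀ t, ‖T t‖ ≤ 1
  continuous : ∀ u, Continuous fun t => T t u
  generator : ∀ u g : H,
    Tendsto (fun t : ℝ≥0 => (t : ℝ)⁻¹ • (T t u - u)) (𝓝[>] 0) (𝓝 g) ↔ IsGeneratorPair D u g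

section Limit

variable {T : ℝ≥0 → H →L[ℝ] H}

theorem norm_limit_le (hα : ∀ n, 0 < α n) (hJ : ∀ n, IsResolvent D (α n) (J n))
    (hT : ∀ (t : ℝ≥0) h, Tendsto (fun n => NormedSpace.exp ((t : ℝ) • yosida (α n) (J n)) h)
      atTop (𝓝 (T t h))) (t : ℝ≥0) : ‖T t‖ ≤ 1 := by
  refine ContinuousLinearMap.opNorm_le_bound _ zero_le_one fun h => ?_
  refine le_of_tendsto (hT t h).norm (Eventually.of_forall fun n => ?_)
  exact ContinuousLinearMap.le_of_opNorm_le _ (norm_exp_yosida_le (hα n) (hJ n) t t.2) h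

theorem limit_add (hα : ∀ n, 0 < α n) (hJ : ∀ n, IsResolvent D (α n) (J n))
    (hT : ∀ (t : ℝ≥0) h, Tendsto (fun n => NormedSpace.exp ((t : ℝ) • yosida (α n) (J n)) h)
      atTop (𝓝 (T t h))) (s t : ℝ≥0) : T (s + t) = (T s).comp (T t) := by
  let _ : NormedAlgebra ℚ (H →L[ℝ] H) := NormedAlgebra.restrictScalars ℚ ℝ _
  ext h
  refine tendsto_nhds_unique (hT (s + t) h) ?_
  have h1 : ∀ n, NormedSpace.exp (((s + t : ℝ≥0) : ℝ) • yosida (α n) (J n)) h =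
      NormedSpace.exp ((s : ℝ) • yosida (α n) (J n))
        (NormedSpace.exp ((t : ℝ) • yosida (α n) (J n)) h) := by
    intro n
    rw [NNReal.coe_add, add_smul, NormedSpace.exp_add_of_commute
      (((Commute.refl _).smul_left _).smul_right _), mul_apply_eq_comp]
  simp_rw [h1]
  have h2 : Tendsto (fun n => NormedSpace.exp ((s : ℝ) • yosida (α n) (J n))
      (NormedSpace.exp ((t : ℝ) • yosida (α n) (J n)) h - T t h)) atTop (𝓝 0) := by
    rw [tendsto_zero_iff_norm_tendsto_zero]
    have h3 := (tendsto_iff_norm_sub_tendsto_zero.1 (hT t h))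
    refine squeeze_zero (fun _ => norm_nonneg _) (fun n => ?_) h3
    exact (ContinuousLinearMap.le_of_opNorm_le _
      (norm_exp_yosida_le (hα n) (hJ n) s s.2) _).trans_eq (one_mul _)
  have h4 := h2.add (hT s (T t h))
  simpa using h4

theorem norm_limit_sub_le (hD : IsClosedForm D) (hα : ∀ n, 0 < α n)
    (hJ : ∀ n, IsResolvent D (α n) (J n))
    (hT : ∀ (t : ℝ≥0) h, Tendsto (fun n => NormedSpace.exp ((t : ℝ) • yosida (α n) (J n)) h)
      atTop (𝓝 (T t h))) {u g : H} (hu : IsGeneratorPair D u g) (t : ℝ≥0) :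
    ‖T t u - u‖ ≤ t * ‖g‖ := by
  refine le_of_tendsto ((hT t u).sub_const u).norm (Eventually.of_forall fun n => ?_)
  refine (norm_exp_apply_sub_le (norm_exp_yosida_le (hα n) (hJ n)) t.2 u).trans ?_
  rw [(hJ n).yosida_eq hD (hα n) hu]
  exact mul_le_mul_of_nonneg_left ((hJ n).norm_apply_le g) t.2

theorem limit_continuous (hD : IsClosedForm D) (hα : ∀ n, 0 < α n)
    (hJ : ∀ n, IsResolvent D (α n) (J n))
    (hT : ∀ (t : ℝ≥0) h, Tendsto (fun n => NormedSpace.exp ((t : ℝ) • yosida (α n) (J n)) h)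
      atTop (𝓝 (T t h))) (u : H) : Continuous fun t => T t u := by
  rw [continuous_iff_continuousAt]
  intro t
  have key := tendsto_zero_of_dense (l := 𝓝 t) (fun s => T s - T t) 2 (fun s => by
    have h1 := norm_limit_le hα hJ hT t
    have h2 := norm_limit_le hα hJ hT s
    exact (norm_sub_le _ _).trans (by linarith)) ((hJ 0).dense_generator hD (hα 0)) (by
      rintro u ⟨g, hu⟩
      rw [tendsto_zero_iff_norm_tendsto_zero]
      have hle : ∀ a b : ℝ≥0, a ≤ b → ‖T b u - T a u‖ ≤ dist b a * ‖g‖ := by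
        intro a b hab
        obtain ⟨c, rfl⟩ := exists_add_of_le hab
        have h1 : T (a + c) u - T a u = T a (T c u - u) := by
          rw [limit_add hα hJ hT, ContinuousLinearMap.comp_apply, map_sub]
        rw [h1, NNReal.dist_eq, NNReal.coe_add, add_sub_cancel_left, abs_of_nonneg c.coe_nonneg]
        refine (ContinuousLinearMap.le_of_opNorm_le _ (norm_limit_le hα hJ hT a) _).trans ?_
        rw [one_mul]
        exact norm_limit_sub_le hD hα hJ hT hu c
      refine squeeze_zero (fun _ => norm_nonneg _) (g := fun s => dist s t * ‖g‖) (fun s => ?_) ?_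
      · rcases le_total s t with h | h
        · rw [sub_apply, norm_sub_rev, dist_comm]; exact hle _ _ h
        · exact hle _ _ h
      · have : Tendsto (fun s : ℝ≥0 => dist s t) (𝓝 t) (𝓝 0) :=
          tendsto_iff_dist_tendsto_zero.1 tendsto_id
        simpa using this.mul_const ‖g‖) u
  rw [ContinuousAt, ← tendsto_sub_nhds_zero_iff]
  exact key

/-- The remainder `T t u - u - t g` is controlled by how far the semigroup moves `g` up to time `t`.
As `g = A u` may lie outside the domain of `A`, it is compared with a nearby `w` in that domain,
which moves by at most `t ‖A w‖`. -/
theorem limit_deriv (hD : IsClosedForm D) (hα : ∀ n, 0 < α n) (hα0 : Tendsto α atTop (𝓝 0))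
    (hJ : ∀ n, IsResolvent D (α n) (J n))
    (hT : ∀ (t : ℝ≥0) h, Tendsto (fun n => NormedSpace.exp ((t : ℝ) • yosida (α n) (J n)) h)
      atTop (𝓝 (T t h))) {u g : H} (hu : IsGeneratorPair D u g) :
    Tendsto (fun t : ℝ≥0 => (t : ℝ)⁻¹ • (T t u - u)) (𝓝[>] 0) (𝓝 g) := by
  have bound : ∀ {w k : H}, IsGeneratorPair D w k → ∀ t : ℝ≥0,
      ‖T t u - u - (t : ℝ) • g‖ ≤ t * (2 * ‖g - w‖ + t * ‖k‖) := by
    intro w k hw t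
    have hA : Tendsto (fun n => yosida (α n) (J n) u) atTop (𝓝 g) := by
      have : ∀ n, yosida (α n) (J n) u = J n g := fun n => (hJ n).yosida_eq hD (hα n) hu
      simp_rw [this]
      exact tendsto_resolvent hD hα hα0 hJ g
    refine le_of_tendsto_of_tendsto' ((((hT t u).sub_const u).sub (hA.const_smul (t : ℝ))).norm)
      ((((hA.sub_const w).norm.const_mul 2).add_const ((t : ℝ) * ‖k‖)).const_mul (t : ℝ))
      fun n => ?_
    refine norm_exp_apply_sub_sub_le t.2 u fun s hs => ?_
    set B := NormedSpace.exp (s • yosida (α n) (J n)) with hB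
    have hBn := norm_exp_yosida_le (hα n) (hJ n) s hs.1
    have h1 : B (yosida (α n) (J n) u) - yosida (α n) (J n) u =
        B (yosida (α n) (J n) u - w) - (yosida (α n) (J n) u - w) + (B w - w) := by
      rw [map_sub]; abel
    have h2 : ‖B (yosida (α n) (J n) u - w)‖ ≤ ‖yosida (α n) (J n) u - w‖ := by
      simpa using B.le_of_opNorm_le hBn (yosida (α n) (J n) u - w)
    have h3 : ‖B w - w‖ ≤ t * ‖k‖ := by
      refine (norm_exp_apply_sub_le (norm_exp_yosida_le (hα n) (hJ n)) hs.1 w).trans ?_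
      rw [(hJ n).yosida_eq hD (hα n) hw]
      exact mul_le_mul hs.2 ((hJ n).norm_apply_le k) (norm_nonneg _) t.2
    rw [h1]
    have h4 := norm_add_le (B (yosida (α n) (J n) u - w) - (yosida (α n) (J n) u - w)) (B w - w)
    have h5 := norm_sub_le (B (yosida (α n) (J n) u - w)) (yosida (α n) (J n) u - w)
    linarith
  rw [Metric.tendsto_nhds]
  intro ε hε
  obtain ⟨w, hw, k, hwk⟩ := Metric.dense_iff.1 ((hJ 0).dense_generator hD (hα 0)) g (ε / 4)
    (by positivity)
  rw [Metric.mem_ball, dist_comm, dist_eq_norm] at hw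
  have hlt : ∀ᶠ t : ℝ≥0 in 𝓝[>] 0, (t : ℝ) * (‖k‖ + 1) < ε / 2 := by
    have : Tendsto (fun t : ℝ≥0 => (t : ℝ) * (‖k‖ + 1)) (𝓝[>] 0) (𝓝 0) := by
      have h1 : Continuous fun t : ℝ≥0 => (t : ℝ) * (‖k‖ + 1) := by fun_prop
      simpa using (h1.tendsto 0).mono_left nhdsWithin_le_nhds
    exact this.eventually_lt_const (half_pos hε)
  filter_upwards [hlt, self_mem_nhdsWithin] with t ht ht0
  have ht0' : (0 : ℝ) < t := NNReal.coe_pos.2 ht0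
  have h1 : (t : ℝ)⁻¹ • (T t u - u) - g = (t : ℝ)⁻¹ • (T t u - u - (t : ℝ) • g) := by
    rw [smul_sub _ _ ((t : ℝ) • g), smul_smul, inv_mul_cancel₀ ht0'.ne', one_smul]
  rw [dist_eq_norm, h1, norm_smul, norm_inv, Real.norm_of_nonneg ht0'.le,
    inv_mul_lt_iff₀ ht0']
  refine (bound hwk t).trans_lt (mul_lt_mul_of_pos_left ?_ ht0')
  nlinarith

/-- One inclusion of generators is `limit_deriv`. The other holds because a dissipative operator
cannot properly extend one for which `1 - A` is onto. -/
theorem isFormSemigroup_limit (hD : IsClosedForm D) (hα : ∀ n, 0 < α n)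
    (hα0 : Tendsto α atTop (𝓝 0)) (hJ : ∀ n, IsResolvent D (α n) (J n))
    (hT : ∀ (t : ℝ≥0) h, Tendsto (fun n => NormedSpace.exp ((t : ℝ) • yosida (α n) (J n)) h)
      atTop (𝓝 (T t h))) : IsFormSemigroup D T where
  zero := by
    ext h
    refine tendsto_nhds_unique (hT 0 h) ?_
    simp
  add := limit_add hα hJ hT
  contraction := norm_limit_le hα hJ hT
  continuous := limit_continuous hD hα hJ hT
  generator u g := by
    refine ⟨fun h => ?_, limit_deriv hD hα hα0 hJ hT⟩
    obtain ⟨K, hK⟩ := hD.exists_isResolvent zero_lt_one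
    have h1 := hK.generatorPair zero_lt_one (u - g)
    set w := K (u - g) with hw
    have h2 := (limit_deriv hD hα hα0 hJ hT h1).sub h
    have h3 : w = u := by
      -- By the choice of `w` as a resolvent of `u - g`, the derivative of `T` at `w - u` is `w - u`
      -- itself. Contractivity makes its inner product with `w - u` nonpositive, so `w = u`.
      have h4 : Tendsto (fun t : ℝ≥0 => (t : ℝ)⁻¹ • (T t (w - u) - (w - u))) (𝓝[>] 0)
          (𝓝 (w - u)) := by
        convert h2 using 2 with t
        · rw [← smul_sub, map_sub]; congr 1; abel
        · rw [inv_one, one_smul]; abel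
      have h5 : inner ℝ (w - u) (w - u) ≤ 0 := by
        refine le_of_tendsto (h4.inner (tendsto_const_nhds (x := w - u)))
          (Eventually.of_forall fun t => ?_)
        rw [inner_smul_left, inner_sub_left, real_inner_self_eq_norm_sq]
        refine mul_nonpos_of_nonneg_of_nonpos (by simp) ?_
        have h6 := real_inner_le_norm (T t (w - u)) (w - u)
        have h7 := (T t).le_of_opNorm_le (norm_limit_le hα hJ hT t) (w - u)
        nlinarith [norm_nonneg (w - u)]
      rw [← sub_eq_zero]
      exact inner_self_eq_zero.1 (le_antisymm h5 real_inner_self_nonneg)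
    rw [h3] at h1
    convert h1 using 1
    rw [inv_one, one_smul]; abel

end Limit

theorem IsClosedForm.exists_semigroup (hD : IsClosedForm D) :
    ∃ (α : ℕ → ℝ) (J : ℕ → H →L[ℝ] H) (T : ℝ≥0 → H →L[ℝ] H),
      (∀ n, 0 < α n) ∧ (∀ n, IsResolvent D (α n) (J n)) ∧ IsFormSemigroup D T ∧
      ∀ (t : ℝ≥0) h, Tendsto (fun n => NormedSpace.exp ((t : ℝ) • yosida (α n) (J n)) h)
        atTop (𝓝 (T t h)) := by
  have hα : ∀ n : ℕ, (0 : ℝ) < 1 / (n + 1) := fun n => Nat.one_div_pos_of_nat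
  choose J hJ using fun n : ℕ => hD.exists_isResolvent (hα n)
  have hα0 := tendsto_one_div_add_atTop_nhds_zero_nat (𝕜 := ℝ)
  choose T hT using fun (t : ℝ≥0) h =>
    cauchySeq_tendsto_of_complete (cauchySeq_exp_yosida hD hα hα0 hJ t h)
  let T' : ℝ≥0 → H →L[ℝ] H := fun t =>
    ContinuousLinearMap.ofTendstoOfBoundedRange (T t) _ (tendsto_pi_nhds.2 (hT t))
      (isBounded_iff_forall_norm_le.2 ⟨1, by
        rintro _ ⟨n, rfl⟩
        exact norm_exp_yosida_le (hα n) (hJ n) t t.2⟩)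
  exact ⟨_, J, T', hα, hJ, isFormSemigroup_limit hD hα hα0 hJ hT, hT⟩

end HilleYosida

/-! ### The Kolmogorov extension theorem for countable discrete state spaces -/

section Kolmogorov

theorem exists_finite_measure_compl_lt {Y : Type*} [Countable Y] [MeasurableSpace Y]
    [DiscreteMeasurableSpace Y] (μ : Measure Y) [IsFiniteMeasure μ] {ε : ℝ≥0∞} (hε : 0 < ε) :
    ∃ K : Set Y, K.Finite ∧ μ Kᶜ < ε := by
  obtain ⟨e, he⟩ := exists_injective_nat Y
  have h1 : Tendsto (fun n : ℕ => μ (e ⁻¹' Set.Ici n)) atTop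
      (𝓝 (μ (⋂ n : ℕ, e ⁻¹' Set.Ici n))) :=
    tendsto_measure_iInter_atTop (fun n => (MeasurableSet.of_discrete).nullMeasurableSet)
      (fun m n hmn => Set.preimage_mono (Set.Ici_subset_Ici.2 hmn)) ⟨0, measure_ne_top _ _⟩
  have h2 : (⋂ n : ℕ, e ⁻¹' Set.Ici n) = ∅ := by
    ext y
    simp only [Set.mem_iInter, Set.mem_preimage, Set.mem_Ici, Set.mem_empty_iff_false, iff_false,
      not_forall, not_le]
    exact ⟨e y + 1, Nat.lt_succ_self _⟩
  rw [h2, measure_empty] at h1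
  obtain ⟨n, hn⟩ := (h1.eventually_lt_const hε).exists
  refine ⟨e ⁻¹' Set.Iio n, (Set.finite_Iio n).preimage he.injOn, ?_⟩
  rwa [← Set.preimage_compl, Set.compl_Iio]

variable {ι X : Type*} [Nonempty X]

/-- A sequence of cylinders with finite bases, any finitely many of which intersect, has a common
point. -/
theorem nonempty_iInter_cylinder (s : ℕ → Finset ι) (K : ∀ n, Set (s n → X))
    (hK : ∀ n, (K n).Finite) (h : ∀ n, ∃ ω : ι → X, ∀ k ≤ n, (s k).restrict ω ∈ K k) :
    ∃ ω : ι → X, ∀ k, (s k).restrict ω ∈ K k := by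
  choose w hw using h
  -- Along a free ultrafilter each restriction, taking values in a finite set, is eventually
  -- constant. So every coordinate that occurs in some base has a limit; the others are arbitrary.
  let U : Ultrafilter ℕ := hyperfilter ℕ
  have hU : ∀ k : ℕ, ∀ᶠ n in (U : Filter ℕ), k ≤ n := fun k =>
    (Nat.hyperfilter_le_atTop : (U : Filter ℕ) ≤ atTop) (eventually_ge_atTop k)
  have hlim : ∀ k, ∃ b ∈ K k, ∀ᶠ n in (U : Filter ℕ), (s k).restrict (w n) = b := by
    intro k
    rw [← Ultrafilter.eventually_exists_mem_iff (hK k)]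
    filter_upwards [hU k] with n hn
    exact ⟨_, hw n k hn, rfl⟩
  have hpt : ∀ i : ι, ∃ x : X, ∀ k, i ∈ s k → ∀ᶠ n in (U : Filter ℕ), w n i = x := by
    intro i
    by_cases hi : ∃ k, i ∈ s k
    · obtain ⟨k, hk⟩ := hi
      obtain ⟨b, -, hb⟩ := hlim k
      exact ⟨b ⟨i, hk⟩, fun _ _ => hb.mono fun n hn => congrFun hn ⟨i, hk⟩⟩
    · exact ⟨Classical.arbitrary X, fun k hk => (hi ⟨k, hk⟩).elim⟩
  choose ω hω using hpt
  refine ⟨ω, fun k => ?_⟩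
  have h1 : ∀ᶠ n in (U : Filter ℕ), ∀ i ∈ s k, w n i = ω i :=
    (Filter.eventually_all_finset (s k)).2 fun i hi => hω i k hi
  obtain ⟨n, hn, hkn⟩ := (h1.and (hU k)).exists
  have h2 : (s k).restrict ω = (s k).restrict (w n) := by
    ext i
    exact (hn i i.2).symm
  rw [h2]
  exact hw n k hkn

variable [Countable X] [MeasurableSpace X] [DiscreteMeasurableSpace X]
variable {P : ∀ J : Finset ι, Measure (J → X)} [∀ J, IsFiniteMeasure (P J)]

/-- Finite sets replace compact ones. If the contents stayed above `c > 0`, shrink the base of each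
cylinder to a finite set, losing less than `c` in total. No `A n` is covered by the discarded parts
up to `n`, so `nonempty_iInter_cylinder` gives a point in every `A n`. -/
theorem projectiveFamilyContent_tendsto_zero (hP : IsProjectiveMeasureFamily P)
    {A : ℕ → Set (ι → X)} (A_mem : ∀ n, A n ∈ measurableCylinders (fun _ : ι => X))
    (A_anti : Antitone A) (A_inter : ⋂ n, A n = ∅) :
    Tendsto (fun n => projectiveFamilyContent hP (A n)) atTop (𝓝 0) := by
  have hmono : Antitone fun n => projectiveFamilyContent hP (A n) := fun m n hmn =>
    projectiveFamilyContent_mono hP (A_mem n) (A_mem m) (A_anti hmn)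
  have h1 := tendsto_atTop_iInf hmono
  set c := ⨅ n, projectiveFamilyContent hP (A n) with hc
  by_cases hc0 : c = 0
  · rwa [hc0] at h1
  exfalso
  have A_cyl n : ∃ s S, MeasurableSet S ∧ A n = cylinder s S :=
    (mem_measurableCylinders _).1 (A_mem n)
  choose s S mS A_eq using A_cyl
  obtain ⟨δ, hδ0, hδ⟩ := ENNReal.exists_pos_sum_of_countable hc0 ℕ
  choose F hF hFδ using fun n => exists_finite_measure_compl_lt (P (s n))
    (ENNReal.coe_pos.2 (hδ0 n))
  have hK : ∀ n, ∃ ω : ι → X, ∀ k ≤ n, (s k).restrict ω ∈ S k ∩ F k := by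
    intro n
    by_contra! hcon
    have hsub : A n ⊆ ⋃ k ∈ Finset.range (n + 1), cylinder (s k) (F k)ᶜ := by
      intro ω hω
      obtain ⟨k, hk, hk'⟩ := hcon ω
      have h2 := A_anti hk hω
      rw [A_eq] at h2
      simp only [Set.mem_iUnion]
      exact ⟨k, Finset.mem_range_succ_iff.2 hk, fun h3 => hk' ⟨h2, h3⟩⟩
    have hcyl : ∀ k, cylinder (s k) (F k)ᶜ ∈ measurableCylinders (fun _ : ι => X) := fun k =>
      cylinder_mem_measurableCylinders _ _ MeasurableSet.of_discrete
    have h4 : projectiveFamilyContent hP (A n) ≤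
        ∑ k ∈ Finset.range (n + 1), projectiveFamilyContent hP (cylinder (s k) (F k)ᶜ) := by
      refine (projectiveFamilyContent_mono hP (A_mem n) ?_ hsub).trans
        (addContent_biUnion_le isSetRing_measurableCylinders fun k _ => hcyl k)
      exact isSetRing_measurableCylinders.biUnion_mem _ fun k _ => hcyl k
    have h5 : c ≤ ∑ k ∈ Finset.range (n + 1), (δ k : ℝ≥0∞) := by
      refine (iInf_le _ n).trans (h4.trans (Finset.sum_le_sum fun k _ => ?_))
      rw [projectiveFamilyContent_cylinder hP MeasurableSet.of_discrete]
      exact (hFδ k).le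
    exact absurd (h5.trans (ENNReal.sum_le_tsum _)) (not_le.2 hδ)
  obtain ⟨ω, hω⟩ := nonempty_iInter_cylinder s (fun n => S n ∩ F n)
    (fun n => (hF n).inter_of_right _) hK
  have : ω ∈ ⋂ n, A n := Set.mem_iInter.2 fun n => by
    rw [A_eq]
    exact (hω n).1
  rw [A_inter] at this
  exact this

theorem exists_isProjectiveLimit (hP : IsProjectiveMeasureFamily (α := fun _ : ι => X) P) :
    ∃ ν : Measure (ι → X), IsProjectiveLimit ν P := by
  have hsub : (projectiveFamilyContent hP).IsSigmaSubadditive := by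
    refine isSigmaSubadditive_of_addContent_iUnion_eq_tsum
      isSetRing_measurableCylinders (fun f hf hf_Union hf' => ?_)
    exact addContent_iUnion_eq_sum_of_tendsto_zero isSetRing_measurableCylinders
      _ (fun s hs => projectiveFamilyContent_ne_top _)
      (fun _ => projectiveFamilyContent_tendsto_zero hP) hf hf_Union hf'
  refine ⟨(projectiveFamilyContent hP).measure isSetSemiring_measurableCylinders
    generateFrom_measurableCylinders.ge hsub, fun I => ?_⟩
  ext S hS
  rw [Measure.map_apply (by fun_prop) hS, AddContent.measure_eq, ← cylinder,
    projectiveFamilyContent_cylinder hP hS]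
  · exact generateFrom_measurableCylinders.symm
  · exact cylinder_mem_measurableCylinders _ _ hS

end Kolmogorov

/-! ### Markov processes with given transition functions -/

section TransitionFunction

variable {X : Type*}

open scoped Classical in
/-- Conservative transition functions on a set `X`, in continuous time. -/
structure IsTransitionFunction (p : ℝ≥0 → X → X → ℝ≥0∞) : Prop where
  zero : ∀ x y, p 0 x y = if x = y then 1 else 0
  tsum_eq_one : ∀ t x, ∑' y, p t x y = 1
  add : ∀ s t x y, p (s + t) x y = ∑' z, p s x z * p t z y

/-- The probability to pass through the points `a t`, `t ∈ l`, starting from `x` at time `r`. -/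
def pathWeight (p : ℝ≥0 → X → X → ℝ≥0∞) : X → ℝ≥0 → List ℝ≥0 → (ℝ≥0 → X) → ℝ≥0∞
  | _, _, [], _ => 1
  | x, r, t :: l, a => p (t - r) x (a t) * pathWeight p (a t) t l a

variable {p : ℝ≥0 → X → X → ℝ≥0∞}

theorem pathWeight_congr {l : List ℝ≥0} {a b : ℝ≥0 → X} (h : ∀ t ∈ l, a t = b t) (x : X)
    (r : ℝ≥0) : pathWeight p x r l a = pathWeight p x r l b := by
  induction l generalizing x r with
  | nil => rfl
  | cons t l ih =>
    rw [pathWeight, pathWeight, h t List.mem_cons_self,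
      ih fun s hs => h s (List.mem_cons_of_mem _ hs)]

open scoped Classical in
theorem pathWeight_update {l : List ℝ≥0} {t : ℝ≥0} (ht : t ∉ l) (a : ℝ≥0 → X) (y : X) (x : X)
    (r : ℝ≥0) : pathWeight p x r l (Function.update a t y) = pathWeight p x r l a :=
  pathWeight_congr (fun s hs => Function.update_of_ne (fun h : s = t => ht (h ▸ hs)) _ _) x r

-- Summing out an intermediate time is the Chapman–Kolmogorov equation; summing out a final time
-- uses total mass one. This is the consistency of the finite dimensional distributions.
open scoped Classical in
theorem IsTransitionFunction.tsum_pathWeight (hp : IsTransitionFunction p) {l : List ℝ≥0}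
    (hl : l.Pairwise (· ≤ ·)) {t : ℝ≥0} (ht : t ∉ l) (a : ℝ≥0 → X) (x : X) (r : ℝ≥0)
    (hr : ∀ s ∈ t :: l, r ≤ s) :
    ∑' y, pathWeight p x r (l.orderedInsert (· ≤ ·) t) (Function.update a t y) =
      pathWeight p x r l a := by
  induction l generalizing x r with
  | nil => simpa [pathWeight] using hp.tsum_eq_one (t - r) x
  | cons s l ih =>
    rw [List.mem_cons, not_or] at ht
    rw [List.pairwise_cons] at hl
    rcases le_or_gt t s with hts | hts
    · rw [List.orderedInsert_cons_of_le _ _ hts]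
      simp_rw [pathWeight, Function.update_self, Function.update_of_ne (Ne.symm ht.1),
        pathWeight_update ht.2, ← mul_assoc]
      rw [ENNReal.tsum_mul_right, ← hp.add, add_comm, tsub_add_tsub_cancel hts
        (hr t List.mem_cons_self)]
    · rw [List.orderedInsert_of_not_le _ _ (not_le.2 hts)]
      simp_rw [pathWeight, Function.update_of_ne (Ne.symm ht.1)]
      rw [ENNReal.tsum_mul_left, ih hl.2 ht.2]
      intro u hu
      rcases List.mem_cons.1 hu with rfl | hu
      · exact hts.le
      · exact hl.1 u hu

theorem pathWeight_concat (x : X) (r : ℝ≥0) (l : List ℝ≥0) (s u : ℝ≥0) (a : ℝ≥0 → X) :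
    pathWeight p x r ((l ++ [s]) ++ [u]) a =
      pathWeight p x r (l ++ [s]) a * p (u - s) (a s) (a u) := by
  induction l generalizing x r with
  | nil => simp [pathWeight]
  | cons t l ih => simp only [List.cons_append, pathWeight] at ih ⊢; rw [ih, mul_assoc]

theorem sort_insert_eq_orderedInsert {J : Finset ℝ≥0} {t : ℝ≥0} (ht : t ∉ J) :
    (insert t J).sort = J.sort.orderedInsert (· ≤ ·) t := by
  refine List.Perm.eq_of_pairwise (fun _ _ _ _ => le_antisymm) (Finset.pairwise_sort _ _)
    ((Finset.pairwise_sort _ _).orderedInsert _ _) ?_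
  refine (Finset.sort_perm_toList _ _).trans ((Finset.toList_insert ht).trans ?_)
  exact ((Finset.sort_perm_toList _ _).symm.cons t).trans (List.perm_orderedInsert _ _ _).symm

theorem sort_insert_eq_concat {J : Finset ℝ≥0} {t : ℝ≥0} (ht : ∀ s ∈ J, s < t) :
    (insert t J).sort = J.sort ++ [t] := by
  have htJ : t ∉ J := fun h => lt_irrefl _ (ht t h)
  refine List.Perm.eq_of_pairwise (fun _ _ _ _ => le_antisymm) (Finset.pairwise_sort _ _) ?_ ?_
  · refine List.pairwise_append.2 ⟨Finset.pairwise_sort _ _, List.pairwise_singleton _ _, ?_⟩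
    intro s hs u hu
    rw [List.mem_singleton.1 hu]
    exact (ht s ((Finset.mem_sort _).1 hs)).le
  · refine (Finset.sort_perm_toList _ _).trans ((Finset.toList_insert htJ).trans ?_)
    exact ((Finset.sort_perm_toList _ _).symm.cons t).trans (List.perm_append_singleton _ _).symm

open scoped Classical in
/-- The extension by `x` of a function on a finite set of times. -/
def extendPath (x : X) {J : Finset ℝ≥0} (b : J → X) (t : ℝ≥0) : X :=
  if h : t ∈ J then b ⟨t, h⟩ else x

theorem extendPath_of_mem (x : X) {J : Finset ℝ≥0} (b : J → X) {t : ℝ≥0} (h : t ∈ J) :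
    extendPath x b t = b ⟨t, h⟩ := dif_pos h

variable [Countable X] [MeasurableSpace X] [DiscreteMeasurableSpace X]

/-- The finite dimensional distributions of the Markov process started at `x`. -/
def pathLaw (p : ℝ≥0 → X → X → ℝ≥0∞) (x : X) (J : Finset ℝ≥0) : Measure (J → X) :=
  Measure.sum fun b : J → X => pathWeight p x 0 J.sort (extendPath x b) • Measure.dirac b

theorem pathLaw_apply (x : X) (J : Finset ℝ≥0) (S : Set (J → X)) :
    pathLaw p x J S =
      ∑' b, S.indicator (fun b => pathWeight p x 0 J.sort (extendPath x b)) b := by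
  rw [pathLaw, Measure.sum_apply _ MeasurableSet.of_discrete]
  refine tsum_congr fun b => ?_
  rw [Measure.smul_apply, Measure.dirac_apply]
  by_cases hb : b ∈ S <;> simp [hb]

theorem pathLaw_singleton (x : X) (J : Finset ℝ≥0) (b : J → X) :
    pathLaw p x J {b} = pathWeight p x 0 J.sort (extendPath x b) := by
  rw [pathLaw_apply, tsum_eq_single b]
  · simp
  · intro c hc
    simp [hc]

-- The fibre of the restriction over `b` is parametrized by the value at the extra time `t`, so the
-- mass of the fibre is the sum in `tsum_pathWeight`.
open scoped Classical in
theorem IsTransitionFunction.pathLaw_erase (hp : IsTransitionFunction p) (x : X)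
    {I J : Finset ℝ≥0} {t : ℝ≥0} (ht : t ∉ J) (hI : I = insert t J) (hJI : J ⊆ I) :
    pathLaw p x J = (pathLaw p x I).map (Finset.restrict₂ (π := fun _ => X) hJI) := by
  refine Measure.ext_of_singleton fun b => ?_
  rw [Measure.map_apply (by fun_prop) MeasurableSet.of_discrete, pathLaw_singleton, pathLaw_apply]
  let g : X → I → X := fun y i => Function.update (extendPath x b) t y i
  have htI : t ∈ I := hI ▸ Finset.mem_insert_self _ _
  have hg : Function.Injective g := by
    intro y z h
    simpa [g] using congrFun h ⟨t, htI⟩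
  have hgJ : ∀ y (i : J), g y ⟨i, hJI i.2⟩ = b i := by
    intro y i
    have : (i : ℝ≥0) ≠ t := fun h => ht (h ▸ i.2)
    simp [g, Function.update_of_ne this, extendPath_of_mem x b i.2]
  rw [← hg.tsum_eq]
  · rw [← hp.tsum_pathWeight (Finset.pairwise_sort J (· ≤ ·))
      (fun h => ht ((Finset.mem_sort _).1 h)) (extendPath x b) x 0 (fun _ _ => zero_le),
      ← sort_insert_eq_orderedInsert ht, ← hI]
    refine tsum_congr fun y => ?_
    have hmem : g y ∈ Finset.restrict₂ (π := fun _ => X) hJI ⁻¹' {b} := by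
      ext i
      exact hgJ y i
    rw [Set.indicator_of_mem hmem]
    refine pathWeight_congr (fun s hs => ?_) _ _
    rw [extendPath_of_mem x (g y) ((Finset.mem_sort _).1 hs)]
  · intro c hc
    have hc' : c ∈ Finset.restrict₂ (π := fun _ => X) hJI ⁻¹' {b} := by
      by_contra h
      exact hc (Set.indicator_of_notMem h _)
    refine ⟨c ⟨t, htI⟩, ?_⟩
    ext i
    by_cases hi : (i : ℝ≥0) = t
    · have : i = ⟨t, htI⟩ := Subtype.ext hi
      subst this
      simp [g]
    · have hiJ : (i : ℝ≥0) ∈ J := by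
        have := hI.le i.2
        exact Finset.mem_of_mem_insert_of_ne this hi
      exact (hgJ _ ⟨i, hiJ⟩).trans (congrFun hc' ⟨i, hiJ⟩).symm

theorem IsTransitionFunction.isProjectiveMeasureFamily (hp : IsTransitionFunction p) (x : X) :
    IsProjectiveMeasureFamily (α := fun _ : ℝ≥0 => X) (pathLaw p x) := by
  classical
  have key : ∀ (n : ℕ) (I J : Finset ℝ≥0) (hJI : J ⊆ I), (I \ J).card = n →
      pathLaw p x J = (pathLaw p x I).map (Finset.restrict₂ (π := fun _ => X) hJI) := by
    intro n
    induction n with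
    | zero =>
      intro I J hJI h
      rw [Finset.card_eq_zero, Finset.sdiff_eq_empty_iff_subset] at h
      obtain rfl := Finset.Subset.antisymm h hJI
      exact Measure.map_id.symm
    | succ n ih =>
      intro I J hJI h
      obtain ⟨t, ht⟩ := Finset.card_pos.1 (h ▸ Nat.succ_pos n : 0 < (I \ J).card)
      rw [Finset.mem_sdiff] at ht
      have h1 : J ⊆ I.erase t := Finset.subset_erase.2 ⟨hJI, ht.2⟩
      have h2 : ((I.erase t) \ J).card = n := by
        rw [Finset.erase_sdiff_comm, Finset.card_erase_of_mem (Finset.mem_sdiff.2 ht), h]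
        rfl
      rw [ih _ _ h1 h2, hp.pathLaw_erase x (Finset.notMem_erase t I)
        (Finset.insert_erase ht.1).symm (Finset.erase_subset _ _),
        Measure.map_map (by fun_prop) (by fun_prop)]
      rfl
  exact fun I J hJI => key _ I J hJI rfl

theorem IsTransitionFunction.isProbabilityMeasure_pathLaw (hp : IsTransitionFunction p) (x : X)
    (J : Finset ℝ≥0) : IsProbabilityMeasure (pathLaw p x J) := by
  refine ⟨?_⟩
  have h1 := hp.isProjectiveMeasureFamily x J ∅ (Finset.empty_subset J)
  have h2 : pathLaw p x ∅ Set.univ = 1 := by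
    rw [pathLaw_apply]
    have : Unique ((∅ : Finset ℝ≥0) → X) := Pi.uniqueOfIsEmpty _
    rw [tsum_eq_single default (fun b hb => (hb (Subsingleton.elim _ _)).elim)]
    simp [pathWeight]
  rwa [h1, Measure.map_apply (by fun_prop) MeasurableSet.univ, Set.preimage_univ] at h2

end TransitionFunction

/-! ### The Markov property on path space -/

section MarkovFamily

variable {X : Type*}

/-- The paths that agree with `a` at the times in `J`. -/
def pathAtom (J : Finset ℝ≥0) (a : ℝ≥0 → X) : Set (ℝ≥0 → X) := {ω | ∀ i ∈ J, ω i = a i}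

/-- Requiring `s ∈ J` makes the present state `ω s` constant on each set of the system; these sets
still generate the history up to `s`. -/
theorem isPiSystem_pathAtom (s : ℝ≥0) :
    IsPiSystem {E | ∃ (J : Finset ℝ≥0) (a : ℝ≥0 → X), s ∈ J ∧ (∀ i ∈ J, i ≤ s) ∧
      E = pathAtom J a} := by
  classical
  rintro _ ⟨J, a, hs, hJ, rfl⟩ _ ⟨K, b, -, hK, rfl⟩ ⟨ω, hω, hω'⟩
  refine ⟨J ∪ K, ω, Finset.mem_union_left _ hs, fun i hi => ?_, ?_⟩
  · rcases Finset.mem_union.1 hi with h | h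
    exacts [hJ i h, hK i h]
  · ext η
    constructor
    · rintro ⟨h1, h2⟩ i hi
      rcases Finset.mem_union.1 hi with h | h
      · rw [h1 i h, hω i h]
      · rw [h2 i h, hω' i h]
    · intro h
      exact ⟨fun i hi => (h i (Finset.mem_union_left _ hi)).trans (hω i hi),
        fun i hi => (h i (Finset.mem_union_right _ hi)).trans (hω' i hi)⟩

variable [MeasurableSpace X]

theorem measurableSet_pathAtom [DiscreteMeasurableSpace X] (J : Finset ℝ≥0) (a : ℝ≥0 → X) :
    MeasurableSet (pathAtom J a) := by
  have : pathAtom J a = ⋂ i ∈ J, (fun ω : ℝ≥0 → X => ω i) ⁻¹' {a i} := by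
    ext ω
    simp [pathAtom]
  rw [this]
  exact Finset.measurableSet_biInter _ fun i _ =>
    measurable_pi_apply i MeasurableSet.of_discrete

theorem history_le (s : ℝ≥0) :
    (⨆ r : Set.Iic s, MeasurableSpace.comap (fun ω : ℝ≥0 → X => ω r) inferInstance) ≤
      MeasurableSpace.pi :=
  iSup_le fun r => (measurable_pi_apply (r : ℝ≥0)).comap_le

variable [Countable X] [DiscreteMeasurableSpace X]

theorem generateFrom_pathAtom (s : ℝ≥0) :
    (⨆ r : Set.Iic s, MeasurableSpace.comap (fun ω : ℝ≥0 → X => ω r) inferInstance) =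
      MeasurableSpace.generateFrom {E | ∃ (J : Finset ℝ≥0) (a : ℝ≥0 → X), s ∈ J ∧
        (∀ i ∈ J, i ≤ s) ∧ E = pathAtom J a} := by
  classical
  refine le_antisymm (iSup_le fun r => ?_) (MeasurableSpace.generateFrom_le ?_)
  · rintro _ ⟨A, -, rfl⟩
    have hA : (fun ω : ℝ≥0 → X => ω r) ⁻¹' A = ⋃ x ∈ A, ⋃ y : X,
        (pathAtom {(r : ℝ≥0), s} (fun t => if t = r then x else y) : Set (ℝ≥0 → X)) := by
      ext ω
      simp only [Set.mem_preimage, Set.mem_iUnion, pathAtom, Finset.mem_insert,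
        Finset.mem_singleton, forall_eq_or_imp, forall_eq, Set.mem_ofPred_eq, if_true]
      constructor
      · intro h
        refine ⟨ω r, h, ω s, rfl, ?_⟩
        split_ifs with hsr
        · exact congrArg ω hsr
        · rfl
      · rintro ⟨x, hx, y, h, -⟩
        rwa [h]
    rw [hA]
    refine MeasurableSet.biUnion (Set.to_countable A) fun x _ => MeasurableSet.iUnion fun y => ?_
    refine MeasurableSpace.measurableSet_generateFrom ⟨{(r : ℝ≥0), s}, _, by simp, ?_, rfl⟩
    simp only [Finset.mem_insert, Finset.mem_singleton, forall_eq_or_imp, forall_eq, le_refl,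
      and_true]
    exact r.2
  · rintro _ ⟨J, a, -, hJ, rfl⟩
    have : pathAtom J a = ⋂ i ∈ J, (fun ω : ℝ≥0 → X => ω i) ⁻¹' {a i} := by
      ext ω
      simp [pathAtom]
    rw [this]
    refine Finset.measurableSet_biInter _ fun i hi => ?_
    refine (le_iSup (fun r : Set.Iic s => MeasurableSpace.comap (fun ω : ℝ≥0 → X => ω r)
      inferInstance) ⟨i, hJ i hi⟩) _ ?_
    exact ⟨{a i}, MeasurableSet.of_discrete, rfl⟩

variable {p : ℝ≥0 → X → X → ℝ≥0∞} {P : X → Measure (ℝ≥0 → X)}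

theorem measure_pathAtom
    (hP : ∀ x, IsProjectiveLimit (α := fun _ : ℝ≥0 => X) (P x) (pathLaw p x)) (x : X)
    (J : Finset ℝ≥0) (a : ℝ≥0 → X) : P x (pathAtom J a) = pathWeight p x 0 J.sort a := by
  have h1 : pathAtom J a = (J.restrict (π := fun _ => X)) ⁻¹' {J.restrict (π := fun _ => X) a} := by
    ext ω
    simp [pathAtom, funext_iff]
  rw [h1, ← Measure.map_apply (by fun_prop) MeasurableSet.of_discrete, hP x J, pathLaw_singleton]
  refine pathWeight_congr (fun t ht => ?_) _ _
  rw [extendPath_of_mem _ _ ((Finset.mem_sort _).1 ht)]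
  rfl

theorem measure_eval_eq
    (hP : ∀ x, IsProjectiveLimit (α := fun _ : ℝ≥0 => X) (P x) (pathLaw p x)) (x y : X)
    (t : ℝ≥0) : P x ((fun ω => ω t) ⁻¹' {y}) = p t x y := by
  have h1 := measure_pathAtom hP x {t} (fun _ => y)
  rw [Finset.sort_singleton] at h1
  convert h1 using 2
  · ext ω
    simp [pathAtom]
  · simp [pathWeight]

theorem IsTransitionFunction.measure_pathAtom_inter (hp : IsTransitionFunction p)
    (hP : ∀ x, IsProjectiveLimit (α := fun _ : ℝ≥0 => X) (P x) (pathLaw p x)) (x y : X)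
    (s t : ℝ≥0) {J : Finset ℝ≥0} (hs : s ∈ J) (hJ : ∀ i ∈ J, i ≤ s) (a : ℝ≥0 → X) :
    P x (pathAtom J a ∩ (fun ω => ω (s + t)) ⁻¹' {y}) = P x (pathAtom J a) * p t (a s) y := by
  classical
  -- For `t = 0` the time `s + t` already belongs to `J`. Otherwise it is appended as the last time,
  -- contributing one more transition factor.
  rcases eq_or_ne t 0 with rfl | ht
  · rw [hp.zero, add_zero]
    split_ifs with h
    · rw [mul_one]
      congr 1
      exact Set.inter_eq_left.2 fun ω hω => (hω s hs).trans h
    · rw [mul_zero]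
      convert measure_empty (μ := P x)
      ext ω
      simp only [Set.mem_inter_iff, Set.mem_preimage, Set.mem_singleton_iff,
        Set.mem_empty_iff_false, iff_false, not_and]
      exact fun hω h2 => h ((hω s hs).symm.trans h2)
  · have hst : s < s + t := lt_add_of_pos_right s (pos_iff_ne_zero.2 ht)
    have hnot : s + t ∉ J := fun h => absurd (hJ _ h) (not_le.2 hst)
    have h1 : pathAtom J a ∩ (fun ω => ω (s + t)) ⁻¹' {y} =
        pathAtom (insert (s + t) J) (Function.update a (s + t) y) := by
      ext ω
      simp only [pathAtom, Set.mem_inter_iff, Set.mem_ofPred_eq, Set.mem_preimage,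
        Set.mem_singleton_iff, Finset.mem_insert, forall_eq_or_imp, Function.update_self]
      rw [and_comm]
      refine and_congr_right fun _ => forall₂_congr fun i hi => ?_
      rw [Function.update_of_ne fun h : i = s + t => hnot (h ▸ hi)]
    have h2 : J.sort = (J.erase s).sort ++ [s] := by
      conv_lhs => rw [← Finset.insert_erase hs]
      exact sort_insert_eq_concat fun i hi =>
        lt_of_le_of_ne (hJ i (Finset.mem_of_mem_erase hi)) (Finset.ne_of_mem_erase hi)
    rw [h1, measure_pathAtom hP, measure_pathAtom hP,
      sort_insert_eq_concat fun i hi => (hJ i hi).trans_lt hst, h2, pathWeight_concat, ← h2,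
      Function.update_self, Function.update_of_ne hst.ne, add_tsub_cancel_left,
      pathWeight_update fun h => hnot ((Finset.mem_sort _).1 h)]

theorem IsTransitionFunction.measure_pathAtom_inter_preimage (hp : IsTransitionFunction p)
    (hP : ∀ x, IsProjectiveLimit (α := fun _ : ℝ≥0 => X) (P x) (pathLaw p x)) (x : X)
    (s t : ℝ≥0) {J : Finset ℝ≥0} (hs : s ∈ J) (hJ : ∀ i ∈ J, i ≤ s) (a : ℝ≥0 → X) (A : Set X) :
    P x (pathAtom J a ∩ (fun ω => ω (s + t)) ⁻¹' A) =
      P x (pathAtom J a) * P (a s) ((fun ω => ω t) ⁻¹' A) := by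
  have h1 : ((P x).restrict (pathAtom J a)).map (fun ω => ω (s + t)) =
      P x (pathAtom J a) • (P (a s)).map (fun ω => ω t) := by
    refine Measure.ext_of_singleton fun y => ?_
    rw [Measure.smul_apply, Measure.map_apply (by fun_prop) MeasurableSet.of_discrete,
      Measure.map_apply (by fun_prop) MeasurableSet.of_discrete,
      Measure.restrict_apply (measurable_pi_apply _ MeasurableSet.of_discrete), Set.inter_comm,
      hp.measure_pathAtom_inter hP x y s t hs hJ a, measure_eval_eq hP, smul_eq_mul]
  have h2 := congrArg (fun ν => ν A) h1
  rw [Measure.smul_apply, Measure.map_apply (by fun_prop) MeasurableSet.of_discrete,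
    Measure.map_apply (by fun_prop) MeasurableSet.of_discrete,
    Measure.restrict_apply (measurable_pi_apply _ MeasurableSet.of_discrete), Set.inter_comm,
    smul_eq_mul] at h2
  exact h2

/-- As functions of `E`, both sides are measures on the history up to `s`. They agree on the
generating pi-system, where the integrand is constant, and the atoms `{ω s = y}` form a countable
cover by sets of finite measure. -/
theorem IsTransitionFunction.measure_inter_eq_lintegral (hp : IsTransitionFunction p)
    (hP : ∀ x, IsProjectiveLimit (α := fun _ : ℝ≥0 => X) (P x) (pathLaw p x))
    [∀ x, IsProbabilityMeasure (P x)] (x : X) (s t : ℝ≥0) (A : Set X) {E : Set (ℝ≥0 → X)}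
    (hE : MeasurableSet[⨆ r : Set.Iic s, MeasurableSpace.comap (fun ω : ℝ≥0 → X => ω r)
      inferInstance] E) :
    P x (E ∩ (fun ω => ω (s + t)) ⁻¹' A) =
      ∫⁻ ω in E, P (ω s) ((fun ω => ω t) ⁻¹' A) ∂(P x) := by
  classical
  set g : (ℝ≥0 → X) → ℝ≥0∞ := fun ω => P (ω s) ((fun ω => ω t) ⁻¹' A) with hg
  have hgm : Measurable g :=
    (measurable_of_countable fun y => P y ((fun ω => ω t) ⁻¹' A)).comp (measurable_pi_apply s)
  set B : Set (ℝ≥0 → X) := (fun ω => ω (s + t)) ⁻¹' A with hB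
  have hBm : MeasurableSet B := measurable_pi_apply _ MeasurableSet.of_discrete
  have key : ((P x).restrict B).trim (history_le s) =
      ((P x).withDensity g).trim (history_le s) := by
    refine Measure.ext_of_generateFrom_of_cover_subset (generateFrom_pathAtom s)
      (isPiSystem_pathAtom s) (T := Set.range fun y : X => pathAtom {s} (fun _ => y)) ?_
      (Set.countable_range _) ?_ ?_ ?_
    · rintro _ ⟨y, rfl⟩
      exact ⟨{s}, fun _ => y, by simp, by simp, rfl⟩
    · refine Set.eq_univ_of_forall fun ω => ⟨_, ⟨ω s, rfl⟩, ?_⟩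
      simp [pathAtom]
    · intro E _
      have : IsFiniteMeasure (((P x).restrict B).trim (history_le s)) := isFiniteMeasure_trim _
      exact measure_ne_top _ _
    · rintro _ ⟨J, a, hs, hJ, rfl⟩
      have hm : MeasurableSet[⨆ r : Set.Iic s, MeasurableSpace.comap
          (fun ω : ℝ≥0 → X => ω r) inferInstance] (pathAtom J a) := by
        rw [generateFrom_pathAtom s]
        exact MeasurableSpace.measurableSet_generateFrom ⟨J, a, hs, hJ, rfl⟩
      rw [trim_measurableSet_eq _ hm, trim_measurableSet_eq _ hm,
        Measure.restrict_apply (measurableSet_pathAtom J a),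
        withDensity_apply _ (measurableSet_pathAtom J a),
        hp.measure_pathAtom_inter_preimage hP x s t hs hJ a A,
        setLIntegral_congr_fun (g := fun _ => P (a s) ((fun ω => ω t) ⁻¹' A))
          (measurableSet_pathAtom J a) (fun ω hω => by rw [hg]; simp only [hω s hs]),
        setLIntegral_const, mul_comm]
  have h1 := congrArg (fun ν => ν E) key
  rw [trim_measurableSet_eq _ hE, trim_measurableSet_eq _ hE,
    Measure.restrict_apply (history_le s _ hE), withDensity_apply _ (history_le s _ hE)] at h1
  exact h1

theorem IsTransitionFunction.isMarkovProcess (hp : IsTransitionFunction p)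
    (hP : ∀ x, IsProjectiveLimit (α := fun _ : ℝ≥0 => X) (P x) (pathLaw p x)) :
    IsMarkovProcess P (fun (t : ℝ≥0) (ω : ℝ≥0 → X) => ω t) := by
  have hprob : ∀ x, IsProbabilityMeasure (P x) := fun x => by
    have := hp.isProbabilityMeasure_pathLaw x
    exact (hP x).isProbabilityMeasure
  refine ⟨hprob, fun t => measurable_pi_apply t, fun x => ?_, fun x s t A _ => ?_⟩
  · have h1 := measure_eval_eq hP x x 0
    rw [hp.zero, if_pos rfl, ← measure_univ (μ := P x)] at h1
    have h2 := (measure_compl (measurable_pi_apply (0 : ℝ≥0)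
      (MeasurableSet.of_discrete (s := ({x} : Set X)))) (measure_ne_top (P x) _))
    rw [h1, tsub_self] at h2
    exact h2
  · symm
    set g : (ℝ≥0 → X) → ℝ≥0∞ := fun ω => P (ω s) ((fun ω => ω t) ⁻¹' A) with hg
    have hgm : Measurable[⨆ r : Set.Iic s, MeasurableSpace.comap (fun ω : ℝ≥0 → X => ω r)
        inferInstance] g := by
      refine (measurable_of_countable fun y => P y ((fun ω => ω t) ⁻¹' A)).comp ?_
      exact Measurable.of_comap_le (le_iSup (fun r : Set.Iic s => MeasurableSpace.comap
        (fun ω : ℝ≥0 → X => ω r) inferInstance) ⟨s, Set.mem_Iic.2 le_rfl⟩)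
    have hBm : MeasurableSet ((fun ω : ℝ≥0 → X => ω (s + t)) ⁻¹' A) :=
      measurable_pi_apply _ MeasurableSet.of_discrete
    have hgi : Integrable (fun ω => (g ω).toReal) (P x) := by
      refine Integrable.of_bound (C := 1)
        ((hgm.mono (history_le s) le_rfl).ennreal_toReal.aestronglyMeasurable)
        (Eventually.of_forall fun ω => ?_)
      rw [Real.norm_of_nonneg ENNReal.toReal_nonneg]
      exact measureReal_le_one
    refine ae_eq_condExp_of_forall_setIntegral_eq (history_le s) (g := fun ω => (g ω).toReal)
      ((integrable_const (1 : ℝ)).indicator hBm) (fun E _ _ => hgi.integrableOn)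
      (fun E hE _ => ?_) ?_
    · rw [integral_toReal (hgm.mono (history_le s) le_rfl).aemeasurable
        (Eventually.of_forall fun ω => measure_lt_top _ _),
        ← hp.measure_inter_eq_lintegral hP x s t A hE, integral_indicator hBm,
        Measure.restrict_restrict hBm, setIntegral_const, smul_eq_mul, mul_one, Set.inter_comm]
      rfl
    · exact hgm.ennreal_toReal.aestronglyMeasurable

end MarkovFamily

/-! ### Truncation and pointwise estimates for resistance forms -/

namespace IsResistanceForm

variable {X : Type*} {R : FormOn (X → ℝ)}

/-- The constant function `c` as an element of the domain of a resistance form. -/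
def const (hR : IsResistanceForm R) (c : ℝ) : R.domain := ⟨fun _ => c, hR.const_mem c⟩

/-- Cauchy–Schwarz in degenerate form: as `E(c, c) = 0`, the energy of `v + λ c` is affine in `λ`,
and nonnegativity forces zero slope. The multiple chosen would give energy `-1`. -/
theorem form_const_left (hR : IsResistanceForm R) (c : ℝ) (v : R.domain) :
    R.form (hR.const c) v = 0 := by
  have h0 : R.form (hR.const c) (hR.const c) = 0 := (hR.eq_zero_iff _).2 ⟨c, fun _ => rfl⟩
  by_contra hk
  have h1 := hR.nonneg (v + (-(R.form v v + 1) / (2 * R.form (hR.const c) v)) • hR.const c)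
  simp only [map_add, map_smul, LinearMap.add_apply, LinearMap.smul_apply, smul_eq_mul, h0,
    hR.symm v (hR.const c)] at h1
  have h2 : -(R.form v v + 1) / (2 * R.form (hR.const c) v) * R.form (hR.const c) v =
      -(R.form v v + 1) / 2 := by field_simp
  rw [h2] at h1
  linarith

theorem form_const_right (hR : IsResistanceForm R) (c : ℝ) (v : R.domain) :
    R.form v (hR.const c) = 0 := by
  rw [hR.symm, hR.form_const_left]

theorem form_add_const (hR : IsResistanceForm R) (c : ℝ) (v : R.domain) :
    R.form (v + hR.const c) (v + hR.const c) = R.form v v := by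
  simp [hR.form_const_left, hR.form_const_right]

theorem exists_resistance (hR : IsResistanceForm R) (x y : X) :
    ∃ C : ℝ, 0 ≤ C ∧ ∀ u : R.domain, (u.1 x - u.1 y) ^ 2 ≤ C * R.form u u := by
  obtain ⟨C, hC⟩ := hR.resistance_finite x y
  refine ⟨max C 0, le_max_right _ _, fun u => ?_⟩
  rcases (hR.nonneg u).eq_or_lt with h | h
  · obtain ⟨c, hc⟩ := (hR.eq_zero_iff u).1 h.symm
    rw [← h, hc, hc]
    simp
  · have := hC ⟨u, h, rfl⟩
    rw [div_le_iff₀ h] at this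
    exact this.trans (mul_le_mul_of_nonneg_right (le_max_left _ _) h.le)

theorem exists_clamp (hR : IsResistanceForm R) {a b : ℝ} (hab : a < b) (u : R.domain) :
    ∃ w : R.domain, (∀ x, w.1 x = max a (min b (u.1 x))) ∧ R.form w w ≤ R.form u u := by
  have hba : 0 < b - a := sub_pos.2 hab
  obtain ⟨w, hw, hle⟩ := hR.markov ((b - a)⁻¹ • (u + hR.const (-a)))
  refine ⟨(b - a) • w + hR.const a, fun x => ?_, ?_⟩
  · change (b - a) * w.1 x + a = _
    rw [hw]
    change (b - a) * max 0 (min 1 ((b - a)⁻¹ * (u.1 x + -a))) + a = _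
    rw [mul_max_of_nonneg _ _ hba.le, mul_min_of_nonneg _ _ hba.le, mul_inv_cancel_left₀ hba.ne',
      max_add, min_add]
    simp
  · rw [hR.form_add_const]
    simp only [map_smul, LinearMap.smul_apply, smul_eq_mul, hR.form_add_const] at hle ⊢
    have h1 : (b - a) * ((b - a)⁻¹ * ((b - a) * ((b - a)⁻¹ * R.form u u))) = R.form u u := by
      field_simp
    have h2 := mul_le_mul_of_nonneg_left hle (mul_pos hba hba).le
    calc (b - a) * ((b - a) * R.form w w) = (b - a) * (b - a) * R.form w w := by ring
      _ ≤ _ := h2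
      _ = R.form u u := by field_simp

/-- Truncation at the levels `-n` and `n` lowers the energy at least by that of the remainder. -/
theorem form_sub_clamp_le (hR : IsResistanceForm R) {n : ℝ} (hn : 0 < n) {u v : R.domain}
    (hv : ∀ x, v.1 x = max (-n) (min n (u.1 x))) :
    R.form (u - v) (u - v) ≤ R.form u u - R.form v v := by
  -- Moving from `v` towards `u` changes only points where `v = ±n`, and moves them outward.
  -- Truncation undoes this, so `v` has least energy on the segment from `v` to `u`, and its
  -- directional derivative there is nonnegative.
  have hcross : 0 ≤ R.form v (u - v) := by
    by_contra! hneg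
    have hs : ∀ s : ℝ, 0 < s → s ≤ 1 → 0 ≤ 2 * R.form v (u - v) + s * R.form (u - v) (u - v) := by
      intro s hs0 hs1
      obtain ⟨w, hw, hle⟩ := hR.exists_clamp (neg_lt_self hn) (v + s • (u - v))
      have hwv : w = v := by
        refine Subtype.ext (funext fun x => ?_)
        rw [hw]
        change max (-n) (min n (v.1 x + s * (u.1 x - v.1 x))) = v.1 x
        rw [hv]
        rcases le_total (u.1 x) n with h1 | h1
        · rcases le_total (u.1 x) (-n) with h2 | h2
          · rw [min_eq_right h1, max_eq_left h2]
            have h3 : -n + s * (u.1 x - -n) ≤ -n := by nlinarith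
            rw [min_eq_right (h3.trans (by linarith)), max_eq_left h3]
          · rw [min_eq_right h1, max_eq_right h2, sub_self, mul_zero, add_zero, min_eq_right h1,
              max_eq_right h2]
        · rw [min_eq_left h1, max_eq_right (by linarith : -n ≤ n)]
          have h3 : n ≤ n + s * (u.1 x - n) := by nlinarith
          rw [min_eq_left h3, max_eq_right (by linarith : -n ≤ n)]
      rw [hwv] at hle
      simp only [map_add, map_smul, LinearMap.add_apply, LinearMap.smul_apply, smul_eq_mul,
        hR.symm (u - v) v] at hle
      have h4 : 0 ≤ s * (2 * R.form v (u - v) + s * R.form (u - v) (u - v)) := by linarith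
      exact nonneg_of_mul_nonneg_right h4 hs0
    have hE := hR.nonneg (u - v)
    set k := R.form v (u - v)
    set e := R.form (u - v) (u - v)
    have hd : 0 < e - k := by linarith
    -- This `s` lies in `(0, 1]` and satisfies `s e ≤ -k`, so `2k + s e ≤ k < 0`.
    have h5 := hs (-k / (e - k)) (div_pos (by linarith) hd) ((div_le_one hd).2 (by linarith))
    have h6 : -k / (e - k) * e ≤ -k := by
      rw [div_mul_eq_mul_div, div_le_iff₀ hd]
      nlinarith
    linarith
  have h1 : R.form u u = R.form v v + 2 * R.form v (u - v) + R.form (u - v) (u - v) := by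
    simp only [map_sub, LinearMap.sub_apply, hR.symm u v]
    ring
  linarith

/-- Bounded functions are dense in the domain of a resistance form. -/
theorem exists_bounded_approx (hR : IsResistanceForm R) (x₀ : X) (u : R.domain) {ε : ℝ}
    (hε : 0 < ε) : ∃ w : R.domain, (∃ C : ℝ, ∀ x, |w.1 x| ≤ C) ∧ w.1 x₀ = u.1 x₀ ∧
      R.form (u - w) (u - w) < ε := by
  have hpos : ∀ n : ℕ, (0 : ℝ) < n + 1 := fun n => Nat.cast_add_one_pos n
  choose w hw hle using fun n : ℕ => hR.exists_clamp (neg_lt_self (hpos n)) u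
  have hmn : ∀ {m n : ℕ}, m ≤ n →
      R.form (w n - w m) (w n - w m) ≤ R.form (w n) (w n) - R.form (w m) (w m) := by
    intro m n hmn
    refine hR.form_sub_clamp_le (hpos m) fun x => ?_
    have h1 : (m : ℝ) ≤ n := Nat.cast_le.2 hmn
    rw [hw, hw, min_max_distrib_left, ← min_assoc, min_eq_left (by linarith : (m : ℝ) + 1 ≤ n + 1),
      ← max_assoc, min_eq_right (by linarith [hpos m, hpos n] : -((n : ℝ) + 1) ≤ m + 1),
      max_eq_left (by linarith : -((n : ℝ) + 1) ≤ -(m + 1))]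
  have hmono : Monotone fun n => R.form (w n) (w n) := fun m n h => by
    have h1 := hmn h
    have h2 := hR.nonneg (w n - w m)
    simp only
    linarith
  have hlim := tendsto_atTop_ciSup hmono ⟨R.form u u, by rintro _ ⟨n, rfl⟩; exact hle n⟩
  have hneg : ∀ v : R.domain, R.form (-v) (-v) = R.form v v := fun v => by simp
  -- The energies of the truncations increase to a finite limit and dominate the energies of
  -- differences.
  have hcauchy : Tendsto (fun p : ℕ × ℕ => R.form (w p.1 - w p.2) (w p.1 - w p.2)) atTop (𝓝 0) := by
    have h1 := cauchySeq_iff_tendsto_dist_atTop_0.1 hlim.cauchySeq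
    refine squeeze_zero (fun p => hR.nonneg _) (fun p => ?_) h1
    rw [Real.dist_eq]
    rcases le_total p.1 p.2 with h | h
    · rw [← neg_sub (w p.2) (w p.1), hneg, abs_sub_comm]
      exact (hmn h).trans (le_abs_self _)
    · exact (hmn h).trans (le_abs_self _)
  obtain ⟨v, hv⟩ := hR.complete w hcauchy
  have hev : ∀ x, ∀ᶠ n in atTop, (w n).1 x = u.1 x := by
    intro x
    obtain ⟨N, hN⟩ := exists_nat_ge |u.1 x|
    filter_upwards [eventually_ge_atTop N] with n hn
    have h1 : (N : ℝ) ≤ n := Nat.cast_le.2 hn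
    obtain ⟨h2, h3⟩ := abs_le.1 hN
    rw [hw, min_eq_right (by linarith), max_eq_right (by linarith)]
  -- Energy convergence implies convergence of point differences by finite resistance, while the
  -- truncations are eventually equal to `u` at each point. So the energy limit is `u` up to a
  -- constant.
  have hconst : ∀ x, u.1 x - v.1 x = u.1 x₀ - v.1 x₀ := by
    intro x
    obtain ⟨C, -, hC⟩ := hR.exists_resistance x x₀
    have h1 : Tendsto (fun n => ((w n - v).1 x - (w n - v).1 x₀) ^ 2) atTop (𝓝 0) :=
      squeeze_zero (fun _ => sq_nonneg _) (fun n => hC _) (by simpa using hv.const_mul C)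
    have h2 : Tendsto (fun n => ((w n - v).1 x - (w n - v).1 x₀) ^ 2) atTop
        (𝓝 (((u.1 x - v.1 x) - (u.1 x₀ - v.1 x₀)) ^ 2)) := by
      refine tendsto_const_nhds.congr' ?_
      filter_upwards [hev x, hev x₀] with n h3 h4
      change _ = (((w n).1 x - v.1 x) - ((w n).1 x₀ - v.1 x₀)) ^ 2
      rw [h3, h4]
    have h3 := tendsto_nhds_unique h2 h1
    exact sub_eq_zero.1 (pow_eq_zero_iff two_ne_zero |>.1 h3)
  have huv : v = u + hR.const (-(u.1 x₀ - v.1 x₀)) := by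
    refine Subtype.ext (funext fun x => ?_)
    change v.1 x = u.1 x + -(u.1 x₀ - v.1 x₀)
    rw [← hconst x]; ring
  have hw0 : ∀ n, R.form (u - w n) (u - w n) = R.form (w n - v) (w n - v) := by
    intro n
    rw [← neg_sub (w n) u, hneg, huv, ← sub_sub, sub_eq_add_neg (w n - u)]
    have : -hR.const (-(u.1 x₀ - v.1 x₀)) = hR.const (u.1 x₀ - v.1 x₀) := by
      refine Subtype.ext (funext fun x => ?_)
      change - -(u.1 x₀ - v.1 x₀) = _
      rw [neg_neg]
      rfl
    rw [this, hR.form_add_const]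
  obtain ⟨n, hn1, hn2⟩ := ((hev x₀).and (hv.eventually_lt_const hε)).exists
  refine ⟨w n, ⟨n + 1, fun x => ?_⟩, hn1, (hw0 n).trans_lt hn2⟩
  rw [hw, abs_le]
  exact ⟨le_max_left _ _, max_le (by linarith [hpos n]) (min_le_left _ _)⟩

/-- Extend the indicator from the first points of an enumeration by (RF3), then truncate to `[0,
1]`, which provides a dominating function for limits of integrals. -/
theorem exists_approx_indicator [Countable X] (hR : IsResistanceForm R) (x : X) :
    ∃ u : ℕ → R.domain, (∀ n y, 0 ≤ (u n).1 y ∧ (u n).1 y ≤ 1) ∧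
      ∀ y, ∀ᶠ n in atTop, (u n).1 y = Set.indicator {x} (fun _ => (1 : ℝ)) y := by
  obtain ⟨e, he⟩ := exists_injective_nat X
  have hfin : ∀ n : ℕ, (e ⁻¹' Set.Iio n).Finite := fun n => (Set.finite_Iio n).preimage he.injOn
  have h1 : ∀ n : ℕ, ∃ u : R.domain, (∀ y, 0 ≤ u.1 y ∧ u.1 y ≤ 1) ∧
      ∀ y, e y < n → u.1 y = Set.indicator {x} (fun _ => (1 : ℝ)) y := by
    intro n
    obtain ⟨u, hu⟩ := hR.extend (hfin n).toFinset
      (fun y => Set.indicator {x} (fun _ => (1 : ℝ)) y.1)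
    obtain ⟨w, hw, -⟩ := hR.markov u
    refine ⟨w, fun y => ?_, fun y hy => ?_⟩
    · rw [hw]
      exact ⟨le_max_left _ _, max_le zero_le_one (min_le_left _ _)⟩
    · rw [hw, hu ⟨y, by simpa using hy⟩]
      by_cases hyx : y = x
      · simp [hyx]
      · simp [hyx]
  choose u hu hu' using h1
  exact ⟨u, hu, fun y => (eventually_gt_atTop (e y)).mono fun n hn => hu' n y hn⟩

end IsResistanceForm

/-! ### The measure -/

/-- Finite measures charging all points, for which a Poincaré inequality with base point `x₀`
holds. -/
structure IsAdaptedMeasure {X : Type*} [MeasurableSpace X] (R : FormOn (X → ℝ)) (μ : Measure X)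
    (x₀ : X) : Prop where
  isFiniteMeasure : IsFiniteMeasure μ
  pos : ∀ x, 0 < μ {x}
  poincare : ∀ f : R.domain,
    ∫⁻ x, ENNReal.ofReal ((f.1 x - f.1 x₀) ^ 2) ∂μ ≤ ENNReal.ofReal (R.form f f)

theorem IsResistanceForm.exists_isAdaptedMeasure {X : Type*} [Countable X] [MeasurableSpace X]
    [DiscreteMeasurableSpace X] {R : FormOn (X → ℝ)} (hR : IsResistanceForm R) (x₀ : X) :
    ∃ μ : Measure X, IsAdaptedMeasure R μ x₀ := by
  choose C hC0 hC using fun x => hR.exists_resistance x x₀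
  obtain ⟨δ, hδ0, hδ⟩ := ENNReal.exists_pos_sum_of_countable one_ne_zero X
  -- With `∑ δ < 1`, these weights give total mass below one and `∑ a x · C x ≤ 1`, whence the
  -- Poincaré constant one.
  let a : X → ℝ≥0∞ := fun x => ENNReal.ofReal (δ x / (1 + C x))
  have ha : ∀ x, a x ≤ δ x := by
    intro x
    rw [← ENNReal.ofReal_coe_nnreal]
    exact ENNReal.ofReal_le_ofReal (div_le_self (δ x).2 (by linarith [hC0 x]))
  have hapos : ∀ x, 0 < a x := fun x =>
    ENNReal.ofReal_pos.2 (div_pos (hδ0 x) (by linarith [hC0 x]))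
  refine ⟨Measure.sum fun x => a x • Measure.dirac x, ⟨?_⟩, fun x => ?_, fun f => ?_⟩
  · rw [Measure.sum_apply _ MeasurableSet.univ]
    refine lt_of_le_of_lt (ENNReal.tsum_le_tsum fun x => ?_) (hδ.trans ENNReal.one_lt_top)
    simpa using ha x
  · refine (hapos x).trans_le ?_
    refine le_trans ?_ (Measure.le_sum (fun x => a x • Measure.dirac x) x {x})
    simp
  · rw [lintegral_sum_measure]
    simp_rw [lintegral_smul_measure, lintegral_dirac]
    calc ∑' x, a x • ENNReal.ofReal ((f.1 x - f.1 x₀) ^ 2)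
        ≤ ∑' x, δ x * ENNReal.ofReal (R.form f f) := by
          refine ENNReal.tsum_le_tsum fun x => ?_
          rw [smul_eq_mul, ← ENNReal.ofReal_coe_nnreal, ← ENNReal.ofReal_mul (by
            have := hC0 x; positivity), ← ENNReal.ofReal_mul (δ x).coe_nonneg]
          refine ENNReal.ofReal_le_ofReal ?_
          have h0 := hC0 x
          rw [div_mul_eq_mul_div, div_le_iff₀ (by positivity), mul_assoc]
          refine mul_le_mul_of_nonneg_left ((hC x f).trans ?_) (δ x).coe_nonneg
          have := hR.nonneg f
          nlinarith
      _ ≤ 1 * ENNReal.ofReal (R.form f f) := by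
          rw [ENNReal.tsum_mul_right]
          exact mul_le_mul_left hδ.le _
      _ = _ := one_mul _

/-! ### `L²`-spaces of atomic measures -/

/-- `m` is the image of `μ`, a measure charging all points, under the injective map `i`. -/
structure IsAtomicMap {X Y : Type*} [MeasurableSpace X] [MeasurableSpace Y] (μ : Measure X)
    (m : Measure Y) (i : X → Y) : Prop where
  isFiniteMeasure : IsFiniteMeasure μ
  pos : ∀ x, 0 < μ {x}
  injective : Function.Injective i
  measurePreserving : MeasurePreserving i μ m

namespace IsAtomicMap

variable {X Y : Type*} [MeasurableSpace X] [MeasurableSpace Y] {μ : Measure X} {m : Measure Y}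
  {i : X → Y}

theorem memLp_comp (h : IsAtomicMap μ m i) (u : Lp ℝ 2 m) : MemLp (fun x => u (i x)) 2 μ :=
  (Lp.memLp u).comp_measurePreserving h.measurePreserving

theorem inner_eq (h : IsAtomicMap μ m i) (u v : Lp ℝ 2 m) :
    inner ℝ u v = ∫ x, u (i x) * v (i x) ∂μ := by
  rw [L2.inner_def]
  have h1 : (fun y => inner ℝ (u y) (v y)) = fun y => u y * v y := by
    ext y
    simp [mul_comm]
  have h2 := integral_map (μ := μ) h.measurePreserving.measurable.aemeasurable
    (f := fun y => u y * v y) (by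
      rw [h.measurePreserving.map_eq]
      exact (Lp.aestronglyMeasurable u).mul (Lp.aestronglyMeasurable v))
  rw [h.measurePreserving.map_eq] at h2
  rw [h1, h2]

theorem norm_sq_eq (h : IsAtomicMap μ m i) (u : Lp ℝ 2 m) :
    ‖u‖ ^ 2 = ∫ x, (u (i x)) ^ 2 ∂μ := by
  rw [← real_inner_self_eq_norm_sq, h.inner_eq]
  simp_rw [sq]

theorem norm_sq_eq_lintegral (h : IsAtomicMap μ m i) (u : Lp ℝ 2 m) :
    ENNReal.ofReal (‖u‖ ^ 2) = ∫⁻ x, ENNReal.ofReal ((u (i x)) ^ 2) ∂μ := by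
  rw [h.norm_sq_eq, ofReal_integral_eq_lintegral_ofReal (h.memLp_comp u).integrable_sq
    (Eventually.of_forall fun _ => sq_nonneg _)]

theorem sq_mul_le [DiscreteMeasurableSpace X] (h : IsAtomicMap μ m i) (u : Lp ℝ 2 m) (x : X) :
    (u (i x)) ^ 2 * μ.real {x} ≤ ‖u‖ ^ 2 := by
  have := h.isFiniteMeasure
  rw [h.norm_sq_eq]
  calc (u (i x)) ^ 2 * μ.real {x} = ∫ y in {x}, (u (i y)) ^ 2 ∂μ := by
        rw [integral_singleton, smul_eq_mul, mul_comm]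
    _ ≤ _ := setIntegral_le_integral (h.memLp_comp u).integrable_sq
        (Eventually.of_forall fun _ => sq_nonneg _)

variable [Countable X] [DiscreteMeasurableSpace X] [MeasurableSingletonClass Y]

/-- The countable range of `i` carries `m` and each of its points has positive mass, so null sets
are exactly the sets disjoint from the range. -/
theorem ae_iff (h : IsAtomicMap μ m i) {p : Y → Prop} : (∀ᵐ y ∂m, p y) ↔ ∀ x, p (i x) := by
  have hm : ∀ A : Set Y, m A = 0 ↔ i ⁻¹' A = ∅ := by
    intro A
    constructor
    · intro hA
      by_contra hne
      obtain ⟨x, hx⟩ := Set.nonempty_iff_ne_empty.2 hne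
      have h1 : m {i x} = 0 := measure_mono_null (Set.singleton_subset_iff.2 hx) hA
      rw [← h.measurePreserving.measure_preimage
        (measurableSet_singleton _).nullMeasurableSet] at h1
      exact (h.pos x).ne'
        (measure_mono_null (Set.singleton_subset_iff.2 (Set.mem_singleton (i x))) h1)
    · intro hA
      have hc : MeasurableSet (Set.range i)ᶜ := (Set.countable_range i).measurableSet.compl
      have h1 : m (Set.range i)ᶜ = 0 := by
        rw [← h.measurePreserving.measure_preimage hc.nullMeasurableSet]
        convert measure_empty (μ := μ)
        ext x
        simp
      refine measure_mono_null (fun y hy => ?_) h1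
      rintro ⟨x, rfl⟩
      have : x ∈ i ⁻¹' A := hy
      rw [hA] at this
      exact this
  rw [MeasureTheory.ae_iff, hm]
  simp [Set.eq_empty_iff_forall_notMem]

theorem ae_eq_iff (h : IsAtomicMap μ m i) {β : Type*} {f g : Y → β} :
    f =ᵐ[m] g ↔ ∀ x, f (i x) = g (i x) := h.ae_iff

theorem exists_lp_eq (h : IsAtomicMap μ m i) {f : X → ℝ} (hf : MemLp f 2 μ) :
    ∃ u : Lp ℝ 2 m, ∀ x, u (i x) = f x := by
  let g : Y → ℝ := Function.extend i f 0
  have hgi : g ∘ i = f := funext fun x => h.injective.extend_apply _ _ _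
  have hi : MeasurableEmbedding i := ⟨h.injective, h.measurePreserving.measurable,
    fun s _ => (s.to_countable.image i).measurableSet⟩
  have hgm : Measurable g := hi.measurable_extend (measurable_of_countable f) measurable_zero
  have hg : MemLp g 2 m := by
    rw [← hgi] at hf
    rw [← h.measurePreserving.map_eq]
    exact (memLp_map_measure_iff hgm.aestronglyMeasurable
      h.measurePreserving.measurable.aemeasurable).2 hf
  exact ⟨hg.toLp g, fun x => (h.ae_eq_iff.1 hg.coeFn_toLp x).trans (congrFun hgi x)⟩

theorem lp_ext (h : IsAtomicMap μ m i) {u v : Lp ℝ 2 m} (huv : ∀ x, u (i x) = v (i x)) : u = v :=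
  Lp.ext (h.ae_eq_iff.2 huv)

/-- The restriction of functions in `L²(Y, m)` to the atoms. -/
def pull (h : IsAtomicMap μ m i) : Lp ℝ 2 m →ₗ[ℝ] X → ℝ where
  toFun u x := u (i x)
  map_add' u v := funext fun x => h.ae_eq_iff.1 (Lp.coeFn_add u v) x
  map_smul' c u := funext fun x => h.ae_eq_iff.1 (Lp.coeFn_smul c u) x

theorem pull_apply (h : IsAtomicMap μ m i) (u : Lp ℝ 2 m) (x : X) : h.pull u x = u (i x) := rfl

/-- Evaluation at an atom as a continuous linear functional on `L²`. -/
def evalL (h : IsAtomicMap μ m i) (x : X) : Lp ℝ 2 m →L[ℝ] ℝ :=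
  ((LinearMap.proj x).comp h.pull).mkContinuous (√(μ.real {x}))⁻¹ fun u => by
    have := h.isFiniteMeasure
    have hpos : 0 < μ.real {x} := ENNReal.toReal_pos (h.pos x).ne' (measure_ne_top _ _)
    have h1 : 0 < √(μ.real {x}) := Real.sqrt_pos.2 hpos
    change |u (i x)| ≤ _
    rw [le_inv_mul_iff₀ h1]
    refine abs_le_of_sq_le_sq' ?_ (norm_nonneg u) |>.2
    rw [mul_pow, Real.sq_sqrt hpos.le, sq_abs, mul_comm]
    exact h.sq_mul_le u x

theorem evalL_apply (h : IsAtomicMap μ m i) (x : X) (u : Lp ℝ 2 m) : h.evalL x u = u (i x) := rfl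

end IsAtomicMap

/-! ### Resistance forms as Dirichlet forms -/

section PullForm

variable {X Y : Type*} [Countable X] [MeasurableSpace X] [DiscreteMeasurableSpace X]
  [MeasurableSpace Y] [MeasurableSingletonClass Y] {μ : Measure X} {m : Measure Y} {i : X → Y}

/-- The form `(u, v) ↦ E(u ∘ i, v ∘ i)` on `L²(Y, m)`. -/
def IsAtomicMap.pullForm (h : IsAtomicMap μ m i) (R : FormOn (X → ℝ)) : FormOn (Lp ℝ 2 m) where
  domain := R.domain.comap h.pull
  form := R.form.compl₁₂ (h.pull.restrict fun _ hu => hu) (h.pull.restrict fun _ hu => hu)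

namespace IsAtomicMap

variable {R : FormOn (X → ℝ)} {x₀ : X}

/-- The restriction of a function in the domain of `h.pullForm R` to the atoms. -/
def pullDomain (h : IsAtomicMap μ m i) (u : (h.pullForm R).domain) : R.domain :=
  ⟨h.pull u.1, u.2⟩

theorem pullDomain_sub (h : IsAtomicMap μ m i) (u v : (h.pullForm R).domain) :
    h.pullDomain (u - v) = h.pullDomain u - h.pullDomain v :=
  Subtype.ext (map_sub h.pull u.1 v.1)

theorem pullForm_apply (h : IsAtomicMap μ m i) (u v : (h.pullForm R).domain) :
    (h.pullForm R).form u v = R.form (h.pullDomain u) (h.pullDomain v) := rfl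

theorem memLp_of_mem_domain (hμ : IsAdaptedMeasure R μ x₀) (f : R.domain) : MemLp f.1 2 μ := by
  have := hμ.isFiniteMeasure
  have h1 : MemLp (fun x => f.1 x - f.1 x₀) 2 μ := by
    have hm : AEStronglyMeasurable (fun x => f.1 x - f.1 x₀) μ :=
      (measurable_of_countable _).aestronglyMeasurable
    rw [memLp_two_iff_integrable_sq hm]
    refine ⟨hm.pow 2, ?_⟩
    rw [hasFiniteIntegral_iff_ofReal (Eventually.of_forall fun _ => sq_nonneg _)]
    exact (hμ.poincare f).trans_lt ENNReal.ofReal_lt_top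
  have h2 := h1.add (memLp_const (f.1 x₀))
  convert h2 using 1
  ext x
  simp

theorem norm_sq_le_of_apply_eq_zero (h : IsAtomicMap μ m i) (hR : IsResistanceForm R)
    (hμ : IsAdaptedMeasure R μ x₀) (u : (h.pullForm R).domain) (h0 : (u : Lp ℝ 2 m) (i x₀) = 0) :
    ‖(u : Lp ℝ 2 m)‖ ^ 2 ≤ (h.pullForm R).form u u := by
  rw [pullForm_apply, ← ENNReal.ofReal_le_ofReal_iff (hR.nonneg _), h.norm_sq_eq_lintegral]
  have := hμ.poincare (h.pullDomain u)
  simp only [pullDomain, h.pull_apply, h0, sub_zero] at this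
  exact this

theorem exists_pullDomain_eq (h : IsAtomicMap μ m i) (hμ : IsAdaptedMeasure R μ x₀)
    (f : R.domain) : ∃ u : (h.pullForm R).domain, h.pullDomain u = f := by
  obtain ⟨u, hu⟩ := h.exists_lp_eq (memLp_of_mem_domain hμ f)
  have hu' : h.pull u = f.1 := funext hu
  exact ⟨⟨u, show h.pull u ∈ R.domain from hu' ▸ f.2⟩, Subtype.ext hu'⟩

/-- A function orthogonal to the domain is orthogonal to approximations of the indicator of each
point; dominated convergence shows that it vanishes there. -/
theorem dense_pullForm (h : IsAtomicMap μ m i) (hR : IsResistanceForm R)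
    (hμ : IsAdaptedMeasure R μ x₀) : Dense ((h.pullForm R).domain : Set (Lp ℝ 2 m)) := by
  have := hμ.isFiniteMeasure
  rw [Submodule.dense_iff_topologicalClosure_eq_top, Submodule.topologicalClosure_eq_top_iff,
    Submodule.eq_bot_iff]
  intro g hg
  rw [Submodule.mem_orthogonal] at hg
  refine h.lp_ext fun x => ?_
  rw [h.ae_eq_iff.1 (Lp.coeFn_zero ℝ 2 m) x, Pi.zero_apply]
  obtain ⟨u, hu, hlim⟩ := hR.exists_approx_indicator x
  have hzero : ∀ n, ∫ y, (u n).1 y * g (i y) ∂μ = 0 := by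
    intro n
    obtain ⟨v, hv⟩ := h.exists_pullDomain_eq hμ (u n)
    have h1 := hg v.1 v.2
    rw [h.inner_eq] at h1
    rw [← hv]
    exact h1
  have hgi : Integrable (fun y => g (i y)) μ := (h.memLp_comp g).integrable one_le_two
  have hconv : Tendsto (fun n => ∫ y, (u n).1 y * g (i y) ∂μ) atTop
      (𝓝 (∫ y, Set.indicator {x} (fun y => g (i y)) y ∂μ)) := by
    refine tendsto_integral_of_dominated_convergence (fun y => |g (i y)|)
      (fun n => (measurable_of_countable _).aestronglyMeasurable) hgi.abs
      (fun n => Eventually.of_forall fun y => ?_) (Eventually.of_forall fun y => ?_)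
    · rw [norm_mul, Real.norm_eq_abs, Real.norm_eq_abs, abs_of_nonneg (hu n y).1]
      exact mul_le_of_le_one_left (abs_nonneg _) (hu n y).2
    · refine tendsto_const_nhds.congr' ((hlim y).mono fun n hn => ?_)
      simp only [hn]
      by_cases hy : y ∈ ({x} : Set X) <;> simp [hy]
  simp_rw [hzero] at hconv
  have h2 := tendsto_nhds_unique hconv tendsto_const_nhds
  rw [integral_indicator MeasurableSet.of_discrete, integral_singleton, smul_eq_mul,
    mul_eq_zero] at h2
  exact h2.resolve_left (ENNReal.toReal_pos (hμ.pos x).ne' (measure_ne_top _ _)).ne'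

/-- Subtracting the value at `x₀` keeps the energy and makes the Poincaré inequality applicable. -/
theorem norm_le_sqrt_add (h : IsAtomicMap μ m i) (hR : IsResistanceForm R)
    (hμ : IsAdaptedMeasure R μ x₀) (u : (h.pullForm R).domain) {e : (h.pullForm R).domain}
    (he : h.pullDomain e = hR.const 1) :
    ‖(u : Lp ℝ 2 m)‖ ≤ √((h.pullForm R).form u u) +
      |(u : Lp ℝ 2 m) (i x₀)| * ‖(e : Lp ℝ 2 m)‖ := by
  have he0 : (e : Lp ℝ 2 m) (i x₀) = 1 := congrFun (congrArg Subtype.val he) x₀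
  set c := (u : Lp ℝ 2 m) (i x₀) with hc
  have h1 : ((u - c • e : (h.pullForm R).domain) : Lp ℝ 2 m) (i x₀) = 0 := by
    rw [← h.evalL_apply x₀, Submodule.coe_sub, Submodule.coe_smul, map_sub, map_smul,
      h.evalL_apply, h.evalL_apply, he0, smul_eq_mul, mul_one, sub_self]
  have h2 := h.norm_sq_le_of_apply_eq_zero hR hμ _ h1
  have h3 : (h.pullForm R).form (u - c • e) (u - c • e) = (h.pullForm R).form u u := by
    have h4 : ∀ z, (h.pullForm R).form e z = 0 := fun z => by
      rw [pullForm_apply, he, hR.form_const_left]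
    have h5 : ∀ z, (h.pullForm R).form z e = 0 := fun z => by
      rw [pullForm_apply, he, hR.form_const_right]
    rw [map_sub, map_smul, h5, smul_zero, sub_zero, map_sub, LinearMap.sub_apply, map_smul,
      LinearMap.smul_apply, h4, smul_zero, sub_zero]
  rw [h3] at h2
  have h6 : (u : Lp ℝ 2 m) =
      ((u - c • e : (h.pullForm R).domain) : Lp ℝ 2 m) + c • (e : Lp ℝ 2 m) := by
    rw [Submodule.coe_sub, Submodule.coe_smul, sub_add_cancel]
  conv_lhs => rw [h6]
  refine (norm_add_le _ _).trans (add_le_add (Real.le_sqrt_of_sq_le h2) ?_)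
  rw [norm_smul, Real.norm_eq_abs]

theorem closed_pullForm (h : IsAtomicMap μ m i) (hR : IsResistanceForm R)
    (hμ : IsAdaptedMeasure R μ x₀) (u : ℕ → (h.pullForm R).domain)
    (hu : Tendsto (fun p : ℕ × ℕ => energyOne (h.pullForm R) (u p.1 - u p.2)) atTop (𝓝 0)) :
    ∃ w : (h.pullForm R).domain,
      Tendsto (fun n => energyOne (h.pullForm R) (u n - w)) atTop (𝓝 0) := by
  have hE : Tendsto (fun p : ℕ × ℕ => R.form (h.pullDomain (u p.1) - h.pullDomain (u p.2))
      (h.pullDomain (u p.1) - h.pullDomain (u p.2))) atTop (𝓝 0) := by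
    refine squeeze_zero (fun p => hR.nonneg _) (fun p => ?_) hu
    rw [energyOne, pullForm_apply, pullDomain_sub]
    exact le_add_of_nonneg_right (sq_nonneg _)
  have hN : Tendsto (fun p : ℕ × ℕ => ‖((u p.1 - u p.2 : (h.pullForm R).domain) : Lp ℝ 2 m)‖)
      atTop (𝓝 0) := by
    have h1 : Tendsto (fun p : ℕ × ℕ =>
        ‖((u p.1 - u p.2 : (h.pullForm R).domain) : Lp ℝ 2 m)‖ ^ 2) atTop (𝓝 0) := by
      refine squeeze_zero (fun p => sq_nonneg _) (fun p => ?_) hu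
      rw [energyOne]
      exact le_add_of_nonneg_left (hR.nonneg _)
    simpa using h1.sqrt
  have hcauchy : CauchySeq fun n => (u n : Lp ℝ 2 m) := by
    rw [cauchySeq_iff_tendsto_dist_atTop_0]
    simp_rw [dist_eq_norm]
    exact hN
  obtain ⟨v, hv⟩ := cauchySeq_tendsto_of_complete hcauchy
  obtain ⟨f, hf⟩ := hR.complete (fun n => h.pullDomain (u n)) hE
  have hx₀ : Tendsto (fun n => (u n : Lp ℝ 2 m) (i x₀)) atTop (𝓝 (v (i x₀))) := by
    have h1 := ((h.evalL x₀).continuous.tendsto v).comp hv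
    exact h1
  -- The energy limit `f` is determined only up to a constant; the shift makes it agree with the
  -- `L²` limit at `x₀`.
  obtain ⟨w, hw⟩ := h.exists_pullDomain_eq hμ (f + hR.const (v (i x₀) - f.1 x₀))
  obtain ⟨e, he⟩ := h.exists_pullDomain_eq hμ (hR.const 1)
  have hwE : ∀ n, (h.pullForm R).form (u n - w) (u n - w) =
      R.form (h.pullDomain (u n) - f) (h.pullDomain (u n) - f) := by
    intro n
    have h1 : h.pullDomain (u n) - f =
        h.pullDomain (u n) - (f + hR.const (v (i x₀) - f.1 x₀)) +
          hR.const (v (i x₀) - f.1 x₀) := by abel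
    rw [pullForm_apply, pullDomain_sub, hw, h1, hR.form_add_const]
  have hwE' : Tendsto (fun n => (h.pullForm R).form (u n - w) (u n - w)) atTop (𝓝 0) := by
    simp_rw [hwE]
    exact hf
  have hw0 : (w : Lp ℝ 2 m) (i x₀) = v (i x₀) := by
    have := congrFun (congrArg Subtype.val hw) x₀
    change (w : Lp ℝ 2 m) (i x₀) = f.1 x₀ + (v (i x₀) - f.1 x₀) at this
    rw [this]
    ring
  have hsq : ∀ n, ‖((u n - w : (h.pullForm R).domain) : Lp ℝ 2 m)‖ ≤
      √((h.pullForm R).form (u n - w) (u n - w)) +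
        |(u n : Lp ℝ 2 m) (i x₀) - v (i x₀)| * ‖(e : Lp ℝ 2 m)‖ := by
    intro n
    have h1 := h.norm_le_sqrt_add hR hμ (u n - w) he
    have h2 : ((u n - w : (h.pullForm R).domain) : Lp ℝ 2 m) (i x₀) =
        (u n : Lp ℝ 2 m) (i x₀) - v (i x₀) := by
      rw [← hw0, ← h.evalL_apply x₀, Submodule.coe_sub, map_sub, h.evalL_apply, h.evalL_apply]
    rwa [h2] at h1
  refine ⟨w, ?_⟩
  have hlim : Tendsto (fun n => ‖((u n - w : (h.pullForm R).domain) : Lp ℝ 2 m)‖) atTop (𝓝 0) := by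
    refine squeeze_zero (fun _ => norm_nonneg _) hsq ?_
    have h1 := hwE'.sqrt
    have h2 := (((hx₀.sub_const (v (i x₀))).abs).mul_const ‖(e : Lp ℝ 2 m)‖)
    simpa using h1.add h2
  have hsum := hwE'.add (hlim.pow 2)
  rw [zero_pow two_ne_zero, add_zero] at hsum
  exact hsum

theorem isDirichletForm_pullForm (h : IsAtomicMap μ m i) (hR : IsResistanceForm R)
    (hμ : IsAdaptedMeasure R μ x₀) : IsDirichletForm (h.pullForm R) where
  dense := h.dense_pullForm hR hμ
  symm _ _ := hR.symm _ _
  nonneg _ := hR.nonneg _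
  closed := h.closed_pullForm hR hμ
  markov u := by
    obtain ⟨f, hf, hle⟩ := hR.markov (h.pullDomain u)
    obtain ⟨w, hw⟩ := h.exists_pullDomain_eq hμ f
    refine ⟨w, h.ae_eq_iff.2 fun x => ?_, ?_⟩
    · have := congrFun (congrArg Subtype.val hw) x
      exact this.trans (hf x)
    · rw [pullForm_apply, hw]
      exact hle

theorem exists_bounded_approx (h : IsAtomicMap μ m i) (hR : IsResistanceForm R)
    (hμ : IsAdaptedMeasure R μ x₀) (u : (h.pullForm R).domain) {ε : ℝ} (hε : 0 < ε) :
    ∃ w : (h.pullForm R).domain, (∃ C : ℝ, ∀ x, |(h.pullDomain w).1 x| ≤ C) ∧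
      energyOne (h.pullForm R) (u - w) < ε := by
  obtain ⟨f, hfb, hf0, hfε⟩ := hR.exists_bounded_approx x₀ (h.pullDomain u) (half_pos hε)
  obtain ⟨w, hw⟩ := h.exists_pullDomain_eq hμ f
  refine ⟨w, hw ▸ hfb, ?_⟩
  have h1 : ((u - w : (h.pullForm R).domain) : Lp ℝ 2 m) (i x₀) = 0 := by
    have h2 : (w : Lp ℝ 2 m) (i x₀) = (u : Lp ℝ 2 m) (i x₀) :=
      (congrFun (congrArg Subtype.val hw) x₀).trans hf0
    rw [← h.evalL_apply x₀, Submodule.coe_sub, map_sub, h.evalL_apply, h.evalL_apply, h2, sub_self]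
  have h2 := h.norm_sq_le_of_apply_eq_zero hR hμ _ h1
  have h3 : (h.pullForm R).form (u - w) (u - w) < ε / 2 := by
    rw [pullForm_apply, pullDomain_sub, hw]
    exact hfε
  rw [energyOne]
  linarith

end IsAtomicMap

theorem isAtomicMap_id {X : Type*} [MeasurableSpace X] {μ : Measure X} (h : IsFiniteMeasure μ)
    (hpos : ∀ x, 0 < μ {x}) : IsAtomicMap μ μ id :=
  ⟨h, hpos, Function.injective_id, MeasurePreserving.id μ⟩

theorem IsAtomicMap.isL2Version (h : IsAtomicMap μ μ id) (R : FormOn (X → ℝ)) :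
    IsL2Version R (h.pullForm R) where
  mem_domain_iff u := by
    constructor
    · intro hu
      exact ⟨⟨_, hu⟩, Filter.EventuallyEq.rfl⟩
    · rintro ⟨f, hf⟩
      have : h.pull u = f.1 := funext (h.ae_eq_iff.1 hf)
      change h.pull u ∈ R.domain
      exact this ▸ f.2
  form_eq u v f g hf hg := by
    have h1 : h.pullDomain u = f := Subtype.ext (funext (h.ae_eq_iff.1 hf))
    have h2 : h.pullDomain v = g := Subtype.ext (funext (h.ae_eq_iff.1 hg))
    rw [h.pullForm_apply, h1, h2]

end PullForm

/-! ### The algebra generated by the bounded functions of finite energy -/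

section BoundedDomain

variable {X : Type*} {R : FormOn (X → ℝ)}

theorem IsResistanceForm.const_mem_boundedDomain (hR : IsResistanceForm R) (c : ℝ) :
    (fun _ => c) ∈ boundedDomain R := ⟨hR.const_mem c, |c|, fun _ => le_rfl⟩

/-- Use `max(f, g) = g + (f - g)⁺`; for bounded `f - g` the positive part is a truncation to `[0,
b]` with `b` large. -/
theorem IsResistanceForm.exists_max (hR : IsResistanceForm R) (f g : boundedDomain R) :
    ∃ h : boundedDomain R, ∀ x, h.1 x = max (f.1 x) (g.1 x) := by
  obtain ⟨C, hC⟩ := (f - g).2.2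
  have hpos : 0 < |C| + 1 := by positivity
  obtain ⟨w, hw, -⟩ := hR.exists_clamp hpos (boundedIncl (f - g))
  have hw' : ∀ x, w.1 x = max 0 (f.1 x - g.1 x) := by
    intro x
    rw [hw, min_eq_right]
    · rfl
    · exact (le_abs_self _).trans ((hC x).trans ((le_abs_self C).trans (by linarith)))
  have hwb : w.1 ∈ boundedDomain R := by
    refine ⟨w.2, |C| + 1, fun x => ?_⟩
    rw [hw, abs_of_nonneg (le_max_left _ _)]
    exact max_le hpos.le (min_le_left _ _)
  refine ⟨g + ⟨w.1, hwb⟩, fun x => ?_⟩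
  change g.1 x + w.1 x = _
  rw [hw', ← max_add_add_left, add_zero, add_sub_cancel, max_comm]

/-- The square of a bounded function of finite energy is a uniform limit of such functions. -/
theorem IsResistanceForm.exists_sq_approx (hR : IsResistanceForm R) (f : boundedDomain R) {ε : ℝ}
    (hε : 0 < ε) : ∃ h : boundedDomain R, ∀ x, |f.1 x ^ 2 - h.1 x| ≤ ε ^ 2 := by
  obtain ⟨C, hC⟩ := f.2.2
  -- The tangent to `y²` at `a` lies below it by `(y - a)²`. The maximum of the tangents at grid
  -- points of mesh `ε` covering `[-C, C]` is therefore within `ε²`.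
  have htangent : ∀ a : ℝ, ∃ h : boundedDomain R, ∀ x, h.1 x = 2 * a * f.1 x - a ^ 2 := fun a =>
    ⟨(2 * a) • f - ⟨_, hR.const_mem_boundedDomain (a ^ 2)⟩, fun x => rfl⟩
  have key : ∀ N : ℕ, ∃ h : boundedDomain R, ∀ x, h.1 x ≤ f.1 x ^ 2 ∧
      ∀ k ≤ N, 2 * (-C + k * ε) * f.1 x - (-C + k * ε) ^ 2 ≤ h.1 x := by
    intro N
    induction N with
    | zero =>
      obtain ⟨h, hh⟩ := htangent (-C + (0 : ℕ) * ε)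
      refine ⟨h, fun x => ⟨?_, fun k hk => ?_⟩⟩
      · rw [hh]
        nlinarith [sq_nonneg (f.1 x - (-C + (0 : ℕ) * ε))]
      · rw [hh, Nat.le_zero.1 hk]
    | succ N ih =>
      obtain ⟨h, hh⟩ := ih
      obtain ⟨g, hg⟩ := htangent (-C + (N + 1 : ℕ) * ε)
      obtain ⟨w, hw⟩ := hR.exists_max h g
      refine ⟨w, fun x => ⟨?_, fun k hk => ?_⟩⟩
      · rw [hw]
        refine max_le (hh x).1 ?_
        rw [hg]
        nlinarith [sq_nonneg (f.1 x - (-C + (N + 1 : ℕ) * ε))]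
      · rw [hw]
        rcases Nat.le_succ_iff.1 hk with h1 | h1
        · exact ((hh x).2 k h1).trans (le_max_left _ _)
        · rw [h1, ← hg]
          exact le_max_right _ _
  obtain ⟨N, hN⟩ := exists_nat_ge (2 * C / ε)
  obtain ⟨h, hh⟩ := key N
  refine ⟨h, fun x => ?_⟩
  obtain ⟨h1, h2⟩ := abs_le.1 (hC x)
  have h3 : 0 ≤ (f.1 x + C) / ε := div_nonneg (by linarith) hε.le
  have h4 := Nat.floor_le h3
  have h5 := Nat.lt_floor_add_one ((f.1 x + C) / ε)
  rw [le_div_iff₀ hε] at h4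
  rw [div_lt_iff₀ hε] at h5
  have h6 : ⌊(f.1 x + C) / ε⌋₊ ≤ N := by
    refine Nat.floor_le_of_le (le_trans ?_ hN)
    gcongr
    linarith
  have h7 := (hh x).2 _ h6
  rw [abs_of_nonneg (sub_nonneg.2 (hh x).1)]
  nlinarith

/-- The complex vector space `B + iB`. -/
def complexSpan (R : FormOn (X → ℝ)) : Submodule ℂ (BoundedFun X) where
  carrier := {a | ∃ f g : boundedDomain R, a = toBoundedFun f + Complex.I • toBoundedFun g}
  zero_mem' := by
    refine ⟨0, 0, lp.ext (funext fun x => ?_)⟩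
    change (0 : ℂ) = ((0 : ℝ) : ℂ) + Complex.I * ((0 : ℝ) : ℂ)
    simp
  add_mem' := by
    rintro _ _ ⟨f, g, rfl⟩ ⟨h, k, rfl⟩
    refine ⟨f + h, g + k, lp.ext (funext fun x => ?_)⟩
    change ((f.1 x : ℂ) + Complex.I * (g.1 x : ℂ)) + ((h.1 x : ℂ) + Complex.I * (k.1 x : ℂ)) =
      ((f.1 x + h.1 x : ℝ) : ℂ) + Complex.I * ((g.1 x + k.1 x : ℝ) : ℂ)
    push_cast
    ring
  smul_mem' := by
    rintro c _ ⟨f, g, rfl⟩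
    refine ⟨c.re • f - c.im • g, c.im • f + c.re • g, lp.ext (funext fun x => ?_)⟩
    change c * ((f.1 x : ℂ) + Complex.I * (g.1 x : ℂ)) =
      ((c.re * f.1 x - c.im * g.1 x : ℝ) : ℂ) +
        Complex.I * ((c.im * f.1 x + c.re * g.1 x : ℝ) : ℂ)
    conv_lhs => rw [← Complex.re_add_im c]
    push_cast
    linear_combination (c.im : ℂ) * g.1 x * Complex.I_sq

theorem toBoundedFun_mem_complexSpan (f : boundedDomain R) : toBoundedFun f ∈ complexSpan R := by
  refine ⟨f, 0, lp.ext (funext fun x => ?_)⟩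
  change (f.1 x : ℂ) = (f.1 x : ℂ) + Complex.I * ((0 : ℝ) : ℂ)
  simp

theorem IsResistanceForm.toBoundedFun_sq_mem (hR : IsResistanceForm R) (f : boundedDomain R) :
    toBoundedFun f * toBoundedFun f ∈ (complexSpan R).topologicalClosure := by
  change _ ∈ closure (complexSpan R : Set (BoundedFun X))
  rw [Metric.mem_closure_iff]
  intro ε hε
  have hε' : 0 < √(ε / 2) := Real.sqrt_pos.2 (half_pos hε)
  obtain ⟨h, hh⟩ := hR.exists_sq_approx f hε'
  refine ⟨toBoundedFun h, toBoundedFun_mem_complexSpan h, ?_⟩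
  rw [dist_eq_norm]
  refine lt_of_le_of_lt (lp.norm_le_of_forall_le (C := ε / 2) (half_pos hε).le fun x => ?_)
    (half_lt_self hε)
  change ‖(f.1 x : ℂ) * (f.1 x : ℂ) - (h.1 x : ℂ)‖ ≤ ε / 2
  rw [← Complex.ofReal_mul, ← Complex.ofReal_sub, Complex.norm_real, ← sq, Real.norm_eq_abs]
  refine (hh x).trans_eq (Real.sq_sqrt (half_pos hε).le)

theorem IsResistanceForm.toBoundedFun_mul_mem (hR : IsResistanceForm R) (f g : boundedDomain R) :
    toBoundedFun f * toBoundedFun g ∈ (complexSpan R).topologicalClosure := by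
  have h1 : toBoundedFun f * toBoundedFun g = (1 / 2 : ℂ) •
      (toBoundedFun (f + g) * toBoundedFun (f + g) - toBoundedFun f * toBoundedFun f -
        toBoundedFun g * toBoundedFun g) := by
    refine lp.ext (funext fun x => ?_)
    change (f.1 x : ℂ) * (g.1 x : ℂ) = (1 / 2 : ℂ) * (((f.1 x + g.1 x : ℝ) : ℂ) *
      ((f.1 x + g.1 x : ℝ) : ℂ) - (f.1 x : ℂ) * (f.1 x : ℂ) - (g.1 x : ℂ) * (g.1 x : ℂ))
    push_cast
    ring
  rw [h1]
  exact Submodule.smul_mem _ _ (Submodule.sub_mem _ (Submodule.sub_mem _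
    (hR.toBoundedFun_sq_mem _) (hR.toBoundedFun_sq_mem _)) (hR.toBoundedFun_sq_mem _))

theorem IsResistanceForm.mul_mem_closure (hR : IsResistanceForm R) {a b : BoundedFun X}
    (ha : a ∈ closure (complexSpan R : Set (BoundedFun X)))
    (hb : b ∈ closure (complexSpan R : Set (BoundedFun X))) :
    a * b ∈ closure (complexSpan R : Set (BoundedFun X)) := by
  have key : ∀ a ∈ complexSpan R, ∀ b ∈ complexSpan R,
      a * b ∈ closure (complexSpan R : Set (BoundedFun X)) := by
    rintro _ ⟨f, g, rfl⟩ _ ⟨h, k, rfl⟩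
    have h1 : (toBoundedFun f + Complex.I • toBoundedFun g) *
        (toBoundedFun h + Complex.I • toBoundedFun k) =
        (toBoundedFun f * toBoundedFun h - toBoundedFun g * toBoundedFun k) +
        Complex.I • (toBoundedFun f * toBoundedFun k + toBoundedFun g * toBoundedFun h) := by
      refine lp.ext (funext fun x => ?_)
      change ((f.1 x : ℂ) + Complex.I * (g.1 x : ℂ)) * ((h.1 x : ℂ) + Complex.I * (k.1 x : ℂ)) =
        ((f.1 x : ℂ) * (h.1 x : ℂ) - (g.1 x : ℂ) * (k.1 x : ℂ)) +
        Complex.I * ((f.1 x : ℂ) * (k.1 x : ℂ) + (g.1 x : ℂ) * (h.1 x : ℂ))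
      linear_combination (g.1 x : ℂ) * (k.1 x : ℂ) * Complex.I_sq
    rw [h1]
    change _ ∈ (complexSpan R).topologicalClosure
    exact Submodule.add_mem _ (Submodule.sub_mem _ (hR.toBoundedFun_mul_mem _ _)
      (hR.toBoundedFun_mul_mem _ _)) (Submodule.smul_mem _ _ (Submodule.add_mem _
      (hR.toBoundedFun_mul_mem _ _) (hR.toBoundedFun_mul_mem _ _)))
  have := map_mem_closure₂ (u := closure (complexSpan R : Set (BoundedFun X))) continuous_mul ha hb
    key
  rwa [closure_closure] at this

theorem IsResistanceForm.closure_complexSpan (hR : IsResistanceForm R) :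
    closure (complexSpan R : Set (BoundedFun X)) = gelfandAlgebra R := by
  refine Set.Subset.antisymm ?_ ?_
  · refine closure_minimal ?_ (StarSubalgebra.isClosed_topologicalClosure _)
    rintro _ ⟨f, g, rfl⟩
    have hmem : ∀ f : boundedDomain R, toBoundedFun f ∈ gelfandAlgebra R := fun f =>
      StarSubalgebra.le_topologicalClosure _ (StarAlgebra.subset_adjoin ℂ _ ⟨f, rfl⟩)
    exact add_mem (hmem f) (SMulMemClass.smul_mem _ (hmem g))
  · have hconst : ∀ c : ℂ, algebraMap ℂ (BoundedFun X) c ∈ complexSpan R := by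
      intro c
      refine ⟨⟨_, hR.const_mem_boundedDomain c.re⟩, ⟨_, hR.const_mem_boundedDomain c.im⟩,
        lp.ext (funext fun x => ?_)⟩
      rw [Algebra.algebraMap_eq_smul_one]
      change c * 1 = (c.re : ℂ) + Complex.I * (c.im : ℂ)
      rw [mul_one, mul_comm Complex.I, Complex.re_add_im]
    let S : StarSubalgebra ℂ (BoundedFun X) :=
      { carrier := closure (complexSpan R : Set (BoundedFun X))
        mul_mem' := hR.mul_mem_closure
        add_mem' := fun ha hb => (complexSpan R).topologicalClosure.add_mem ha hb
        algebraMap_mem' := fun c => subset_closure (hconst c)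
        star_mem' := fun {a} ha => by
          refine map_mem_closure continuous_star ha ?_
          rintro _ ⟨f, g, rfl⟩
          refine ⟨f, -g, lp.ext (funext fun x => ?_)⟩
          change star ((f.1 x : ℂ) + Complex.I * (g.1 x : ℂ)) =
            (f.1 x : ℂ) + Complex.I * ((-g.1 x : ℝ) : ℂ)
          simp }
    have hS : gelfandAlgebra R ≤ S := by
      refine StarSubalgebra.topologicalClosure_minimal ?_ isClosed_closure
      refine StarAlgebra.adjoin_le ?_
      rintro _ ⟨f, rfl⟩
      exact subset_closure (toBoundedFun_mem_complexSpan f)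
    exact hS

end BoundedDomain

/-! ### The Gelfand spectrum -/

section Spectrum

variable {X : Type*} {R : FormOn (X → ℝ)}

instance (R : FormOn (X → ℝ)) : CompactSpace (GelfandSpectrum R) :=
  inferInstanceAs (CompactSpace (WeakDual.characterSpace ℂ (GelfandAlgebra R)))

instance (R : FormOn (X → ℝ)) : T2Space (GelfandSpectrum R) :=
  inferInstanceAs (T2Space (WeakDual.characterSpace ℂ (GelfandAlgebra R)))

/-- The value of an element of `A(B)` at a point of `X`. -/
def GelfandAlgebra.eval (a : GelfandAlgebra R) (x : X) : ℂ :=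
  ((show gelfandAlgebra R from a) : BoundedFun X) x

theorem gelfandTransform_gelfandEmbedding (a : GelfandAlgebra R) (x : X) :
    WeakDual.gelfandTransform ℂ (GelfandAlgebra R) a (gelfandEmbedding R x) = a.eval x := rfl

theorem GelfandAlgebra.ext_eval {a b : GelfandAlgebra R} (h : ∀ x, a.eval x = b.eval x) : a = b :=
  Subtype.ext (lp.ext (funext h))

theorem gelfand_gelfandEmbedding (f : boundedDomain R) (x : X) :
    gelfand f (gelfandEmbedding R x) = f.1 x := rfl

theorem continuous_gelfand (f : boundedDomain R) : Continuous (gelfand f) :=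
  Complex.continuous_re.comp
    (WeakDual.gelfandTransform ℂ (GelfandAlgebra R) (toGelfandAlgebra f)).continuous

/-- Every continuous real function on the spectrum is the Gelfand transform of an element of
`A(B)`. -/
theorem exists_gelfandTransform_eq (φ : GelfandSpectrum R → ℝ) (hφ : Continuous φ) :
    ∃ a : GelfandAlgebra R, ∀ χ : GelfandSpectrum R,
      WeakDual.gelfandTransform ℂ (GelfandAlgebra R) a χ = (φ χ : ℂ) := by
  obtain ⟨a, ha⟩ := (gelfandTransform_bijective (GelfandAlgebra R)).2
    ⟨fun χ : GelfandSpectrum R => (φ χ : ℂ), Complex.continuous_ofReal.comp hφ⟩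
  exact ⟨a, fun χ => DFunLike.congr_fun ha χ⟩

/-- A Urysohn function vanishing on the closure of the range is the transform of an algebra element
that vanishes on `X`, hence is zero. -/
theorem denseRange_gelfandEmbedding : DenseRange (gelfandEmbedding R) := by
  rw [DenseRange, dense_iff_closure_eq]
  by_contra hne
  obtain ⟨χ, hχ⟩ := (Set.ne_univ_iff_exists_notMem _).1 hne
  obtain ⟨φ, h0, h1, -⟩ := exists_continuous_zero_one_of_isClosed
    (isClosed_closure (s := Set.range (gelfandEmbedding R))) (isClosed_singleton (x := χ))
    (Set.disjoint_singleton_right.2 hχ)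
  obtain ⟨a, ha⟩ := exists_gelfandTransform_eq φ φ.continuous
  have ha0 : a = 0 := GelfandAlgebra.ext_eval fun x => by
    have h2 := ha (gelfandEmbedding R x)
    rw [gelfandTransform_gelfandEmbedding, h0 (subset_closure ⟨x, rfl⟩)] at h2
    rw [h2]
    simp
    rfl
  have h3 := ha χ
  rw [ha0, map_zero, h1 rfl] at h3
  change (0 : ℂ) = ((1 : ℝ) : ℂ) at h3
  simp at h3

/-- Inequalities between continuous functions on the spectrum can be checked on `X`. -/
theorem le_of_gelfandEmbedding {φ ψ : GelfandSpectrum R → ℝ} (hφ : Continuous φ)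
    (hψ : Continuous ψ)
    (h : ∀ x, φ (gelfandEmbedding R x) ≤ ψ (gelfandEmbedding R x)) (χ : GelfandSpectrum R) :
    φ χ ≤ ψ χ :=
  denseRange_gelfandEmbedding.induction_on χ (isClosed_le hφ hψ) h

/-- By Gelfand duality `φ` comes from `A(B)`. Approximate that element by `f + i g`, keep the real
part, and extend the estimate from `X` to `Δ` by density. -/
theorem IsResistanceForm.exists_gelfand_approx (hR : IsResistanceForm R)
    (φ : GelfandSpectrum R → ℝ) (hφ : Continuous φ) {ε : ℝ} (hε : 0 < ε) :
    ∃ f : boundedDomain R, ∀ χ, |φ χ - gelfand f χ| < ε := by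
  obtain ⟨a, ha⟩ := exists_gelfandTransform_eq φ hφ
  have hmem : ((show gelfandAlgebra R from a) : BoundedFun X) ∈
      closure (complexSpan R : Set (BoundedFun X)) := by
    rw [hR.closure_complexSpan]
    exact (show gelfandAlgebra R from a).2
  obtain ⟨_, ⟨f, g, rfl⟩, hfg⟩ := Metric.mem_closure_iff.1 hmem (ε / 2) (half_pos hε)
  refine ⟨f, fun χ => (le_of_gelfandEmbedding (ψ := fun _ => ε / 2)
    (hφ.sub (continuous_gelfand f)).abs continuous_const (fun x => ?_) χ).trans_lt
    (half_lt_self hε)⟩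
  rw [dist_eq_norm] at hfg
  have h1 := (lp.norm_apply_le_norm ENNReal.top_ne_zero _ x).trans hfg.le
  have h2 : a.eval x = (φ (gelfandEmbedding R x) : ℂ) := ha (gelfandEmbedding R x)
  change ‖a.eval x - ((f.1 x : ℂ) + Complex.I * (g.1 x : ℂ))‖ ≤ ε / 2 at h1
  rw [h2] at h1
  refine le_trans ?_ h1
  refine le_trans (le_of_eq ?_) (Complex.abs_re_le_norm _)
  change |φ (gelfandEmbedding R x) - f.1 x| = _
  simp

/-- (RF3) separates two points and truncation makes the separating function bounded without changing
its values `0` and `1`. -/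
theorem IsResistanceForm.injective_gelfandEmbedding (hR : IsResistanceForm R) :
    Function.Injective (gelfandEmbedding R) := by
  classical
  intro x y hxy
  by_contra hne
  obtain ⟨u, hu⟩ := hR.extend {x, y} fun z => if z.1 = x then 1 else 0
  obtain ⟨w, hw, -⟩ := hR.markov u
  have hwb : w.1 ∈ boundedDomain R := by
    refine ⟨w.2, 1, fun z => ?_⟩
    rw [hw, abs_of_nonneg (le_max_left _ _)]
    exact max_le zero_le_one (min_le_left _ _)
  have h1 := congrArg (gelfand (R := R) ⟨w.1, hwb⟩) hxy
  rw [gelfand_gelfandEmbedding, gelfand_gelfandEmbedding] at h1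
  simp only [hw] at h1
  rw [hu ⟨x, by simp⟩, hu ⟨y, by simp⟩] at h1
  simp [Ne.symm hne] at h1

/-- The transforms of a countable dense subset of `B` still separate points, so they embed the
compact space `Δ` into a countable power of `ℝ`. -/
theorem IsResistanceForm.secondCountable_gelfandSpectrum (hR : IsResistanceForm R)
    (hsep : TopologicalSpace.IsSeparable
      (Set.range (toBoundedFun : boundedDomain R → BoundedFun X))) :
    SecondCountableTopology (GelfandSpectrum R) := by
  obtain ⟨t, hts, htc, hst⟩ := hsep.exists_countable_dense_subset
  choose F hF using fun a : t => hts a.2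
  have : Countable t := htc.to_subtype
  let Φ : GelfandSpectrum R → t → ℝ := fun χ a => gelfand (F a) χ
  have hΦ : Continuous Φ := continuous_pi fun a => continuous_gelfand (F a)
  have hinj : Function.Injective Φ := by
    intro χ ψ h
    by_contra hne
    obtain ⟨φ, h0, h1, -⟩ := exists_continuous_zero_one_of_isClosed
      (isClosed_singleton (x := χ)) (isClosed_singleton (x := ψ))
      (Set.disjoint_singleton.2 hne)
    obtain ⟨f, hf⟩ := hR.exists_gelfand_approx φ φ.continuous (ε := 1 / 8) (by norm_num)
    obtain ⟨b, hb, hfb⟩ := Metric.mem_closure_iff.1 (hst ⟨f, rfl⟩) (1 / 8) (by norm_num)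
    have hclose : ∀ η, |gelfand f η - gelfand (F ⟨b, hb⟩) η| ≤ 1 / 8 :=
      le_of_gelfandEmbedding ((continuous_gelfand f).sub (continuous_gelfand _)).abs
        continuous_const fun x => by
          have hb' : toBoundedFun (F ⟨b, hb⟩) = b := hF ⟨b, hb⟩
          rw [dist_eq_norm, ← hb'] at hfb
          have h2 := (lp.norm_apply_le_norm ENNReal.top_ne_zero _ x).trans hfb.le
          change ‖(f.1 x : ℂ) - ((F ⟨b, hb⟩).1 x : ℂ)‖ ≤ 1 / 8 at h2
          rwa [← Complex.ofReal_sub, Complex.norm_real, Real.norm_eq_abs] at h2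
    have h2 : gelfand (F ⟨b, hb⟩) χ = gelfand (F ⟨b, hb⟩) ψ := congrFun h ⟨b, hb⟩
    have h3 := abs_lt.1 (hf χ)
    have h4 := abs_lt.1 (hf ψ)
    have h5 := abs_le.1 (hclose χ)
    have h6 := abs_le.1 (hclose ψ)
    rw [h0 rfl] at h3
    rw [h1 rfl] at h4
    simp only [Pi.zero_apply, Pi.one_apply] at h3 h4
    linarith
  exact (hΦ.isClosedEmbedding hinj).isEmbedding.secondCountableTopology

end Spectrum

/-! ### Regularity of atomic measures -/

section Regular

variable {X Y : Type*} [Countable X] [MeasurableSpace X] [DiscreteMeasurableSpace X]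
  [TopologicalSpace Y] [MeasurableSpace Y] [BorelSpace Y]

/-- Finite sets carry all but an arbitrarily small part of the mass, and they are closed and
compact. Removing one from the space gives outer regularity, keeping one gives inner regularity. -/
theorem regular_map_of_countable [T1Space Y] (μ : Measure X) [IsFiniteMeasure μ] (i : X → Y) :
    (μ.map i).Regular := by
  have hi : Measurable i := measurable_of_countable i
  refine { lt_top_of_isCompact := fun K _ => measure_lt_top _ K,
           outerRegular := fun A hA r hr => ?_,
           innerRegular := fun U hU r hr => ?_ }
  · rw [Measure.map_apply hi hA] at hr
    obtain ⟨V, hV, hVr⟩ := exists_finite_measure_compl_lt μ (tsub_pos_of_lt hr)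
    refine ⟨(i '' (V ∩ i ⁻¹' Aᶜ))ᶜ, ?_, ((hV.inter_of_left _).image i).isClosed.isOpen_compl, ?_⟩
    · rintro y hy ⟨x, ⟨-, hx⟩, rfl⟩
      exact hx hy
    · rw [Measure.map_apply hi ((hV.inter_of_left _).image i).isClosed.isOpen_compl.measurableSet]
      have h1 : i ⁻¹' (i '' (V ∩ i ⁻¹' Aᶜ))ᶜ ⊆ i ⁻¹' A ∪ Vᶜ := by
        intro x hx
        by_contra hcon
        rw [Set.mem_union, not_or, Set.notMem_compl_iff] at hcon
        exact hx ⟨x, ⟨hcon.2, hcon.1⟩, rfl⟩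
      calc μ (i ⁻¹' (i '' (V ∩ i ⁻¹' Aᶜ))ᶜ) ≤ μ (i ⁻¹' A) + μ Vᶜ :=
            (measure_mono h1).trans (measure_union_le _ _)
        _ < μ (i ⁻¹' A) + (r - μ (i ⁻¹' A)) := ENNReal.add_lt_add_left (measure_ne_top _ _) hVr
        _ = r := add_tsub_cancel_of_le hr.le
  · rw [Measure.map_apply hi hU.measurableSet] at hr
    obtain ⟨V, hV, hVr⟩ := exists_finite_measure_compl_lt μ (tsub_pos_of_lt hr)
    refine ⟨i '' (V ∩ i ⁻¹' U), ?_, ((hV.inter_of_left _).image i).isCompact, ?_⟩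
    · rintro _ ⟨x, ⟨-, hx⟩, rfl⟩
      exact hx
    · rw [Measure.map_apply hi ((hV.inter_of_left _).image i).isClosed.measurableSet]
      by_contra! hle
      have h1 : i ⁻¹' U ⊆ i ⁻¹' (i '' (V ∩ i ⁻¹' U)) ∪ Vᶜ := by
        intro x hx
        by_cases hxV : x ∈ V
        · exact Or.inl ⟨x, ⟨hxV, hx⟩, rfl⟩
        · exact Or.inr hxV
      have h2 : μ (i ⁻¹' U) < μ (i ⁻¹' U) :=
        calc μ (i ⁻¹' U) ≤ μ (i ⁻¹' (i '' (V ∩ i ⁻¹' U))) + μ Vᶜ :=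
              (measure_mono h1).trans (measure_union_le _ _)
          _ ≤ r + μ Vᶜ := by gcongr
          _ < r + (μ (i ⁻¹' U) - r) :=
            ENNReal.add_lt_add_left (hr.trans (measure_lt_top _ _)).ne hVr
          _ = μ (i ⁻¹' U) := add_tsub_cancel_of_le hr.le
      exact lt_irrefl _ h2

theorem isOpenPosMeasure_map {μ : Measure X} (hμ : ∀ x, 0 < μ {x}) {i : X → Y}
    (hi : DenseRange i) : (μ.map i).IsOpenPosMeasure := by
  refine ⟨fun U hU hne h0 => ?_⟩
  obtain ⟨x, hx⟩ := hi.exists_mem_open hU hne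
  rw [Measure.map_apply (measurable_of_countable i) hU.measurableSet] at h0
  exact (hμ x).ne' (measure_mono_null (Set.singleton_subset_iff.2 hx) h0)

end Regular

/-! ### The form on the Gelfand spectrum -/

section Transfer

variable {X : Type*} [Countable X] [MeasurableSpace X] [DiscreteMeasurableSpace X]
  {R : FormOn (X → ℝ)} {μ : Measure X} {x₀ : X}

theorem IsResistanceForm.isAtomicMap_gelfandEmbedding (hR : IsResistanceForm R)
    (hμ : IsAdaptedMeasure R μ x₀) :
    IsAtomicMap μ (μ.map (gelfandEmbedding R)) (gelfandEmbedding R) :=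
  ⟨hμ.isFiniteMeasure, hμ.pos, hR.injective_gelfandEmbedding,
    (measurable_of_countable _).measurePreserving μ⟩

theorem IsAtomicMap.exists_ae_eq_gelfand
    (h : IsAtomicMap μ (μ.map (gelfandEmbedding R)) (gelfandEmbedding R))
    (hμ : IsAdaptedMeasure R μ x₀) (f : boundedDomain R) :
    ∃ u : (h.pullForm R).domain,
      ((u : Lp ℝ 2 (μ.map (gelfandEmbedding R))) : GelfandSpectrum R → ℝ)
        =ᵐ[μ.map (gelfandEmbedding R)] gelfand f := by
  obtain ⟨u, hu⟩ := h.exists_pullDomain_eq hμ (boundedIncl f)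
  exact ⟨u, h.ae_eq_iff.2 (congrFun (congrArg Subtype.val hu))⟩

theorem IsAtomicMap.pullDomain_eq_boundedIncl
    (h : IsAtomicMap μ (μ.map (gelfandEmbedding R)) (gelfandEmbedding R)) {f : boundedDomain R}
    {u : (h.pullForm R).domain}
    (hu : ((u : Lp ℝ 2 (μ.map (gelfandEmbedding R))) : GelfandSpectrum R → ℝ)
        =ᵐ[μ.map (gelfandEmbedding R)] gelfand f) : h.pullDomain u = boundedIncl f :=
  Subtype.ext (funext (h.ae_eq_iff.1 hu))

theorem IsAtomicMap.exists_gelfand_approx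
    (h : IsAtomicMap μ (μ.map (gelfandEmbedding R)) (gelfandEmbedding R))
    (hR : IsResistanceForm R) (hμ : IsAdaptedMeasure R μ x₀) (u : (h.pullForm R).domain) {ε : ℝ}
    (hε : 0 < ε) : ∃ (f : boundedDomain R) (v : (h.pullForm R).domain),
      ((v : Lp ℝ 2 (μ.map (gelfandEmbedding R))) : GelfandSpectrum R → ℝ)
        =ᵐ[μ.map (gelfandEmbedding R)] gelfand f ∧ energyOne (h.pullForm R) (u - v) < ε := by
  obtain ⟨w, ⟨C, hC⟩, hw⟩ := h.exists_bounded_approx hR hμ u hε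
  exact ⟨⟨(h.pullDomain w).1, (h.pullDomain w).2, C, hC⟩, w, h.ae_eq_iff.2 fun x => rfl, hw⟩

theorem IsAtomicMap.isTransferredForm
    (h : IsAtomicMap μ (μ.map (gelfandEmbedding R)) (gelfandEmbedding R))
    (hR : IsResistanceForm R) (hμ : IsAdaptedMeasure R μ x₀) :
    IsTransferredForm (R := R) (h.pullForm R) where
  mem_domain := h.exists_ae_eq_gelfand hμ
  form_eq f g u v hu hv := by
    rw [h.pullForm_apply, h.pullDomain_eq_boundedIncl hu, h.pullDomain_eq_boundedIncl hv]
  core u _ hε := h.exists_gelfand_approx hR hμ u hε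

theorem IsAtomicMap.isRegularDirichletForm
    (h : IsAtomicMap μ (μ.map (gelfandEmbedding R)) (gelfandEmbedding R))
    (hR : IsResistanceForm R) (hμ : IsAdaptedMeasure R μ x₀) :
    IsRegularDirichletForm (h.pullForm R) where
  isDirichletForm := h.isDirichletForm_pullForm hR hμ
  locallyCompact := inferInstance
  hausdorff := inferInstance
  radon := by
    have := hμ.isFiniteMeasure
    exact regular_map_of_countable μ _
  fullSupport := isOpenPosMeasure_map hμ.pos denseRange_gelfandEmbedding
  dense_domain u ε hε := by
    obtain ⟨f, v, hv, hvε⟩ := h.exists_gelfand_approx hR hμ u hε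
    exact ⟨v, ⟨gelfand f, continuous_gelfand f, HasCompactSupport.of_compactSpace _, hv⟩, hvε⟩
  dense_continuous φ hφ _ ε hε := by
    obtain ⟨f, hf⟩ := hR.exists_gelfand_approx φ hφ hε
    exact ⟨gelfand f, continuous_gelfand f, HasCompactSupport.of_compactSpace _,
      h.exists_ae_eq_gelfand hμ f, hf⟩

theorem integrable_gelfand_and_integral_eq [IsFiniteMeasure μ] (f : boundedDomain R) :
    Integrable (gelfand f) (μ.map (gelfandEmbedding R)) ∧
      ∫ x, f.1 x ∂μ = ∫ φ, gelfand f φ ∂(μ.map (gelfandEmbedding R)) := by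
  have hm : AEMeasurable (gelfandEmbedding R) μ := (measurable_of_countable _).aemeasurable
  have hg : AEStronglyMeasurable (gelfand f) (μ.map (gelfandEmbedding R)) :=
    (continuous_gelfand f).aestronglyMeasurable
  refine ⟨(integrable_map_measure hg hm).2 ?_, (integral_map hm hg).symm⟩
  obtain ⟨C, hC⟩ := f.2.2
  exact Integrable.of_bound (measurable_of_countable _).aestronglyMeasurable C
    (Eventually.of_forall hC)

end Transfer

/-! ### Semigroups of Dirichlet forms -/

section Dirichlet

variable {Y : Type*} [MeasurableSpace Y] {m : Measure Y} {D : FormOn (Lp ℝ 2 m)}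

theorem IsDirichletForm.isClosedForm (hD : IsDirichletForm D) : IsClosedForm D :=
  ⟨hD.dense, hD.symm, hD.nonneg, hD.closed⟩

theorem IsFormSemigroup.isSemigroupOf {T : ℝ≥0 → (Lp ℝ 2 m →L[ℝ] Lp ℝ 2 m)}
    (hT : IsFormSemigroup D T) : IsSemigroupOf D T :=
  ⟨hT.zero, hT.add, hT.contraction, hT.continuous, hT.generator⟩

/-- The resolvent of a Dirichlet form is Markovian. -/
theorem IsResolvent.apply_mem_Icc (hD : IsDirichletForm D) {α : ℝ} (hα : 0 < α)
    {J : Lp ℝ 2 m →L[ℝ] Lp ℝ 2 m} (hJ : IsResolvent D α J) {h : Lp ℝ 2 m}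
    (hh : ∀ᵐ y ∂m, h y ∈ Set.Icc (0 : ℝ) 1) : ∀ᵐ y ∂m, J h y ∈ Set.Icc (0 : ℝ) 1 := by
  set u : D.domain := ⟨J h, hJ.mem h⟩ with hu
  obtain ⟨w, hw, hle⟩ := hD.markov u
  -- `J h` is the unique minimizer of `α E(v, v) + ‖v - h‖²`. Truncation fixes `h` and is
  -- 1-Lipschitz, so it does not increase this functional and must fix `J h`.
  have hnorm : ‖(w : Lp ℝ 2 m) - h‖ ≤ ‖(u : Lp ℝ 2 m) - h‖ := by
    refine Lp.norm_le_norm_of_ae_le ?_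
    filter_upwards [hw, hh, Lp.coeFn_sub (w : Lp ℝ 2 m) h, Lp.coeFn_sub (u : Lp ℝ 2 m) h]
      with y h1 h2 h3 h4
    rw [h3, h4, Pi.sub_apply, Pi.sub_apply, h1, Real.norm_eq_abs, Real.norm_eq_abs]
    have h5 : h y = max 0 (min 1 (h y)) := by rw [min_eq_right h2.2, max_eq_right h2.1]
    have h6 : ∀ a b : ℝ, |max 0 (min 1 a) - max 0 (min 1 b)| ≤ |a - b| := fun a b => by
      simpa only [max_comm (0 : ℝ), min_comm (1 : ℝ)] using
        (abs_max_sub_max_le_abs (min a 1) (min b 1) 0).trans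
          ((abs_min_sub_min_le_max a 1 b 1).trans (by simp))
    calc |max 0 (min 1 (J h y)) - h y| = |max 0 (min 1 (J h y)) - max 0 (min 1 (h y))| := by
          rw [← h5]
      _ ≤ |J h y - h y| := h6 _ _
  have hcross := hJ.eq h (w - u)
  have hE : D.form w w = D.form u u + 2 * D.form u (w - u) + D.form (w - u) (w - u) := by
    simp only [map_sub, LinearMap.sub_apply, hD.symm w u]
    ring
  have hN : ‖(w : Lp ℝ 2 m) - h‖ ^ 2 = ‖(u : Lp ℝ 2 m) - h‖ ^ 2 +
      2 * inner ℝ ((u : Lp ℝ 2 m) - h) ((w : Lp ℝ 2 m) - u) + ‖(w : Lp ℝ 2 m) - u‖ ^ 2 := by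
    have : (w : Lp ℝ 2 m) - h = ((u : Lp ℝ 2 m) - h) + ((w : Lp ℝ 2 m) - u) := by abel
    rw [this, norm_add_sq_real]
  have hsq : ‖(w : Lp ℝ 2 m) - h‖ ^ 2 ≤ ‖(u : Lp ℝ 2 m) - h‖ ^ 2 :=
    pow_le_pow_left₀ (norm_nonneg _) hnorm 2
  have h6 := mul_nonneg hα.le (hD.nonneg (w - u))
  have h7 := mul_le_mul_of_nonneg_left hle hα.le
  have h8 : inner ℝ ((u : Lp ℝ 2 m) - h) ((w : Lp ℝ 2 m) - u) =
      inner ℝ (J h) ((w - u : D.domain) : Lp ℝ 2 m) -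
        inner ℝ h ((w - u : D.domain) : Lp ℝ 2 m) := by
    rw [inner_sub_left]
    rfl
  have h9 : ‖(w : Lp ℝ 2 m) - u‖ ^ 2 ≤ 0 := by
    have hcross' : α * D.form u (w - u) + inner ℝ (J h) ((w - u : D.domain) : Lp ℝ 2 m) =
      inner ℝ h ((w - u : D.domain) : Lp ℝ 2 m) := hcross
    rw [hE] at h7
    nlinarith
  have h10 : (w : Lp ℝ 2 m) = J h := by
    have := pow_eq_zero_iff two_ne_zero |>.1 (le_antisymm h9 (sq_nonneg _))
    exact sub_eq_zero.1 (norm_eq_zero.1 this)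
  rw [h10] at hw
  filter_upwards [hw] with y hy
  rw [hy]
  exact ⟨le_max_left _ _, max_le zero_le_one (min_le_left _ _)⟩

end Dirichlet

/-! ### Transition functions from positive semigroups on atomic spaces -/

section Transition

variable {X : Type*} [Countable X] [MeasurableSpace X] [DiscreteMeasurableSpace X]
  {μ : Measure X}

theorem IsAtomicMap.exists_indicator (h : IsAtomicMap μ μ id) :
    ∃ δ : X → Lp ℝ 2 μ, ∀ y x, δ y x = Set.indicator {y} (fun _ => (1 : ℝ)) x := by
  have := h.isFiniteMeasure
  choose δ hδ using fun y : X => h.exists_lp_eq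
    (memLp_indicator_const (μ := μ) 2 (MeasurableSet.of_discrete (s := ({y} : Set X))) (1 : ℝ)
      (Or.inr (measure_ne_top _ _)))
  exact ⟨δ, hδ⟩

variable {δ : X → Lp ℝ 2 μ}

/-- The squared norm of the remainder is the integral of `u²` off a finite set, which tends to zero
by dominated convergence. Hence a bounded operator on `L²` acts through the kernel `S (δ y) x`. -/
theorem IsAtomicMap.hasSum_indicator (h : IsAtomicMap μ μ id)
    (hδ : ∀ y x, δ y x = Set.indicator {y} (fun _ => (1 : ℝ)) x) (u : Lp ℝ 2 μ) :
    HasSum (fun y => u y • δ y) u := by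
  classical
  change Tendsto (fun s : Finset X => ∑ y ∈ s, u y • δ y) atTop (𝓝 u)
  rw [tendsto_iff_norm_sub_tendsto_zero]
  have hval : ∀ (s : Finset X) x, (∑ y ∈ s, u y • δ y - u) x =
      -Set.indicator (s : Set X)ᶜ u x := by
    intro s x
    change h.evalL x (∑ y ∈ s, u y • δ y - u) = _
    have hsmul : ∀ y, h.evalL x (u y • δ y) = u y * Set.indicator {y} (fun _ => (1 : ℝ)) x :=
      fun y => by
        rw [map_smul, ← hδ]
        rfl
    rw [map_sub, map_sum]
    simp only [hsmul, h.evalL_apply, id]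
    by_cases hx : x ∈ s
    · rw [Finset.sum_eq_single x, Set.indicator_of_mem (Set.mem_singleton x),
        Set.indicator_of_notMem (by simpa)]
      · simp
      · intro y _ hyx
        rw [Set.indicator_of_notMem (by simpa using Ne.symm hyx), mul_zero]
      · exact fun hx' => (hx' hx).elim
    · rw [Finset.sum_eq_zero, Set.indicator_of_mem (by simpa), zero_sub]
      intro y hy
      rw [Set.indicator_of_notMem, mul_zero]
      rintro rfl
      exact hx hy
  have hsq : ∀ s : Finset X, ‖∑ y ∈ s, u y • δ y - u‖ ^ 2 =
      ∫ x, Set.indicator (s : Set X)ᶜ (fun x => u x ^ 2) x ∂μ := by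
    intro s
    rw [h.norm_sq_eq]
    refine integral_congr_ae (Eventually.of_forall fun x => ?_)
    simp only [id, hval, neg_sq]
    by_cases hx : x ∈ s <;> simp [hx]
  have hlim : Tendsto (fun s : Finset X => ‖∑ y ∈ s, u y • δ y - u‖ ^ 2) atTop (𝓝 0) := by
    simp_rw [hsq]
    rw [← integral_zero X ℝ (μ := μ)]
    refine tendsto_integral_filter_of_dominated_convergence (fun x => u x ^ 2)
      (Eventually.of_forall fun s => (measurable_of_countable _).aestronglyMeasurable)
      (Eventually.of_forall fun s => Eventually.of_forall fun x => ?_)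
      (h.memLp_comp u).integrable_sq (Eventually.of_forall fun x => ?_)
    · by_cases hx : x ∈ s <;> simp [hx, sq_nonneg]
    · refine tendsto_const_nhds.congr' ?_
      filter_upwards [eventually_ge_atTop {x}] with s hs
      have : x ∈ s := hs (Finset.mem_singleton_self x)
      simp [this]
  simpa using hlim.sqrt

theorem IsAtomicMap.hasSum_apply (h : IsAtomicMap μ μ id)
    (hδ : ∀ y x, δ y x = Set.indicator {y} (fun _ => (1 : ℝ)) x)
    (S : Lp ℝ 2 μ →L[ℝ] Lp ℝ 2 μ) (u : Lp ℝ 2 μ) (x : X) :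
    HasSum (fun y => u y * S (δ y) x) (S u x) := by
  have h1 := ((h.evalL x).comp S).hasSum (h.hasSum_indicator hδ u)
  have h2 : ∀ y, ((h.evalL x).comp S) (u y • δ y) = u y * S (δ y) x := fun y => by
    rw [map_smul]
    rfl
  simp_rw [h2] at h1
  exact h1

theorem IsAtomicMap.exp_yosida_apply_nonneg (h : IsAtomicMap μ μ id) {D : FormOn (Lp ℝ 2 μ)}
    (hD : IsDirichletForm D) {α : ℝ} (hα : 0 < α) {J : Lp ℝ 2 μ →L[ℝ] Lp ℝ 2 μ}
    (hJ : IsResolvent D α J) {t : ℝ} (ht : 0 ≤ t) {u : Lp ℝ 2 μ}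
    (hu : ∀ x, u x ∈ Set.Icc (0 : ℝ) 1) (x : X) :
    0 ≤ (NormedSpace.exp (t • yosida α J) u : Lp ℝ 2 μ) x := by
  have hpow : ∀ n : ℕ, ∀ x, (J ^ n) u x ∈ Set.Icc (0 : ℝ) 1 := by
    intro n
    induction n with
    | zero => exact hu
    | succ n ih =>
      rw [pow_succ']
      exact h.ae_iff.1 (hJ.apply_mem_Icc hD hα (h.ae_iff.2 ih))
  have h1 := hasSum_exp_smul_sub_one J (t * α⁻¹)
  rw [yosida, smul_smul]
  have h2 := ((h.evalL x).comp (ContinuousLinearMap.apply ℝ _ u)).hasSum h1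
  refine h2.nonneg fun n => ?_
  change 0 ≤ h.evalL x (((Real.exp (-(t * α⁻¹)) * ((t * α⁻¹) ^ n / n.factorial)) • J ^ n) u)
  rw [smul_apply, map_smul, smul_eq_mul]
  exact mul_nonneg (by positivity) (hpow n x).1

/-- Expanding in indicators turns `T t 1 = 1` into row sums one, and the semigroup law into the
Chapman–Kolmogorov equation. -/
theorem IsAtomicMap.isTransitionFunction (h : IsAtomicMap μ μ id)
    (hδ : ∀ y x, δ y x = Set.indicator {y} (fun _ => (1 : ℝ)) x)
    {T : ℝ≥0 → (Lp ℝ 2 μ →L[ℝ] Lp ℝ 2 μ)} (hT0 : T 0 = ContinuousLinearMap.id ℝ (Lp ℝ 2 μ))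
    (hTadd : ∀ s t, T (s + t) = (T s).comp (T t)) (hpos : ∀ t y x, 0 ≤ T t (δ y) x)
    {e : Lp ℝ 2 μ} (he : ∀ x, e x = 1) (hTe : ∀ t, T t e = e) :
    IsTransitionFunction fun t x y => ENNReal.ofReal (T t (δ y) x) where
  zero x y := by
    rw [hT0, ContinuousLinearMap.id_apply, hδ]
    by_cases hxy : x = y <;> simp [hxy]
  tsum_eq_one t x := by
    have h1 := h.hasSum_apply hδ (T t) e x
    simp_rw [he, one_mul, hTe, he] at h1
    rw [← ENNReal.ofReal_tsum_of_nonneg (fun y => hpos t y x) h1.summable, h1.tsum_eq,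
      ENNReal.ofReal_one]
  add s t x y := by
    have h1 := h.hasSum_apply hδ (T s) (T t (δ y)) x
    simp_rw [← ENNReal.ofReal_mul (hpos s _ x)]
    have h2 : ∀ z, T s (δ z) x * T t (δ y) z = T t (δ y) z * T s (δ z) x := fun z => mul_comm _ _
    simp_rw [h2]
    rw [hTadd, ContinuousLinearMap.comp_apply, ← h1.tsum_eq, ENNReal.ofReal_tsum_of_nonneg
      (fun z => mul_nonneg (hpos t y z) (hpos s z x)) h1.summable]

/-- Integrals with respect to a measure on a countable space. -/
theorem integrable_and_integral_eq_of_hasSum {κ : Measure X} [IsFiniteMeasure κ] {f q : X → ℝ}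
    (hq : ∀ y, 0 ≤ q y) (hκ : ∀ y, κ {y} = ENNReal.ofReal (q y)) {a : ℝ}
    (hf : HasSum (fun y => f y * q y) a) : Integrable f κ ∧ ∫ y, f y ∂κ = a := by
  have hint : Integrable f κ := by
    refine ⟨(measurable_of_countable f).aestronglyMeasurable, ?_⟩
    rw [hasFiniteIntegral_iff_norm, lintegral_countable']
    have h1 : ∀ y, ENNReal.ofReal ‖f y‖ * κ {y} = ENNReal.ofReal ‖f y * q y‖ := fun y => by
      rw [hκ, ← ENNReal.ofReal_mul (norm_nonneg _), norm_mul, Real.norm_of_nonneg (hq y)]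
    simp_rw [h1]
    rw [← ENNReal.ofReal_tsum_of_nonneg (fun y => norm_nonneg _) hf.summable.norm]
    exact ENNReal.ofReal_lt_top
  refine ⟨hint, ?_⟩
  rw [integral_countable hint, ← hf.tsum_eq]
  refine tsum_congr fun y => ?_
  rw [Measure.real, hκ, ENNReal.toReal_ofReal (hq y), smul_eq_mul, mul_comm]

end Transition

/-! ### The Markov process of the form -/

section PathSpace

variable {X : Type*} [Countable X] [Nonempty X] [MeasurableSpace X] [DiscreteMeasurableSpace X]
  {R : FormOn (X → ℝ)} {μ : Measure X} {x₀ : X}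

theorem IsAtomicMap.exists_markovProcess (h : IsAtomicMap μ μ id) (hR : IsResistanceForm R)
    (hμ : IsAdaptedMeasure R μ x₀) :
    ∃ (T : ℝ≥0 → (Lp ℝ 2 μ →L[ℝ] Lp ℝ 2 μ)) (P : X → Measure (ℝ≥0 → X)),
      IsSemigroupOf (h.pullForm R) T ∧ IsMarkovProcess P (fun t ω => ω t) ∧
      ∀ (t : ℝ≥0) (u : Lp ℝ 2 μ),
        (∀ x, Integrable (fun ω : ℝ≥0 → X => u (ω t)) (P x)) ∧
        ((T t u : Lp ℝ 2 μ) : X → ℝ) =ᵐ[μ] fun x => ∫ ω, u (ω t) ∂(P x) := by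
  have hD := h.isDirichletForm_pullForm hR hμ
  obtain ⟨α, J, T, hα, hJ, hT, hlim⟩ := hD.isClosedForm.exists_semigroup
  obtain ⟨δ, hδ⟩ := h.exists_indicator
  obtain ⟨e, he⟩ := h.exists_pullDomain_eq hμ (hR.const 1)
  have he1 : ∀ x, (e : Lp ℝ 2 μ) x = 1 := congrFun (congrArg Subtype.val he)
  have hgen : IsGeneratorPair (h.pullForm R) (e : Lp ℝ 2 μ) 0 := by
    refine ⟨e.2, fun v => ?_⟩
    rw [inner_zero_left, neg_zero]
    exact (congrArg (fun f => R.form f (h.pullDomain v)) he).trans (hR.form_const_left 1 _)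
  -- Constants are annihilated by the generator, so the bound `‖T t e - e‖ ≤ t ‖A e‖` gives
  -- conservativeness.
  have hTe : ∀ t, T t (e : Lp ℝ 2 μ) = e := by
    intro t
    have h1 := norm_limit_sub_le hD.isClosedForm hα hJ hlim hgen t
    rw [norm_zero, mul_zero] at h1
    exact sub_eq_zero.1 (norm_le_zero_iff.1 h1)
  have hpos : ∀ t y x, 0 ≤ T t (δ y) x := by
    intro t y x
    refine ge_of_tendsto (((h.evalL x).continuous.tendsto _).comp (hlim t (δ y)))
      (Eventually.of_forall fun n => ?_)
    refine h.exp_yosida_apply_nonneg hD (hα n) (hJ n) t.2 (fun z => ?_) x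
    rw [hδ]
    by_cases hz : z = y <;> simp [hz]
  have hp := h.isTransitionFunction hδ hT.zero hT.add hpos he1 hTe
  have hfin := hp.isProbabilityMeasure_pathLaw
  choose P hP using fun x => exists_isProjectiveLimit (hp.isProjectiveMeasureFamily x)
  have hmarkov := hp.isMarkovProcess hP
  refine ⟨T, P, hT.isSemigroupOf, hmarkov, fun t u => ?_⟩
  have key : ∀ x, Integrable (fun ω : ℝ≥0 → X => u (ω t)) (P x) ∧
      ∫ ω, u (ω t) ∂(P x) = T t u x := by
    intro x
    have := hmarkov.isProbabilityMeasure x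
    have hm : Measurable fun ω : ℝ≥0 → X => ω t := measurable_pi_apply t
    have hum : AEStronglyMeasurable (fun y => u y) ((P x).map fun ω => ω t) :=
      (measurable_of_countable _).aestronglyMeasurable
    have hκ : ∀ y, (P x).map (fun ω => ω t) {y} = ENNReal.ofReal (T t (δ y) x) := fun y => by
      rw [Measure.map_apply hm MeasurableSet.of_discrete]
      exact measure_eval_eq hP x y t
    obtain ⟨h1, h2⟩ := integrable_and_integral_eq_of_hasSum (fun y => hpos t y x) hκ
      (h.hasSum_apply hδ (T t) u x)
    exact ⟨(integrable_map_measure hum hm.aemeasurable).1 h1,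
      (integral_map hm.aemeasurable hum).symm.trans h2⟩
  exact ⟨fun x => (key x).1, h.ae_eq_iff.2 fun x => ((key x).2).symm⟩

end PathSpace

end

theorem mainTheorem3 {X : Type*} [Countable X] [Nonempty X] [MeasurableSpace X]
    [DiscreteMeasurableSpace X] (R : FormOn (X → ℝ)) (hR : IsResistanceForm R) :
    ∃ μ : Measure X, IsFiniteMeasure μ ∧
      -- (i)
      (∀ x, 0 < μ {x}) ∧ (∀ f ∈ R.domain, MemLp f 2 μ) ∧
      -- (ii)
      (∃ D : FormOn (Lp ℝ 2 μ), IsL2Version R D ∧ IsDirichletForm D ∧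
        -- the associated Markov process
        ∃ (T : ℝ≥0 → (Lp ℝ 2 μ →L[ℝ] Lp ℝ 2 μ)) (P : X → Measure (ℝ≥0 → X)),
          IsSemigroupOf D T ∧ IsMarkovProcess P (fun t ω => ω t) ∧
          ∀ (t : ℝ≥0) (u : Lp ℝ 2 μ),
            (∀ x, Integrable (fun ω : ℝ≥0 → X => u (ω t)) (P x)) ∧
            ((T t u : Lp ℝ 2 μ) : X → ℝ) =ᵐ[μ] fun x => ∫ ω, u (ω t) ∂(P x)) ∧
      -- (iii)
      closure {a : BoundedFun X | ∃ f g : boundedDomain R,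
        a = toBoundedFun f + Complex.I • toBoundedFun g} = gelfandAlgebra R ∧
      Function.Injective (gelfandEmbedding R) ∧ DenseRange (gelfandEmbedding R) ∧
      (∀ f : boundedDomain R, Integrable (gelfand f) (μ.map (gelfandEmbedding R)) ∧
        ∫ x, f.1 x ∂μ = ∫ φ, gelfand f φ ∂(μ.map (gelfandEmbedding R))) ∧
      (∃ D : FormOn (Lp ℝ 2 (μ.map (gelfandEmbedding R))),
        IsTransferredForm D ∧ IsRegularDirichletForm D) ∧
      (TopologicalSpace.IsSeparable
          (Set.range (toBoundedFun : boundedDomain R → BoundedFun X)) →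
        SecondCountableTopology (GelfandSpectrum R)) := by
  let x₀ : X := Classical.arbitrary X
  obtain ⟨μ, hμ⟩ := hR.exists_isAdaptedMeasure x₀
  have hfin := hμ.isFiniteMeasure
  -- The same construction is applied to the identity of `X` and to `ι`.
  have hid := isAtomicMap_id hfin hμ.pos
  have hι := hR.isAtomicMap_gelfandEmbedding hμ
  exact ⟨μ, hfin, hμ.pos, fun f hf => IsAtomicMap.memLp_of_mem_domain hμ ⟨f, hf⟩,
    ⟨hid.pullForm R, hid.isL2Version R, hid.isDirichletForm_pullForm hR hμ,
      hid.exists_markovProcess hR hμ⟩,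
    hR.closure_complexSpan, hR.injective_gelfandEmbedding, denseRange_gelfandEmbedding,
    integrable_gelfand_and_integral_eq,
    ⟨hι.pullForm R, hι.isTransferredForm hR hμ, hι.isRegularDirichletForm hR hμ⟩,
    hR.secondCountable_gelfandSpectrum⟩
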